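/- Let $\phi$ be a nonnegative Borel measure on $(0,\infty)$ with $\int (y^2\wedge y)\,\phi(dy)<\infty$ and $\int_{(0,1)}y\,\phi(dy)=\infty$, and let $\psi(\xi)=\int_{(0,\infty)}(e^{-\xi y}-1+\xi y)\,\phi(dy)$, $\xi\ge 0$. Let $n\ge 1$, $h=2/(n+1)$, $\mathrm{Grid}_h=\{-1+hi: i=0,\dots,n+1\}$, and let $\mathcal G_j$ ($j\ge 0$) be the coefficients determined by $\psi((1-\xi)/h)=\sum_{j\ge0}\mathcal G_j\xi^j$, $|\xi|<1$; put $\mathcal G_j=0$ for $j<0$. **The free process.** Let $Y^h$ be a càdlàg continuous-time Markov chain (compound Poisson process) on $-1+h\mathbb Z$ which moves from $x$ to $x+(j-1)h$ with rate $\mathcal G_j$, $j\ge 0$, $j\ne 1$ (the diagonal entry of its rate matrix is $\mathcal G_1$), with an arbitrary initial law on $\mathrm{Grid}_h$. **Path maps.** For $f:[0,\infty)\to\mathbb R$ let $\mathrm D^l(f)$ equal $f$ before $\inf\{s>0:f(s)\le-1\}$ and $-1$ from then on; let $\mathrm D^r(f)$ equal $f$ before $\inf\{s>0:f(s)\ge1\}$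 and $1$ from then on. For $B\subset\mathbb R$ let $A_B(t)=\int_0^t\mathbf 1_{\{f(z)\in B\}}dz$ and $A_B^{-1}(t)=\inf\{s>0:A_B(s)>t\}$; put $\mathrm N^l(f)=f\circ A^{-1}_{(-1,\infty)}$ for $f$ spending infinite time in $(-1,\infty)$ and $\mathrm N^r(f)=f\circ A^{-1}_{(-\infty,1)}$ for $f$ spending infinite time in $(-\infty,1)$; the composition $\mathrm N^r(\mathrm N^l(f))$ is considered for $f$ spending infinite time in $(-1,1)$. Let $\mathrm N^{*,l}_{a}(f)(t)=f(t)-\inf_{s\le t}\{(f(s)-a)\wedge0\}$. Define $$Y^{\mathrm{DD},h}=\mathrm D^r(\mathrm D^l(Y^h)),\quad Y^{\mathrm{DN},h}=\mathrm D^l(\mathrm N^r(Y^h)),\quad Y^{\mathrm{ND},h}=\mathrm D^r(\mathrm N^l(Y^h)),$$ $$Y^{\mathrm{NN},h}=\mathrm N^r(\mathrm N^l(Y^h)),\quad Y^{\mathrm{N^*D},h}=\mathrm D^r(\mathrm N^{*,l}_{h-1}(Y^h)),\quad Y^{\mathrm{N^*N},h}=\mathrm N^r(\mathrm N^{*,l}_{h-1}(Y^h)).$$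 **The rate matrix.** For $\mathrm L\in\{\mathrm D,\mathrm N,\mathrm N^*\}$, $\mathrm R\in\{\mathrm D,\mathrm N\}$ let $G^{\mathrm{LR}}_{n+2}=(g_{i,j})_{0\le i,j\le n+1}$, where rows $0$ and $n+1$ vanish, row $1$ is $(d_0^l,b_1^l,\dots,b_{n-1}^l,b_n,d_{n+1}^r)$, and for $2\le i\le n$: $g_{i,0}=0$, $g_{i,j}=\mathcal G_{j-i+1}$ for $1\le j\le n-1$, $g_{i,n}=b^r_{n+1-i}$, $g_{i,n+1}=d^r_{n+2-i}$. The weights are: - $\mathrm L=\mathrm D$: $b_i^l=\mathcal G_i$ ($i\ge 0$), $d_0^l=\mathcal G_0$. - $\mathrm L=\mathrm N$: $b^l_0=0$, $b_i^l=-\sum_{j=0}^{i-1}\mathcal G_j$ ($i\ge1$), $d_0^l=0$. - $\mathrm L=\mathrm N^*$: $b^l_0=0$, $b_1^l=\mathcal G_0+\mathcal G_1$, $b_i^l=\mathcal G_i$ ($i\ge2$), $d_0^l=0$. - $\mathrm R=\mathrm D$: $b_i^r=\mathcal G_i$, $b_n=b_n^l$, $d_i^r=\sum_{j\ge i}\mathcal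 G_j$, except that $d_{n+1}^r=\sum_{j\ge n+1}b_j^l$ in the case $\mathrm{ND}$. - $\mathrm R=\mathrm N$: $b_i^r=-\sum_{j=0}^{i-1}\mathcal G_j$, $b_n=-\sum_{j=0}^{n-1}b_j^l$, $d_i^r=0$. **Claim.** For each of the six combinations $\mathrm{LR}$, almost surely the path of $Y^h$ lies in the domain of the path maps used (so $Y^{\mathrm{LR},h}$ is well defined), and $Y^{\mathrm{LR},h}$ is a càdlàg continuous-time Markov chain with values in $\mathrm{Grid}_h$ and transition rate matrix $G^{\mathrm{LR}}_{n+2}$ (index $i$ standing for the point $-1+hi$). Moreover, almost surely, $Y^{\mathrm{LR},h}_0=Y^h_0$ whenever ($Y_0^h\ne-1$ or $\mathrm L=\mathrm D$) and ($Y_0^h\neq 1$ or $\mathrm R=\mathrm D$). Here a continuous-time Markov chain with rate matrix $Q$ on a countable set $S$ is a process whose finite-dimensional laws are given by its initial law and stochastic matrices $p(t)$, $t\ge0$, with $p(0)=I$ and $p'(t)=Q\,p(t)$. -/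

import Mathlib

open MeasureTheory Filter Topology
open scoped NNReal ENNReal

noncomputable section

namespace GrunwaldChain

/-! ### The Laplace exponent and its Gruenwald type coefficients -/

/-- Hypothesis (H0) on the jump measure. Only the restriction of `φ` to `(0, ∞)` is ever used. -/
structure H0 (φ : Measure ℝ) : Prop where
  integrable : IntegrableOn (fun y : ℝ => min (y ^ 2) y) (Set.Ioi 0) φ
  unbounded_variation : ∫⁻ y in Set.Ioo (0 : ℝ) 1, ENNReal.ofReal y ∂φ = ⊤

/-- The Laplace exponent `ψ(ξ) = ∫_{(0,∞)} (e^{-ξ y} - 1 + ξ y) φ(dy)`, for real `ξ ≥ 0`. -/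
def laplaceExponent (φ : Measure ℝ) (ξ : ℝ) : ℝ :=
  ∫ y in Set.Ioi (0 : ℝ), (Real.exp (-ξ * y) - 1 + ξ * y) ∂φ

/-- The coefficients `𝒢_{j,h}`, determined by `ψ((1-ξ)/h) = ∑_j 𝒢_{j,h} ξ^j` for `|ξ| < 1`,
i.e. the Taylor coefficients at `0` of the left-hand side. -/
def coeff (φ : Measure ℝ) (h : ℝ) (j : ℕ) : ℝ :=
  iteratedDeriv j (fun ξ : ℝ => laplaceExponent φ ((1 - ξ) / h)) 0 / (j.factorial : ℝ)

/-- The coefficients indexed by the integers, with `𝒢_{-j,h} = 0` for `j ≥ 1`. -/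
def coeffInt (φ : Measure ℝ) (h : ℝ) (k : ℤ) : ℝ :=
  if 0 ≤ k then coeff φ h k.toNat else 0

/-- The bi-infinite transition rate matrix `G_h` of `Y^h`: from `x` to `x + (j-1)h` the entry is
`𝒢_{j,h}`. The integer `i` stands for the point `-1 + i h`. -/
def freeRates (φ : Measure ℝ) (h : ℝ) (i j : ℤ) : ℝ := coeffInt φ h (j - i + 1)

/-! ### Boundary conditions and the finite transition rate matrix -/

/-- Left boundary conditions: killing, fast-forwarding, reflecting. -/
inductive LeftBC
  | D
  | N
  | Nstar
  deriving DecidableEq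

/-- Right boundary conditions: killing, fast-forwarding. -/
inductive RightBC
  | D
  | N
  deriving DecidableEq

/-- The mesh `h = 2/(n+1)`. -/
def mesh (n : ℕ) : ℝ := 2 / ((n : ℝ) + 1)

/-- The point `-1 + k h` of the lattice `-1 + h ℤ`. -/
def latticePoint (n : ℕ) (k : ℤ) : ℝ := -1 + mesh n * (k : ℝ)

/-- The `i`-th point of `Grid_h`, `i = 0, …, n+1`. -/
def gridPoint (n : ℕ) (i : Fin (n + 2)) : ℝ := -1 + mesh n * ((i : ℕ) : ℝ)

/-- The weight `b_i^l`. -/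
def bLeft (φ : Measure ℝ) (h : ℝ) (L : LeftBC) (i : ℕ) : ℝ :=
  match L with
  | .D => coeff φ h i
  | .N => if i = 0 then 0 else -∑ j ∈ Finset.range i, coeff φ h j
  | .Nstar =>
      if i = 0 then 0
      else if i = 1 then ∑ j ∈ Finset.range 2, coeff φ h j
      else coeff φ h i

/-- The weight `d_0^l`. -/
def dLeft (φ : Measure ℝ) (h : ℝ) (L : LeftBC) : ℝ :=
  match L with
  | .D => coeff φ h 0
  | .N => 0
  | .Nstar => 0

/-- The weight `b_i^r`. -/
def bRight (φ : Measure ℝ) (h : ℝ) (R : RightBC) (i : ℕ) : ℝ :=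
  match R with
  | .D => coeff φ h i
  | .N => -∑ j ∈ Finset.range i, coeff φ h j

/-- The corner weight `b_n`. -/
def bCorner (φ : Measure ℝ) (h : ℝ) (L : LeftBC) (R : RightBC) (n : ℕ) : ℝ :=
  match R with
  | .D => bLeft φ h L n
  | .N => -∑ j ∈ Finset.range n, bLeft φ h L j

/-- The weight `d_i^r`, including the exceptional value of `d_{n+1}^r` in the case `ND`. -/
def dRight (φ : Measure ℝ) (h : ℝ) (L : LeftBC) (R : RightBC) (n i : ℕ) : ℝ :=
  match R with
  | .D =>
      if L = LeftBC.N ∧ i = n + 1 then ∑' j : ℕ, bLeft φ h LeftBC.N (n + 1 + j)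
      else ∑' j : ℕ, coeff φ h (i + j)
  | .N => 0

/-- The transition rate matrix `G_{n+2}^{LR}`, with rows and columns numbered `0, …, n+1`. -/
def gridRates (φ : Measure ℝ) (L : LeftBC) (R : RightBC) (n : ℕ) :
    Matrix (Fin (n + 2)) (Fin (n + 2)) ℝ :=
  fun i j =>
    if (i : ℕ) = 0 ∨ (i : ℕ) = n + 1 then 0
    else if (i : ℕ) = 1 then
      if (j : ℕ) = 0 then dLeft φ (mesh n) L
      else if (j : ℕ) = n + 1 then dRight φ (mesh n) L R n (n + 1)
      else if (j : ℕ) = n then bCorner φ (mesh n) L R n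
      else bLeft φ (mesh n) L j
    else
      if (j : ℕ) = 0 then 0
      else if (j : ℕ) = n + 1 then dRight φ (mesh n) L R n (n + 2 - i)
      else if (j : ℕ) = n then bRight φ (mesh n) R (n + 1 - i)
      else coeffInt φ (mesh n) ((j : ℤ) - (i : ℤ) + 1)

/-! ### Path maps -/

/-- Right continuous with left limits. -/
def IsCadlag (f : ℝ≥0 → ℝ) : Prop :=
  ∀ t, ContinuousWithinAt f (Set.Ici t) t ∧ ∃ l, Tendsto f (𝓝[<] t) (𝓝 l)

/-- First exit time `τ_B^f = inf {s > 0 : f(s) ∉ B}` in `[0, ∞]`. -/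
def exitTime (B : Set ℝ) (f : ℝ≥0 → ℝ) : ℝ≥0∞ :=
  ⨅ (s : ℝ≥0) (_ : 0 < s ∧ f s ∉ B), (s : ℝ≥0∞)

open Classical in
/-- The left killing map `D^l`. -/
def killLeft (f : ℝ≥0 → ℝ) (t : ℝ≥0) : ℝ :=
  if (t : ℝ≥0∞) < exitTime (Set.Ioi (-1)) f then f t else -1

open Classical in
/-- The right killing map `D^r`. -/
def killRight (f : ℝ≥0 → ℝ) (t : ℝ≥0) : ℝ :=
  if (t : ℝ≥0∞) < exitTime (Set.Iio 1) f then f t else 1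

/-- The time `A_B^f(t) = ∫_0^t 1_{f(z) ∈ B} dz` spent by `f` in `B` up to time `t`. -/
def occupation (B : Set ℝ) (f : ℝ≥0 → ℝ) (t : ℝ≥0) : ℝ≥0∞ :=
  volume {z : ℝ | 0 ≤ z ∧ z ≤ t ∧ f z.toNNReal ∈ B}

/-- `f` spends an infinite amount of time in `B`. -/
def SpendsInfiniteTime (B : Set ℝ) (f : ℝ≥0 → ℝ) : Prop :=
  volume {z : ℝ | 0 ≤ z ∧ f z.toNNReal ∈ B} = ⊤

/-- The path `f` run only while it is in `B`: `t ↦ f(A⁻¹(t))`,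
`A⁻¹(t) = inf {s > 0 : A_B^f(s) > t}`. Meaningful if `f` spends an infinite amount of time in `B`
(then the set is nonempty for every `t`). -/
def fastForward (B : Set ℝ) (f : ℝ≥0 → ℝ) (t : ℝ≥0) : ℝ :=
  f (sInf {s : ℝ≥0 | 0 < s ∧ (t : ℝ≥0∞) < occupation B f s})

/-- The left fast-forwarding map `N^l` at `-1`. -/
def ffLeft (f : ℝ≥0 → ℝ) : ℝ≥0 → ℝ := fastForward (Set.Ioi (-1)) f

/-- The right fast-forwarding map `N^r` at `1`. -/
def ffRight (f : ℝ≥0 → ℝ) : ℝ≥0 → ℝ := fastForward (Set.Iio 1) f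

/-- Reflection on `[a, ∞)`: `t ↦ f(t) - inf_{s ≤ t} ((f(s) - a) ∧ 0)`. -/
def reflectLeft (a : ℝ) (f : ℝ≥0 → ℝ) (t : ℝ≥0) : ℝ :=
  f t - ⨅ s : Set.Iic t, min (f s - a) 0

/-- The path map that turns `Y^h` into `Y^{LR,h}`. -/
def modify (L : LeftBC) (R : RightBC) (n : ℕ) (f : ℝ≥0 → ℝ) : ℝ≥0 → ℝ :=
  match L, R with
  | .D, .D => killRight (killLeft f)
  | .D, .N => killLeft (ffRight f)
  | .N, .D => killRight (ffLeft f)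
  | .N, .N => ffRight (ffLeft f)
  | .Nstar, .D => killRight (reflectLeft (mesh n - 1) f)
  | .Nstar, .N => ffRight (reflectLeft (mesh n - 1) f)

/-- The path `f` lies in the domain of the path map `modify L R n`. -/
def InDomain (L : LeftBC) (R : RightBC) (n : ℕ) (f : ℝ≥0 → ℝ) : Prop :=
  match L, R with
  | .D, .D => True
  | .D, .N => SpendsInfiniteTime (Set.Iio 1) f
  | .N, .D => SpendsInfiniteTime (Set.Ioi (-1)) f
  | .N, .N => SpendsInfiniteTime (Set.Ioo (-1) 1) f
  | .Nstar, .D => True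
  | .Nstar, .N => SpendsInfiniteTime (Set.Iio 1) (reflectLeft (mesh n - 1) f)

/-! ### Continuous-time Markov chains -/

/-- `p` is a transition function with rate matrix `Q`: the matrices `p t` are stochastic,
`p 0` is the identity, and the backward equation `p' = Q p` holds on `[0, ∞)`. If `Q` has bounded
rates, `p t` is `e^{tQ}`. -/
structure IsTransitionFunction {S : Type*} (Q : S → S → ℝ) (p : ℝ≥0 → S → S → ℝ) : Prop where
  nonneg : ∀ t i j, 0 ≤ p t i j
  hasSum_one : ∀ t i, HasSum (p t i) 1
  zero_self : ∀ i, p 0 i i = 1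
  zero_ne : ∀ i j, i ≠ j → p 0 i j = 0
  backward : ∀ (t : ℝ≥0) (i j : S),
    HasDerivWithinAt (fun s : ℝ => p s.toNNReal i j) (∑' k, Q i k * p t k j) (Set.Ici 0) t

/-- The real-valued process `X` is, under `P`, a continuous-time Markov chain with càdlàg paths
on the state space `{e i : i ∈ S}` (with `S` countable, `e` injective) and with transition rate
matrix `Q`. The initial law is arbitrary. -/
structure IsMarkovChain {Ω S : Type*} [MeasurableSpace Ω] (P : Measure Ω)
    (e : S → ℝ) (Q : S → S → ℝ) (X : ℝ≥0 → Ω → ℝ) : Prop where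
  aemeasurable : ∀ t, AEMeasurable (X t) P
  mem_range : ∀ᵐ ω ∂P, ∀ t, X t ω ∈ Set.range e
  cadlag : ∀ᵐ ω ∂P, IsCadlag (fun t => X t ω)
  markov : ∃ p : ℝ≥0 → S → S → ℝ, IsTransitionFunction Q p ∧
    ∀ (k : ℕ) (t : Fin (k + 1) → ℝ≥0), Monotone t → ∀ s : Fin (k + 1) → S,
      P.real {ω | ∀ i, X (t i) ω = e (s i)} =
        P.real {ω | X (t 0) ω = e (s 0)} *
          ∏ i : Fin k, p (t i.succ - t i.castSucc) (s i.castSucc) (s i.succ)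

end GrunwaldChain

end

noncomputable section

namespace GrunwaldChain

section

/-! ### The coefficients of the Laplace exponent -/

/-! The lattice points are indexed by `ℤ`, with `0` for `-1` and `n + 1` for `1`. At `z = y/h` the
kernel of `ψ((1-ξ)/h)` has as Taylor coefficients the Poisson weights of parameter `z`, corrected at
the indices `0` and `1` only. Hence `∑ 𝒢_j = 0` and `∑ j 𝒢_j = 0`, with `𝒢_0 > 0` and `𝒢_j ≥ 0` for
`j ≥ 2` (`isCenteredSkipFree_coeff`): the free process is a centred walk that goes down by single
steps. The rest uses only this.

The modified process is identified through its martingale problem. The walk `X` with generator `G`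
makes `F(X_t) - ∫ G F(X_r) dr` a martingale for every bounded `F` (`HasTransition.martPair`), and
each path map acts on such pairs `(F, h)` of a function and its compensator. Killing is stopping at
an optional time: if `F` is constant off the set, `h` is replaced by zero there
(`MartPair.killPath`). Fast-forwarding is a time change and keeps every pair whose `h` vanishes off
the set (`MartPair.ffPath`). Reflection is, over a short interval, the map `z ↦ max (z + increment)
1` up to an event of quadratically small probability, on which the walk changes twice
(`HasTransition.martPair_reflPath`).

A function `g` on the grid is therefore extended to `ℤ` so that its compensator vanishes wherever
the path is cut out. On the right a constant extension does this. For fast-forwarding on the left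
the extension must be harmonic on the nonpositive integers; the walk returns to the positive ones
through ascending ladder heights, whose law is explicit, and the harmonic extension is the average
`ladderExt` over them. Summation by parts gives its generator at `1`
(`IsCenteredSkipFree.walkGen_ladderExt_one`), and the weights that come out are the `b_i^l` of the
case `N`. `mulVec_gridRates_eq` matches every row of the matrix with these generators. On a finite
set the martingale problem yields the forward equation, a linear ODE, whose uniqueness forces the
transition function `e^{tQ}` (`measureReal_inter_eq_expMatrix`).

Fast-forwarding needs infinite occupation times. These come from a Lyapunov criterion
(`ae_occInfinite`): bounded functions that vanish on the favoured side, are nearly superharmonic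
there, are superharmonic on the other side, and tend to zero at the starting point. To the right of
`n` a concave parabola serves (`rightLyap`), to the left of `1` a truncation of an unbounded
solution of the inhomogeneous ladder equation (`leftLyap`), and for the walk already fast-forwarded
at the left the ladder extension of the parabola. -/

/-- The jump rates of a centred random walk on `ℤ` that is skip free to the left: `c j` is the rate
of the jump `j - 1`, and `c 1` is the diagonal entry. -/
structure IsCenteredSkipFree (c : ℕ → ℝ) : Prop where
  zero_pos : 0 < c 0
  nonneg : ∀ j, 2 ≤ j → 0 ≤ c j
  hasSum : HasSum c 0
  hasSum_mul : HasSum (fun j : ℕ => (j : ℝ) * c j) 0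

/-- The `k`-th derivative of `ξ ↦ e^{-(1-ξ) z} - 1 + (1-ξ) z`. -/
def expKernel (k : ℕ) (ξ z : ℝ) : ℝ :=
  z ^ k * Real.exp (-(1 - ξ) * z) +
    (if k = 0 then -1 + (1 - ξ) * z else if k = 1 then -z else 0)

theorem hasDerivAt_expKernel (k : ℕ) (ξ z : ℝ) :
    HasDerivAt (fun ξ => expKernel k ξ z) (expKernel (k + 1) ξ z) ξ := by
  have h1 : HasDerivAt (fun ξ : ℝ => -(1 - ξ) * z) z ξ := by
    have := (((hasDerivAt_id ξ).const_sub 1).neg).mul_const z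
    simpa using this
  have h2 := (h1.exp).const_mul (z ^ k)
  rcases k with _ | _ | k
  · have h3 : HasDerivAt (fun ξ : ℝ => -1 + (1 - ξ) * z) (-z) ξ := by
      have := ((((hasDerivAt_id ξ).const_sub 1)).mul_const z).const_add (-1)
      simpa using this
    refine (h2.add h3).congr_deriv ?_
    simp [expKernel]
    ring
  · refine (h2.add (hasDerivAt_const ξ (-z))).congr_deriv ?_
    simp [expKernel]
    ring
  · refine (h2.add (hasDerivAt_const ξ (0:ℝ))).congr_deriv ?_
    simp [expKernel]
    ring

/-- From `e^u ≥ 1 + u` one has `e^{-u} ≤ 1/(1+u)`, and `(1 - u + u²)(1 + u) = 1 + u³ ≥ 1`. -/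
theorem exp_neg_le_quadratic {u : ℝ} (hu : 0 ≤ u) : Real.exp (-u) ≤ 1 - u + u ^ 2 := by
  have h1 := Real.add_one_le_exp u
  have h2 : Real.exp (-u) * Real.exp u = 1 := by rw [← Real.exp_add]; simp
  have h3 := Real.exp_pos (-u)
  have h4 : Real.exp (-u) * (u + 1) ≤ 1 := by nlinarith
  by_contra! h
  have : (1 - u + u ^ 2) * (u + 1) < Real.exp (-u) * (u + 1) := by
    apply mul_lt_mul_of_pos_right h; linarith
  nlinarith [pow_nonneg hu 3]

theorem pow_mul_exp_neg_le (m : ℕ) {z ξ : ℝ} (hz : 0 ≤ z) (hξ : ξ ≤ 1 / 2) :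
    z ^ m * Real.exp (-(1 - ξ) * z) ≤ 2 ^ m * m.factorial := by
  have h1 := Real.pow_div_factorial_le_exp (x := z / 2) (by positivity) m
  have h2 : Real.exp (-(1 - ξ) * z) ≤ Real.exp (-(z / 2)) := by
    apply Real.exp_le_exp.2; nlinarith
  have h3 : Real.exp (-(z/2)) * Real.exp (z/2) = 1 := by rw [← Real.exp_add]; simp
  have hf : (0:ℝ) < m.factorial := by positivity
  rw [div_le_iff₀ hf, div_pow, div_le_iff₀ (by positivity)] at h1
  calc z ^ m * Real.exp (-(1 - ξ) * z)
      ≤ (Real.exp (z/2) * m.factorial * 2 ^ m) * Real.exp (-(z/2)) := by gcongr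
    _ = (Real.exp (-(z/2)) * Real.exp (z/2)) * (2 ^ m * m.factorial) := by ring
    _ = _ := by rw [h3, one_mul]

/-- The domination for differentiating under the integral sign: the bound is uniform in `|ξ| < 1/2`
and has the shape that `H0` makes integrable. -/
theorem abs_expKernel_le (k : ℕ) : ∃ C : ℝ, 0 ≤ C ∧ ∀ ξ z : ℝ, -(1 / 2) < ξ → ξ < 1 / 2 → 0 ≤ z →
    |expKernel k ξ z| ≤ C * min (z ^ 2) z := by
  rcases k with _ | _ | k
  · refine ⟨4, by norm_num, fun ξ z h1 h2 hz => ?_⟩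
    have hu : 0 ≤ (1 - ξ) * z := mul_nonneg (by linarith) hz
    have h3 := exp_neg_le_quadratic hu
    have h4 : Real.exp (-((1 - ξ) * z)) ≤ 1 := Real.exp_le_one_iff.2 (by linarith)
    have h5 := Real.add_one_le_exp (-((1 - ξ) * z))
    simp only [expKernel, pow_zero, one_mul, if_true, neg_mul]
    rw [abs_of_nonneg (by linarith), mul_min_of_nonneg _ _ (by norm_num)]
    refine le_min ?_ (by nlinarith)
    have : ((1 - ξ) * z) ^ 2 ≤ 4 * z ^ 2 := by
      rw [mul_pow]; gcongr; nlinarith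
    linarith
  · refine ⟨2, by norm_num, fun ξ z h1 h2 hz => ?_⟩
    have hu : 0 ≤ (1 - ξ) * z := mul_nonneg (by linarith) hz
    have h4 : Real.exp (-((1 - ξ) * z)) ≤ 1 := Real.exp_le_one_iff.2 (by linarith)
    have h5 := Real.add_one_le_exp (-((1 - ξ) * z))
    have h6 := Real.exp_pos (-((1 - ξ) * z))
    simp only [expKernel, zero_add, pow_one, one_ne_zero, if_false, if_true, neg_mul]
    rw [abs_of_nonpos (by nlinarith), mul_min_of_nonneg _ _ (by norm_num)]
    refine le_min ?_ ?_
    · have : z * (1 - Real.exp (-((1 - ξ) * z))) ≤ z * (2 * z) := by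
        gcongr; nlinarith
      nlinarith
    · nlinarith
  · refine ⟨2 ^ (k + 1) * (k + 1).factorial + 2 ^ k * k.factorial, by positivity,
      fun ξ z h1 h2 hz => ?_⟩
    have e1 := pow_mul_exp_neg_le k hz h2.le
    have e2 := pow_mul_exp_neg_le (k + 1) hz h2.le
    have p1 : (0:ℝ) ≤ 2 ^ (k + 1) * (k + 1).factorial := by positivity
    have p2 : (0:ℝ) ≤ 2 ^ k * k.factorial := by positivity
    have hp := Real.exp_pos (-(1 - ξ) * z)
    simp only [expKernel, Nat.add_eq_zero_iff, one_ne_zero, and_false, if_false, Nat.add_eq_right,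
      add_zero]
    rw [abs_of_nonneg (by positivity), mul_min_of_nonneg _ _ (by positivity)]
    refine le_min ?_ ?_
    · calc z ^ (k + 1 + 1) * Real.exp (-(1 - ξ) * z)
          = (z ^ k * Real.exp (-(1 - ξ) * z)) * z ^ 2 := by ring
        _ ≤ _ := by gcongr; linarith
    · calc z ^ (k + 1 + 1) * Real.exp (-(1 - ξ) * z)
          = (z ^ (k + 1) * Real.exp (-(1 - ξ) * z)) * z := by ring
        _ ≤ _ := by gcongr; linarith

theorem measurable_expKernel (k : ℕ) (ξ : ℝ) : Measurable (expKernel k ξ) := by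
  unfold expKernel
  split_ifs <;> fun_prop

section Laplace

variable {φ : Measure ℝ} {w : ℝ}

theorem integrableOn_min_scaled (hφ : H0 φ) (hw : 0 < w) :
    IntegrableOn (fun y => min ((w * y) ^ 2) (w * y)) (Set.Ioi 0) φ := by
  refine (hφ.integrable.const_mul (w ^ 2 + w)).mono' (by fun_prop) ?_
  filter_upwards [ae_restrict_mem measurableSet_Ioi] with y hy
  have hy : 0 < y := hy
  rw [Real.norm_eq_abs, abs_of_nonneg (by positivity), mul_min_of_nonneg _ _ (by positivity)]
  refine le_min ((min_le_left _ _).trans ?_) ((min_le_right _ _).trans ?_)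
  · nlinarith [mul_pos hw (pow_pos hy 2)]
  · nlinarith [mul_pos (pow_pos hw 2) hy]

theorem integrableOn_expKernel (hφ : H0 φ) (hw : 0 < w) (k : ℕ) {ξ : ℝ} (h1 : -(1 / 2) < ξ)
    (h2 : ξ < 1 / 2) : IntegrableOn (fun y => expKernel k ξ (w * y)) (Set.Ioi 0) φ := by
  obtain ⟨C, hC, h⟩ := abs_expKernel_le k
  refine ((integrableOn_min_scaled hφ hw).const_mul C).mono'
    ((measurable_expKernel k ξ).comp (measurable_const_mul w)).aestronglyMeasurable ?_
  filter_upwards [ae_restrict_mem measurableSet_Ioi] with y hy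
  exact h ξ _ h1 h2 (mul_nonneg hw.le (le_of_lt hy))

/-- Only `ξ = 0` is needed later, but the induction differentiates the previous formula and so needs
it on a neighbourhood. -/
theorem iteratedDeriv_laplaceExponent (hφ : H0 φ) {h : ℝ} (hh : 0 < h) (k : ℕ) :
    ∀ ξ ∈ Set.Ioo (-(1 / 2) : ℝ) (1 / 2),
      iteratedDeriv k (fun ξ : ℝ => laplaceExponent φ ((1 - ξ) / h)) ξ =
        ∫ y in Set.Ioi (0 : ℝ), expKernel k ξ (h⁻¹ * y) ∂φ := by
  have hw : 0 < h⁻¹ := inv_pos.2 hh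
  induction k with
  | zero =>
    intro ξ _
    simp only [iteratedDeriv_zero, laplaceExponent]
    congr 1; ext y
    simp only [expKernel, pow_zero, one_mul, if_true]
    have : -((1 - ξ) / h) * y = -(1 - ξ) * (h⁻¹ * y) := by rw [div_eq_mul_inv]; ring
    rw [this, div_eq_mul_inv]; ring
  | succ k ih =>
    intro ξ hξ
    rw [iteratedDeriv_succ]
    have hU : Set.Ioo (-(1 / 2) : ℝ) (1 / 2) ∈ 𝓝 ξ := isOpen_Ioo.mem_nhds hξ
    have e : iteratedDeriv k (fun ξ : ℝ => laplaceExponent φ ((1 - ξ) / h)) =ᶠ[𝓝 ξ]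
        fun ξ => ∫ y in Set.Ioi (0 : ℝ), expKernel k ξ (h⁻¹ * y) ∂φ := by
      filter_upwards [hU] with x hx using ih x hx
    rw [e.deriv_eq]
    obtain ⟨C, hC, hb⟩ := abs_expKernel_le (k + 1)
    refine (hasDerivAt_integral_of_dominated_loc_of_deriv_le hU
      (bound := fun y => C * min ((h⁻¹ * y) ^ 2) (h⁻¹ * y))
      (F' := fun ξ y => expKernel (k + 1) ξ (h⁻¹ * y))
      (Eventually.of_forall fun x =>
        ((measurable_expKernel k x).comp (measurable_const_mul _)).aestronglyMeasurable)
      (integrableOn_expKernel hφ hw k hξ.1 hξ.2)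
      ((measurable_expKernel (k + 1) ξ).comp (measurable_const_mul _)).aestronglyMeasurable
      ?_ ((integrableOn_min_scaled hφ hw).const_mul C) ?_).2.deriv
    · filter_upwards [ae_restrict_mem measurableSet_Ioi] with y hy x hx
      exact hb x _ hx.1 hx.2 (mul_nonneg hw.le (le_of_lt hy))
    · exact Eventually.of_forall fun y x _ => hasDerivAt_expKernel k x _

theorem coeff_eq_integral (hφ : H0 φ) {h : ℝ} (hh : 0 < h) (k : ℕ) :
    coeff φ h k = ∫ y in Set.Ioi (0 : ℝ), expKernel k 0 (h⁻¹ * y) / (k.factorial : ℝ) ∂φ := by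
  rw [coeff, iteratedDeriv_laplaceExponent hφ hh k 0 (by norm_num), integral_div]

/-- The Poisson weights `z^k e^{-z} / k!` sum to `1`, and the corrections `-1 + z` and `-z` at the
indices `0` and `1` cancel this. -/
theorem hasSum_expKernel_zero (z : ℝ) :
    HasSum (fun k : ℕ => expKernel k 0 z / (k.factorial : ℝ)) 0 := by
  have h1 := (NormedSpace.expSeries_div_hasSum_exp z).mul_right (Real.exp (-z))
  have h2 : HasSum (fun k : ℕ => if k = 0 then -1 + z else if k = 1 then -z else 0) (-1) := by
    have := hasSum_sum_of_ne_finset_zero (L := .unconditional ℕ)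
      (f := fun k : ℕ => if k = 0 then -1 + z else if k = 1 then -z else 0)
      (s := Finset.range 2) (by
        intro k hk
        simp only [Finset.mem_range, not_lt] at hk
        rw [if_neg (by omega), if_neg (by omega)])
    simpa [Finset.sum_range_succ] using this
  have h3 := h1.add h2
  rw [← Real.exp_eq_exp_ℝ, ← Real.exp_add] at h3
  convert! h3 using 1
  · ext k
    rcases k with _ | _ | k
    · simp [expKernel]
    · simp [expKernel]
    · simp only [expKernel, Nat.add_eq_zero_iff, one_ne_zero, and_false, if_false, Nat.add_eq_right,
        add_zero, sub_zero, neg_mul, one_mul]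
      ring
  · simp

/-- The Poisson mean `z` is cancelled by the correction `-z` at index `1`; the correction at index
`0` has no weight. -/
theorem hasSum_mul_expKernel_zero (z : ℝ) :
    HasSum (fun k : ℕ => (k : ℝ) * (expKernel k 0 z / (k.factorial : ℝ))) 0 := by
  rw [← hasSum_nat_add_iff' 1]
  have h1 := (NormedSpace.expSeries_div_hasSum_exp z).mul_right (z * Real.exp (-z))
  have h2 : HasSum (fun k : ℕ => if k = 0 then -z else 0) (-z) := by
    convert! hasSum_ite_eq 0 (-z) using 1
  have h3 := h1.add h2
  rw [← Real.exp_eq_exp_ℝ] at h3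
  convert! h3 using 1
  · ext k
    have hf : (((k + 1).factorial : ℕ) : ℝ) = (k + 1 : ℝ) * k.factorial := by
      rw [Nat.factorial_succ]; push_cast; ring
    have hk : (k.factorial : ℝ) ≠ 0 := by positivity
    have hk' : (k + 1 : ℝ) ≠ 0 := by positivity
    rw [hf]
    rcases k with _ | k
    · simp [expKernel]
    · simp only [expKernel, Nat.add_eq_zero_iff, one_ne_zero, and_false, if_false, Nat.add_eq_right,
        add_zero, sub_zero, neg_mul, one_mul]
      push_cast at *
      field_simp
      ring
  · have : Real.exp z * Real.exp (-z) = 1 := by rw [← Real.exp_add]; simp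
    simp only [Finset.range_one, Finset.sum_singleton, Nat.cast_zero, zero_mul, sub_zero]
    linear_combination (-z) * this

theorem expKernel_zero_nonneg {k : ℕ} (hk : k ≠ 1) {z : ℝ} (hz : 0 ≤ z) : 0 ≤ expKernel k 0 z := by
  rcases k with _ | _ | k
  · have := Real.add_one_le_exp (-z)
    simp only [expKernel, pow_zero, one_mul, if_true, sub_zero, neg_mul]
    linarith
  · omega
  · have hp := Real.exp_pos (-(1 - 0) * z)
    simp only [expKernel, Nat.add_eq_zero_iff, one_ne_zero, and_false, if_false, Nat.add_eq_right,
      add_zero]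
    positivity

theorem expKernel_one_nonpos {z : ℝ} (hz : 0 ≤ z) : expKernel 1 0 z ≤ 0 := by
  have h4 : Real.exp (-z) ≤ 1 := Real.exp_le_one_iff.2 (by linarith)
  simp only [expKernel, pow_one, one_ne_zero, if_false, if_true, sub_zero, neg_mul, one_mul]
  nlinarith

/-- A sequence whose only nonpositive term has index `1` and whose sum vanishes. -/
theorem hasSum_abs_of_hasSum_zero {b : ℕ → ℝ} (hb : ∀ k, k ≠ 1 → 0 ≤ b k) (hb1 : b 1 ≤ 0)
    (h : HasSum b 0) : HasSum (fun k => |b k|) (-2 * b 1) := by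
  have h2 : HasSum (fun k : ℕ => if k = 1 then -2 * b 1 else 0) (-2 * b 1) := by
    convert! hasSum_ite_eq 1 (-2 * b 1) using 1
  convert! h.add h2 using 1
  · ext k
    by_cases hk : k = 1
    · subst hk; rw [abs_of_nonpos hb1]; simp; ring
    · rw [abs_of_nonneg (hb k hk)]; simp [hk]
  · simp

/-- Sum and integral may be exchanged because a null sum with a single nonpositive term has absolute
sum `-2` times this term, and the kernel of index `1` is integrable. -/
theorem hasSum_integral_zero_of_kernel (hφ : H0 φ) (hw : 0 < w) {r : ℕ → ℝ}
    (hr : ∀ k, 0 ≤ r k) (hr0 : ∀ z, HasSum (fun k : ℕ => r k * expKernel k 0 z) 0) :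
    HasSum (fun k => ∫ y in Set.Ioi (0 : ℝ), r k * expKernel k 0 (w * y) ∂φ) 0 := by
  have key : ∀ z, 0 ≤ z → HasSum (fun k => |r k * expKernel k 0 z|) (-2 * (r 1 * expKernel 1 0 z)) :=
    fun z hz => hasSum_abs_of_hasSum_zero
      (fun k hk => mul_nonneg (hr k) (expKernel_zero_nonneg hk hz))
      (mul_nonpos_of_nonneg_of_nonpos (hr 1) (expKernel_one_nonpos hz)) (hr0 z)
  have hpos : ∀ᵐ y ∂(φ.restrict (Set.Ioi 0)), 0 ≤ w * y := by
    filter_upwards [ae_restrict_mem measurableSet_Ioi] with y hy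
      using mul_nonneg hw.le (le_of_lt hy)
  have := hasSum_integral_of_dominated_convergence (μ := φ.restrict (Set.Ioi 0))
    (F := fun k y => r k * expKernel k 0 (w * y)) (f := fun _ => (0 : ℝ))
    (fun k y => |r k * expKernel k 0 (w * y)|)
    (fun k => (((measurable_expKernel k 0).comp (measurable_const_mul w)).const_mul
      (r k)).aestronglyMeasurable)
    (fun k => Eventually.of_forall fun y => le_rfl)
    (hpos.mono fun y hy => (key _ hy).summable) ?_
    (Eventually.of_forall fun y => hr0 _)
  · simpa using this
  · refine (((integrableOn_expKernel hφ hw 1 (ξ := 0) (by norm_num) (by norm_num)).const_mul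
      (r 1)).const_mul (-2)).congr (hpos.mono fun y hy => ?_)
    exact (key _ hy).tsum_eq.symm

theorem isCenteredSkipFree_coeff (hφ : H0 φ) {h : ℝ} (hh : 0 < h) :
    IsCenteredSkipFree (coeff φ h) := by
  have hw : 0 < h⁻¹ := inv_pos.2 hh
  have e : ∀ k, coeff φ h k =
      ∫ y in Set.Ioi (0 : ℝ), ((k.factorial : ℝ))⁻¹ * expKernel k 0 (h⁻¹ * y) ∂φ := fun k => by
    rw [coeff_eq_integral hφ hh]; congr 1; ext y; rw [div_eq_inv_mul]
  have hpos : ∀ᵐ y ∂(φ.restrict (Set.Ioi 0)), 0 < h⁻¹ * y := by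
    filter_upwards [ae_restrict_mem measurableSet_Ioi] with y hy using mul_pos hw hy
  refine ⟨?_, ?_, ?_, ?_⟩
  · rw [coeff_eq_integral hφ hh]
    simp only [Nat.factorial_zero, Nat.cast_one, div_one]
    rw [integral_pos_iff_support_of_nonneg_ae
      (hpos.mono fun y hy => expKernel_zero_nonneg (by norm_num) hy.le)
      (integrableOn_expKernel hφ hw 0 (by norm_num) (by norm_num))]
    have hsupp : Set.Ioi (0:ℝ) ⊆ Function.support fun y => expKernel 0 0 (h⁻¹ * y) := by
      intro y hy
      have hz : 0 < h⁻¹ * y := mul_pos hw hy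
      have := Real.add_one_lt_exp (x := -(h⁻¹ * y)) (by linarith)
      simp only [Function.mem_support, expKernel, pow_zero, one_mul, if_true, sub_zero, neg_mul]
      linarith
    refine lt_of_lt_of_le ?_ (measure_mono hsupp)
    -- Strict positivity of `c 0` needs `φ` to charge `(0, ∞)`; otherwise the infinite integral in
    -- `H0` would vanish.
    rw [Measure.restrict_apply_self, pos_iff_ne_zero]
    intro h0
    have h1 : ∫⁻ y in Set.Ioo (0 : ℝ) 1, ENNReal.ofReal y ∂φ = 0 :=
      setLIntegral_measure_zero _ _ (measure_mono_null (fun y hy => hy.1) h0)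
    exact absurd (h1.symm.trans hφ.unbounded_variation) (by simp)
  · intro k hk
    rw [coeff_eq_integral hφ hh]
    refine integral_nonneg_of_ae (hpos.mono fun y hy => ?_)
    exact div_nonneg (expKernel_zero_nonneg (by omega) hy.le) (by positivity)
  · have := hasSum_integral_zero_of_kernel hφ hw (r := fun k => ((k.factorial : ℝ))⁻¹)
      (fun k => by positivity)
      (fun z => by simpa only [div_eq_inv_mul] using hasSum_expKernel_zero z)
    simpa only [← e] using this
  · have := hasSum_integral_zero_of_kernel hφ hw (r := fun k => k * ((k.factorial : ℝ))⁻¹)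
      (fun k => by positivity)
      (fun z => by simpa only [div_eq_inv_mul, mul_assoc] using hasSum_mul_expKernel_zero z)
    simpa only [mul_assoc, integral_const_mul, e] using this

end Laplace

end

section

/-! ### Transition functions with bounded rates for small times -/

section SmallTime

variable {S : Type*} {Q : S → S → ℝ} {p : ℝ≥0 → S → S → ℝ} {C : ℝ}

theorem IsTransitionFunction.le_one (hp : IsTransitionFunction Q p) (t : ℝ≥0) (i j : S) :
    p t i j ≤ 1 :=
  le_hasSum (hp.hasSum_one t i) j fun k _ => hp.nonneg t i k

theorem IsTransitionFunction.sum_le_one (hp : IsTransitionFunction Q p) (t : ℝ≥0) (i : S)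
    (J : Finset S) : ∑ j ∈ J, p t i j ≤ 1 :=
  sum_le_hasSum J (fun k _ => hp.nonneg t i k) (hp.hasSum_one t i)

theorem abs_tsum_mul_le {a b : S → ℝ} {B : ℝ} (ha : Summable fun k => |a k|)
    (haC : ∑' k, |a k| ≤ C) (hB : 0 ≤ B) (hb : ∀ k, |b k| ≤ B) : |∑' k, a k * b k| ≤ C * B := by
  have h1 : ∀ k, |a k * b k| ≤ |a k| * B := fun k => by
    rw [abs_mul]; exact mul_le_mul_of_nonneg_left (hb k) (abs_nonneg _)
  have h2 : Summable fun k => |a k * b k| :=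
    Summable.of_nonneg_of_le (fun _ => abs_nonneg _) h1 (ha.mul_right B)
  have h3 : |∑' k, a k * b k| ≤ ∑' k, |a k * b k| := by
    simpa only [Real.norm_eq_abs] using
      norm_tsum_le_tsum_norm (f := fun k => a k * b k) (by simpa only [Real.norm_eq_abs] using h2)
  calc |∑' k, a k * b k| ≤ ∑' k, |a k * b k| := h3
    _ ≤ ∑' k, |a k| * B := h2.tsum_le_tsum h1 (ha.mul_right B)
    _ = (∑' k, |a k|) * B := tsum_mul_right
    _ ≤ C * B := by gcongr

theorem summable_mul_of_abs_le {a b : S → ℝ} {B : ℝ} (ha : Summable fun k => |a k|)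
    (hb : ∀ k, |b k| ≤ B) : Summable fun k => a k * b k := by
  refine Summable.of_norm_bounded (ha.mul_right B) fun k => ?_
  rw [Real.norm_eq_abs, abs_mul]
  exact mul_le_mul_of_nonneg_left (hb k) (abs_nonneg _)

/-- Mean value inequality: by the backward equation and `0 ≤ p ≤ 1` the derivative of `p t i i` is
at most `C` in modulus. -/
theorem IsTransitionFunction.one_sub_diag_le (hp : IsTransitionFunction Q p)
    (hQ : ∀ i, Summable fun k => |Q i k|) (hC : ∀ i, ∑' k, |Q i k| ≤ C) (t : ℝ≥0) (i : S) :
    1 - p t i i ≤ C * t := by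
  have h := (convex_Icc (0:ℝ) t).norm_image_sub_le_of_norm_hasDerivWithin_le
    (f := fun s : ℝ => p s.toNNReal i i) (f' := fun s => ∑' k, Q i k * p s.toNNReal k i) (C := C)
    (x := 0) (y := t)
    (fun s hs => by
      have := hp.backward s.toNNReal i i
      rw [Real.coe_toNNReal _ hs.1] at this
      exact this.mono fun x hx => hx.1)
    (fun s hs => by
      have := abs_tsum_mul_le (C := C) (B := 1) (hQ i) (hC i) zero_le_one
        (b := fun k => p s.toNNReal k i)
        (fun k => by rw [abs_of_nonneg (hp.nonneg _ _ _)]; exact hp.le_one _ _ _)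
      simpa using this)
    ⟨le_rfl, t.2⟩ ⟨t.2, le_rfl⟩
  simp only [Real.toNNReal_coe, Real.toNNReal_zero, hp.zero_self, sub_zero, Real.norm_eq_abs,
    NNReal.abs_eq] at h
  have := neg_abs_le (p t i i - 1)
  linarith

-- The rows have mass one, so the off-diagonal mass is at most `1 - p t i i`; it is counted once off
-- and once on the diagonal, hence the factor `2`.
open Classical in
theorem IsTransitionFunction.sum_abs_sub_le (hp : IsTransitionFunction Q p)
    (hQ : ∀ i, Summable fun k => |Q i k|) (hC : ∀ i, ∑' k, |Q i k| ≤ C) (t : ℝ≥0) (i : S)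
    (J : Finset S) : ∑ j ∈ J, |p t i j - if i = j then 1 else 0| ≤ 2 * C * t := by
  have h1 := hp.one_sub_diag_le hQ hC t i
  have h2 : ∑ j ∈ J, |p t i j - if i = j then 1 else 0| ≤
      ∑ j ∈ insert i (J.erase i), |p t i j - if i = j then 1 else 0| :=
    Finset.sum_le_sum_of_subset_of_nonneg (fun j hj => by
      by_cases h : j = i <;> simp [h, hj]) fun _ _ _ => abs_nonneg _
  rw [Finset.sum_insert (Finset.notMem_erase i J)] at h2
  have h3 : ∑ j ∈ J.erase i, |p t i j - if i = j then 1 else 0| = ∑ j ∈ J.erase i, p t i j := by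
    refine Finset.sum_congr rfl fun j hj => ?_
    rw [if_neg (Ne.symm (Finset.ne_of_mem_erase hj)), sub_zero, abs_of_nonneg (hp.nonneg _ _ _)]
  have h4 := hp.sum_le_one t i (insert i (J.erase i))
  rw [Finset.sum_insert (Finset.notMem_erase i J)] at h4
  rw [h3, if_pos rfl, abs_of_nonpos (by linarith [hp.le_one t i i])] at h2
  linarith

-- A second order Taylor bound obtained from the backward equation alone. The set `J` is finite so
-- that the sum can be differentiated termwise; the bound does not depend on `J`, which allows the
-- passage to the full sum.
open Classical in
theorem IsTransitionFunction.abs_sum_sub_le (hp : IsTransitionFunction Q p)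
    (hQ : ∀ i, Summable fun k => |Q i k|) (hC : ∀ i, ∑' k, |Q i k| ≤ C) (hC0 : 0 ≤ C)
    {F : S → ℝ} {K : ℝ} (hF : ∀ i, |F i| ≤ K) (hK : 0 ≤ K) (t : ℝ≥0) (i : S) (J : Finset S) :
    |∑ j ∈ J, F j * (p t i j - (if i = j then 1 else 0) - t * Q i j)| ≤
      2 * C ^ 2 * K * t ^ 2 := by
  have hS : ∀ (s : ℝ≥0) j, Summable fun k => Q i k * p s k j := fun s j =>
    summable_mul_of_abs_le (B := 1) (hQ i)
      fun k => by rw [abs_of_nonneg (hp.nonneg _ _ _)]; exact hp.le_one _ _ _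
  have hd : ∀ s ∈ Set.Icc (0:ℝ) t, HasDerivWithinAt
      (fun s : ℝ => ∑ j ∈ J, F j * (p s.toNNReal i j - (if i = j then 1 else 0) - s * Q i j))
      (∑ j ∈ J, F j * ((∑' k, Q i k * p s.toNNReal k j) - Q i j)) (Set.Icc 0 t) s := by
    intro s hs
    refine HasDerivWithinAt.fun_sum fun j _ => ?_
    have h1 := hp.backward s.toNNReal i j
    rw [Real.coe_toNNReal _ hs.1] at h1
    have h2 := (h1.mono (fun x hx => hx.1 : Set.Icc (0:ℝ) t ⊆ Set.Ici 0)).sub_const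
      (if i = j then (1:ℝ) else 0)
    have h3 := (hasDerivWithinAt_id s (Set.Icc (0:ℝ) t)).mul_const (Q i j)
    have := (h2.sub h3).const_mul (F j)
    simpa using this
  have hb : ∀ s ∈ Set.Icc (0:ℝ) t,
      ‖∑ j ∈ J, F j * ((∑' k, Q i k * p s.toNNReal k j) - Q i j)‖ ≤ C * (K * (2 * C * t)) := by
    intro s hs
    -- The derivative is `Q (p_s - I) F`, and `p_s - I` is already known to be of order `s`; one
    -- more application of the mean value inequality gives order `t²`.
    have e : ∑ j ∈ J, F j * ((∑' k, Q i k * p s.toNNReal k j) - Q i j) =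
        ∑' k, Q i k * ∑ j ∈ J, F j * (p s.toNNReal k j - if k = j then 1 else 0) := by
      have h1 : ∀ j, HasSum (fun k => Q i k * (F j * (p s.toNNReal k j - if k = j then 1 else 0)))
          (F j * ((∑' k, Q i k * p s.toNNReal k j) - Q i j)) := by
        intro j
        have h2 : HasSum (fun k => if k = j then Q i j else 0) (Q i j) := hasSum_ite_eq j (Q i j)
        convert! ((hS s.toNNReal j).hasSum.sub h2).mul_left (F j) using 1
        ext k
        split_ifs with hkj
        · subst hkj; ring
        · ring
      have h3 := hasSum_sum (s := J) fun j _ => h1 j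
      simp only [← Finset.mul_sum] at h3
      exact h3.tsum_eq.symm
    rw [e, Real.norm_eq_abs]
    refine abs_tsum_mul_le (hQ i) (hC i) (by positivity) fun k => ?_
    refine (Finset.abs_sum_le_sum_abs _ _).trans ?_
    have h4 := hp.sum_abs_sub_le hQ hC s.toNNReal k J
    have h5 : (s.toNNReal : ℝ) ≤ t := by rw [Real.coe_toNNReal _ hs.1]; exact hs.2
    calc ∑ j ∈ J, |F j * (p s.toNNReal k j - if k = j then 1 else 0)|
        ≤ ∑ j ∈ J, K * |p s.toNNReal k j - if k = j then 1 else 0| :=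
          Finset.sum_le_sum fun j _ => by
            rw [abs_mul]; exact mul_le_mul_of_nonneg_right (hF j) (abs_nonneg _)
      _ = K * ∑ j ∈ J, |p s.toNNReal k j - if k = j then 1 else 0| := by rw [Finset.mul_sum]
      _ ≤ K * (2 * C * s.toNNReal) := by gcongr
      _ ≤ K * (2 * C * t) := by gcongr
  have h := (convex_Icc (0:ℝ) t).norm_image_sub_le_of_norm_hasDerivWithin_le
    (𝕜 := ℝ) hd hb (x := 0) (y := (t : ℝ)) ⟨le_rfl, t.2⟩ ⟨t.2, le_rfl⟩
  have h0 : ∑ j ∈ J, F j * (p (0:ℝ).toNNReal i j - (if i = j then 1 else 0) - 0 * Q i j) = 0 := by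
    refine Finset.sum_eq_zero fun j _ => ?_
    rw [Real.toNNReal_zero]
    by_cases hij : i = j
    · subst hij; simp [hp.zero_self]
    · simp [hp.zero_ne i j hij, hij]
  rw [h0] at h
  simp only [Real.toNNReal_coe, sub_zero, Real.norm_eq_abs, NNReal.abs_eq] at h
  calc _ ≤ _ := h
    _ = _ := by ring

theorem IsTransitionFunction.summable_mul (hp : IsTransitionFunction Q p) {F : S → ℝ} {K : ℝ}
    (hF : ∀ i, |F i| ≤ K) (t : ℝ≥0) (i : S) : Summable fun j => p t i j * F j :=
  summable_mul_of_abs_le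
    (by simpa only [abs_of_nonneg (hp.nonneg t i _)] using (hp.hasSum_one t i).summable) hF

theorem IsTransitionFunction.abs_tsum_sub_le (hp : IsTransitionFunction Q p)
    (hQ : ∀ i, Summable fun k => |Q i k|) (hC : ∀ i, ∑' k, |Q i k| ≤ C) (hC0 : 0 ≤ C)
    {F : S → ℝ} {K : ℝ} (hF : ∀ i, |F i| ≤ K) (hK : 0 ≤ K) (t : ℝ≥0) (i : S) :
    |∑' j, p t i j * F j - F i - t * ∑' j, Q i j * F j| ≤ 2 * C ^ 2 * K * t ^ 2 := by
  classical
  have h1 := (hp.summable_mul hF t i).hasSum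
  have h2 : HasSum (fun j => if j = i then F i else 0) (F i) := hasSum_ite_eq i (F i)
  have h3 := ((summable_mul_of_abs_le (hQ i) hF).hasSum).mul_left (t : ℝ)
  have h4 := (h1.sub h2).sub h3
  have e : (fun j => p t i j * F j - (if j = i then F i else 0) - t * (Q i j * F j)) =
      fun j => F j * (p t i j - (if i = j then 1 else 0) - t * Q i j) := by
    ext j
    by_cases hij : j = i
    · subst hij; simp; ring
    · simp [hij, Ne.symm hij]; ring
  rw [e] at h4
  exact le_of_tendsto h4.abs (Eventually.of_forall fun J =>
    hp.abs_sum_sub_le hQ hC hC0 hF hK t i J)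

end SmallTime

end

section

/-! ### Integer-valued càdlàg processes -/

/-- A right continuous integer-valued path with left limits. -/
structure RegPath (x : ℝ → ℤ) : Prop where
  rc : ∀ t, ∀ᶠ s in 𝓝[>] t, x s = x t
  ll : ∀ t, ∃ l, ∀ᶠ s in 𝓝[<] t, x s = l

theorem RegPath.rc_Ici {x : ℝ → ℤ} (hx : RegPath x) (t : ℝ) : ∀ᶠ s in 𝓝[≥] t, x s = x t := by
  rw [← Set.Ioi_insert, nhdsWithin_insert, eventually_sup]
  exact ⟨by simp, hx.rc t⟩

/-- Time runs over all of `ℝ`; paths are continued to the left of `0` by their initial value, and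
regularity has to be checked on `[0, ∞)` only. -/
theorem RegPath.of_max {y : ℝ → ℤ} (hrc : ∀ t, 0 ≤ t → ∀ᶠ s in 𝓝[>] t, y s = y t)
    (hll : ∀ t, 0 < t → ∃ l, ∀ᶠ s in 𝓝[<] t, y s = l) : RegPath (fun t => y (max t 0)) := by
  constructor
  · intro t
    rcases lt_or_ge t 0 with ht | ht
    · filter_upwards [mem_nhdsWithin_of_mem_nhds (Iio_mem_nhds ht)] with s hs
      rw [max_eq_right (le_of_lt hs), max_eq_right ht.le]
    · filter_upwards [hrc t ht, self_mem_nhdsWithin] with s hs hts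
      rw [max_eq_left ht, max_eq_left (ht.trans (le_of_lt hts)), hs]
  · intro t
    rcases le_or_gt t 0 with ht | ht
    · refine ⟨y 0, ?_⟩
      filter_upwards [self_mem_nhdsWithin] with s hs
      rw [max_eq_right ((le_of_lt hs).trans ht)]
    · obtain ⟨l, hl⟩ := hll t ht
      refine ⟨l, ?_⟩
      filter_upwards [hl, mem_nhdsWithin_of_mem_nhds (Ioi_mem_nhds ht)] with s hs h0
      rw [max_eq_left (le_of_lt h0), hs]

/-! ### The past of a process -/

section

variable {Ω : Type*}

/-- The set of paths taking prescribed values at finitely many times. -/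
def cylinderSet (X : ℝ → Ω → ℤ) (I : Finset ℝ) (v : ℝ → ℤ) : Set Ω := {ω | ∀ u ∈ I, X u ω = v u}

/-- The σ-algebra generated by `X u`, `0 ≤ u ≤ s`. -/
@[reducible] def past (X : ℝ → Ω → ℤ) (s : ℝ) : MeasurableSpace Ω :=
  MeasurableSpace.generateFrom
    {A | ∃ I v, (∀ u ∈ I, 0 ≤ u ∧ u ≤ s) ∧ A = cylinderSet X I v}

theorem past_mono (X : ℝ → Ω → ℤ) {s t : ℝ} (h : s ≤ t) : past X s ≤ past X t := by
  refine MeasurableSpace.generateFrom_mono ?_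
  rintro A ⟨I, v, hI, rfl⟩
  exact ⟨I, v, fun u hu => ⟨(hI u hu).1, (hI u hu).2.trans h⟩, rfl⟩

theorem measurableSet_past_cylinderSet (X : ℝ → Ω → ℤ) {I : Finset ℝ} {v : ℝ → ℤ} {s : ℝ}
    (hI : ∀ u ∈ I, 0 ≤ u ∧ u ≤ s) : MeasurableSet[past X s] (cylinderSet X I v) :=
  MeasurableSpace.measurableSet_generateFrom ⟨I, v, hI, rfl⟩

theorem measurable_past (X : ℝ → Ω → ℤ) {u s : ℝ} (h0 : 0 ≤ u) (hs : u ≤ s) :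
    Measurable[past X s] (X u) := by
  refine @measurable_to_countable' ℤ Ω _ _ (past X s) _ fun k => ?_
  have : X u ⁻¹' {k} = cylinderSet X {u} fun _ => k := by ext; simp [cylinderSet]
  rw [this]
  exact measurableSet_past_cylinderSet X (by simp [h0, hs])

theorem isPiSystem_cylinderSet (X : ℝ → Ω → ℤ) (s : ℝ) :
    IsPiSystem {A | ∃ I v, (∀ u ∈ I, 0 ≤ u ∧ u ≤ s) ∧ A = cylinderSet X I v} := by
  classical
  rintro _ ⟨I, v, hI, rfl⟩ _ ⟨J, w, hJ, rfl⟩ ⟨ω₀, h1, h2⟩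
  refine ⟨I ∪ J, fun u => if u ∈ I then v u else w u, fun u hu => ?_, ?_⟩
  · rcases Finset.mem_union.1 hu with h | h
    exacts [hI u h, hJ u h]
  · ext ω
    constructor
    · rintro ⟨hv, hw⟩ u hu
      by_cases hui : u ∈ I
      · simpa [hui] using hv u hui
      · simpa [hui] using hw u ((Finset.mem_union.1 hu).resolve_left hui)
    · intro h
      refine ⟨fun u hu => by simpa [hu] using h u (Finset.mem_union_left _ hu), fun u hu => ?_⟩
      have := h u (Finset.mem_union_right _ hu)
      by_cases hui : u ∈ I
      · simp only [if_pos hui] at this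
        rw [this, ← h1 u hui, h2 u hu]
      · simpa [hui] using this

end

variable {Ω : Type*} [MeasurableSpace Ω]

/-- An integer-valued stochastic process all of whose paths are càdlàg. -/
structure IsProc (X : ℝ → Ω → ℤ) : Prop where
  meas : ∀ t, Measurable (X t)
  reg : ∀ ω, RegPath (fun t => X t ω)

/-- The point of the grid `ℤ / (m + 1)` following `t`. -/
def nextGrid (m : ℕ) (t : ℝ) : ℝ := ((⌊t * (m + 1)⌋ : ℤ) + 1) / ((m : ℝ) + 1)

theorem lt_nextGrid (m : ℕ) (t : ℝ) : t < nextGrid m t := by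
  rw [nextGrid, lt_div_iff₀ (by positivity)]
  exact Int.lt_floor_add_one _

theorem nextGrid_le (m : ℕ) (t : ℝ) : nextGrid m t ≤ t + 1 / ((m : ℝ) + 1) := by
  rw [nextGrid, div_le_iff₀ (by positivity), add_mul, one_div, inv_mul_cancel₀ (by positivity)]
  linarith [Int.floor_le (t * ((m : ℝ) + 1))]

theorem tendsto_nextGrid (t : ℝ) : Tendsto (fun m => nextGrid m t) atTop (𝓝[>] t) := by
  rw [tendsto_nhdsWithin_iff]
  refine ⟨?_, Eventually.of_forall fun m => lt_nextGrid m t⟩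
  have h : Tendsto (fun m : ℕ => t + 1 / ((m : ℝ) + 1)) atTop (𝓝 (t + 0)) :=
    tendsto_one_div_add_atTop_nhds_zero_nat.const_add t
  rw [add_zero] at h
  exact tendsto_of_tendsto_of_tendsto_of_le_of_le tendsto_const_nhds h
    (fun m => (lt_nextGrid m t).le) fun m => nextGrid_le m t

/-- Joint measurability by right continuity: at the next point of a countable grid the process
depends on time through an integer only. -/
theorem IsProc.measurable_uncurry {X : ℝ → Ω → ℤ} (hX : IsProc X) :
    Measurable (fun q : ℝ × Ω => X q.1 q.2) := by
  refine measurable_of_tendsto_metrizable (f := fun m q => X (nextGrid m q.1) q.2) (fun m => ?_) ?_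
  · have h1 : Measurable (fun q : ℤ × Ω => X (((q.1 : ℤ) + 1 : ℝ) / ((m : ℝ) + 1)) q.2) :=
      measurable_from_prod_countable_right
        fun k => hX.meas (((k : ℤ) + 1 : ℝ) / ((m : ℝ) + 1))
    have h2 : Measurable (fun q : ℝ × Ω => ((⌊q.1 * ((m : ℝ) + 1)⌋ : ℤ), q.2)) := by fun_prop
    exact h1.comp h2
  · rw [tendsto_pi_nhds]
    intro q
    refine tendsto_const_nhds.congr' ?_
    filter_upwards [(tendsto_nextGrid q.1).eventually ((hX.reg q.2).rc q.1)] with m hm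
    exact hm.symm

theorem IsProc.measurable_comp {X : ℝ → Ω → ℤ} (hX : IsProc X) {τ : Ω → ℝ} (hτ : Measurable τ) :
    Measurable (fun ω => X (τ ω) ω) :=
  hX.measurable_uncurry.comp (hτ.prodMk measurable_id)

theorem RegPath.measurable {x : ℝ → ℤ} (hx : RegPath x) : Measurable x := by
  have : IsProc (fun t (_ : Unit) => x t) := ⟨fun _ => measurable_const, fun _ => hx⟩
  exact this.measurable_uncurry.comp (measurable_id.prodMk (measurable_const (a := ())))

theorem intervalIntegrable_comp {x : ℝ → ℤ} (hx : Measurable x) {h : ℤ → ℝ} {K : ℝ}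
    (hK : ∀ k, |h k| ≤ K) (a b : ℝ) : IntervalIntegrable (fun r => h (x r)) volume a b := by
  refine (intervalIntegrable_const (c := K)).mono_fun
    ((measurable_of_countable h).comp hx).aestronglyMeasurable ?_
  exact Eventually.of_forall fun r => by
    simpa using (hK (x r)).trans (le_abs_self K)

/-- The integral up to `b` is continuous in `b` and measurable in `ω`, hence jointly measurable, so
random limits may be inserted. -/
theorem measurable_timeIntegral {X : ℝ → Ω → ℤ} (hX : IsProc X) {h : ℤ → ℝ} {K : ℝ}
    (hK : ∀ k, |h k| ≤ K) {τ₁ τ₂ : Ω → ℝ} (h1 : Measurable τ₁) (h2 : Measurable τ₂) :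
    Measurable (fun ω => ∫ r in τ₁ ω..τ₂ ω, h (X r ω)) := by
  have hm : Measurable (fun q : Ω × ℝ => h (X q.2 q.1)) :=
    (measurable_of_countable h).comp (hX.measurable_uncurry.comp measurable_swap)
  have key : Measurable (Function.uncurry fun (b : ℝ) ω => ∫ r in (0 : ℝ)..b, h (X r ω)) := by
    refine measurable_uncurry_of_continuous_of_measurable (fun ω => ?_) fun b => ?_
    · exact intervalIntegral.continuous_primitive
        (fun a b => intervalIntegrable_comp (hX.reg ω).measurable hK a b) 0
    · simp only [intervalIntegral]
      exact (hm.stronglyMeasurable.integral_prod_right).measurable.sub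
        (hm.stronglyMeasurable.integral_prod_right).measurable
  have e : (fun ω => ∫ r in τ₁ ω..τ₂ ω, h (X r ω)) =
      fun ω => (∫ r in (0 : ℝ)..τ₂ ω, h (X r ω)) - ∫ r in (0 : ℝ)..τ₁ ω, h (X r ω) := by
    ext ω
    rw [intervalIntegral.integral_interval_sub_left
      (intervalIntegrable_comp (hX.reg ω).measurable hK _ _)
      (intervalIntegrable_comp (hX.reg ω).measurable hK _ _)]
  rw [e]
  exact (key.comp (h2.prodMk measurable_id)).sub (key.comp (h1.prodMk measurable_id))

theorem abs_timeIntegral_le {x : ℝ → ℤ} {h : ℤ → ℝ} {K : ℝ} (hK : ∀ k, |h k| ≤ K) (a b : ℝ) :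
    |∫ r in a..b, h (x r)| ≤ K * |b - a| :=
  Real.norm_eq_abs (∫ r in a..b, h (x r)) ▸
    intervalIntegral.norm_integral_le_of_norm_le_const fun r _ => hK (x r)

theorem measurableSet_cylinderSet {X : ℝ → Ω → ℤ} (hX : ∀ t, Measurable (X t)) (I : Finset ℝ)
    (v : ℝ → ℤ) : MeasurableSet (cylinderSet X I v) := by
  have : cylinderSet X I v = ⋂ u ∈ I, X u ⁻¹' {v u} := by ext; simp [cylinderSet]
  rw [this]
  exact Finset.measurableSet_biInter I fun u _ => hX u (measurableSet_singleton _)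

theorem past_le {X : ℝ → Ω → ℤ} (hX : ∀ t, Measurable (X t)) (s : ℝ) :
    past X s ≤ (inferInstance : MeasurableSpace Ω) := by
  refine MeasurableSpace.generateFrom_le ?_
  rintro A ⟨I, v, _, rfl⟩
  exact measurableSet_cylinderSet hX I v

theorem setIntegral_eq_zero_of_past {P : Measure Ω} {X : ℝ → Ω → ℤ} (hX : ∀ t, Measurable (X t))
    {s : ℝ} {N : Ω → ℝ} (hN : Integrable N P)
    (h : ∀ I v, (∀ u ∈ I, 0 ≤ u ∧ u ≤ s) → ∫ ω in cylinderSet X I v, N ω ∂P = 0)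
    {A : Set Ω} (hA : MeasurableSet[past X s] A) : ∫ ω in A, N ω ∂P = 0 := by
  have huniv : ∫ ω, N ω ∂P = 0 := by
    have := h ∅ 0 (by simp)
    simpa [cylinderSet] using this
  refine MeasurableSpace.induction_on_inter (m := past X s)
    (C := fun A _ => ∫ ω in A, N ω ∂P = 0) rfl (isPiSystem_cylinderSet X s) (by simp)
    ?_ ?_ ?_ A hA
  · rintro _ ⟨I, v, hI, rfl⟩
    exact h I v hI
  · intro t ht h0
    have := integral_add_compl (past_le hX s _ ht) hN
    linarith
  · intro f hd hf h0
    rw [integral_iUnion (fun i => past_le hX s _ (hf i)) hd hN.integrableOn]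
    simp [h0]

/-! ### Martingale pairs -/

/-- `F (X t) - ∫_0^t h (X r) dr` is a martingale with respect to the filtration of `X`. -/
structure MartPair (P : Measure Ω) (X : ℝ → Ω → ℤ) (F h : ℤ → ℝ) : Prop where
  bdd_left : ∃ K, ∀ k, |F k| ≤ K
  bdd_right : ∃ K, ∀ k, |h k| ≤ K
  eq : ∀ s t, 0 ≤ s → s ≤ t → ∀ A, MeasurableSet[past X s] A →
    ∫ ω in A, (F (X t ω) - F (X s ω) - ∫ r in s..t, h (X r ω)) ∂P = 0

/-- Only the values of the functions on the range of the process matter. -/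
theorem MartPair.congr_fun {P : Measure Ω} {X : ℝ → Ω → ℤ} {F h F' h' : ℤ → ℝ} (hM : MartPair P X F h)
    (hF' : ∃ K, ∀ k, |F' k| ≤ K) (hh' : ∃ K, ∀ k, |h' k| ≤ K)
    (e1 : ∀ t ω, F' (X t ω) = F (X t ω)) (e2 : ∀ t ω, h' (X t ω) = h (X t ω)) :
    MartPair P X F' h' :=
  ⟨hF', hh', fun s t hs hst A hA => by simpa only [e1, e2] using hM.eq s t hs hst A hA⟩

section

variable {P : Measure Ω} [IsProbabilityMeasure P] {X : ℝ → Ω → ℤ}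

theorem integrable_of_bdd {f : Ω → ℝ} (hf : Measurable f) {K : ℝ} (hK : ∀ ω, |f ω| ≤ K) :
    Integrable f P :=
  Integrable.of_bound hf.aestronglyMeasurable K (Eventually.of_forall hK)

theorem integrable_comp (hX : IsProc X) {F : ℤ → ℝ} {K : ℝ} (hK : ∀ k, |F k| ≤ K)
    {τ : Ω → ℝ} (hτ : Measurable τ) : Integrable (fun ω => F (X (τ ω) ω)) P :=
  integrable_of_bdd ((measurable_of_countable F).comp (hX.measurable_comp hτ)) fun _ => hK _

theorem integrable_timeIntegral (hX : IsProc X) {h : ℤ → ℝ} {K : ℝ} (hK : ∀ k, |h k| ≤ K)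
    (s t : ℝ) : Integrable (fun ω => ∫ r in s..t, h (X r ω)) P :=
  integrable_of_bdd (measurable_timeIntegral hX hK measurable_const measurable_const)
    fun _ => abs_timeIntegral_le hK s t

theorem integrable_increment (hX : IsProc X) {F h : ℤ → ℝ} (hF : ∃ K, ∀ k, |F k| ≤ K)
    (hh : ∃ K, ∀ k, |h k| ≤ K) (s t : ℝ) :
    Integrable (fun ω => F (X t ω) - F (X s ω) - ∫ r in s..t, h (X r ω)) P := by
  obtain ⟨K, hK⟩ := hF
  obtain ⟨K', hK'⟩ := hh
  exact ((integrable_comp hX hK measurable_const).sub (integrable_comp hX hK measurable_const)).sub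
    (integrable_timeIntegral hX hK' s t)

theorem MartPair.of_cylinder (hX : IsProc X) {F h : ℤ → ℝ} (hF : ∃ K, ∀ k, |F k| ≤ K)
    (hh : ∃ K, ∀ k, |h k| ≤ K)
    (H : ∀ s t, 0 ≤ s → s ≤ t → ∀ I v, (∀ u ∈ I, 0 ≤ u ∧ u ≤ s) →
      ∫ ω in cylinderSet X I v, (F (X t ω) - F (X s ω) - ∫ r in s..t, h (X r ω)) ∂P = 0) :
    MartPair P X F h :=
  ⟨hF, hh, fun s t hs hst _ hA =>
    setIntegral_eq_zero_of_past hX.meas (integrable_increment hX hF hh s t) (H s t hs hst) hA⟩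

/-- Passing to a process that is indistinguishable from the given one. -/
theorem MartPair.congr_proc {X' : ℝ → Ω → ℤ} {F h : ℤ → ℝ} (hM : MartPair P X F h)
    (hX' : IsProc X') (he : ∀ᵐ ω ∂P, ∀ t, X' t ω = X t ω) : MartPair P X' F h := by
  refine MartPair.of_cylinder hX' hM.bdd_left hM.bdd_right fun s t hs hst I v hI => ?_
  rw [← hM.eq s t hs hst (cylinderSet X I v) (measurableSet_past_cylinderSet X hI)]
  have : cylinderSet X' I v =ᵐ[P] cylinderSet X I v := by
    filter_upwards [he] with ω hω
    simp only [cylinderSet, eq_iff_iff]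
    change (∀ u ∈ I, X' u ω = v u) ↔ (∀ u ∈ I, X u ω = v u)
    simp only [hω]
  rw [setIntegral_congr_set this]
  refine integral_congr_ae (ae_restrict_of_ae ?_)
  filter_upwards [he] with ω hω
  simp only [hω]

/-- A process satisfying a right differential equation in expectation. -/
theorem setIntegral_increment_eq_zero (hX : IsProc X) {F h : ℤ → ℝ} (hF : ∃ K, ∀ k, |F k| ≤ K)
    (hh : ∃ K, ∀ k, |h k| ≤ K) {s t : ℝ} (hst : s ≤ t) {A : Set Ω} {C : ℝ}
    (H : ∀ u, s ≤ u → ∀ δ, 0 < δ → δ ≤ 1 →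
      |∫ ω in A, (F (X (u + δ) ω) - F (X u ω) - δ * h (X u ω)) ∂P| ≤ C * δ ^ 2) :
    ∫ ω in A, (F (X t ω) - F (X s ω) - ∫ r in s..t, h (X r ω)) ∂P = 0 := by
  obtain ⟨K, hK⟩ := hF
  obtain ⟨K', hK'⟩ := hh
  have iF : ∀ u, Integrable (fun ω => F (X u ω)) (P.restrict A) := fun u =>
    (integrable_comp hX hK measurable_const).integrableOn
  have ih : ∀ u, Integrable (fun ω => h (X u ω)) (P.restrict A) := fun u =>
    (integrable_comp hX hK' measurable_const).integrableOn
  set f : ℝ → ℝ := fun u => ∫ ω in A, F (X u ω) ∂P with hf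
  set g : ℝ → ℝ := fun u => ∫ ω in A, h (X u ω) ∂P with hg
  have H' : ∀ u, s ≤ u → ∀ δ, 0 < δ → δ ≤ 1 → |f (u + δ) - f u - δ * g u| ≤ C * δ ^ 2 := by
    intro u hu δ h0 h1
    have := H u hu δ h0 h1
    have i1 : Integrable (fun ω => F (X (u + δ) ω) - F (X u ω)) (P.restrict A) :=
      (iF _).sub (iF _)
    rwa [integral_sub i1 ((ih _).const_mul δ), integral_sub (iF _) (iF _),
      integral_const_mul] at this
  have hgb : ∀ u, |g u| ≤ |K'| := by
    intro u
    have h1 : ‖g u‖ ≤ |K'| * (P.restrict A).real Set.univ :=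
      norm_integral_le_of_norm_le_const (Eventually.of_forall fun ω => (hK' _).trans (le_abs_self _))
    refine h1.trans (mul_le_of_le_one_right (abs_nonneg _) ?_)
    rw [measureReal_restrict_apply_univ]
    exact measureReal_le_one
  have hC : 0 ≤ C := by
    have := (abs_nonneg _).trans (H' s le_rfl 1 one_pos le_rfl)
    linarith
  have hlip : ∀ u, s ≤ u → ∀ δ, 0 ≤ δ → δ ≤ 1 → |f (u + δ) - f u| ≤ (C + |K'|) * δ := by
    intro u hu δ h0 h1
    rcases h0.eq_or_lt with rfl | h0'
    · simp
    have h2 := H' u hu δ h0' h1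
    have h3 : |δ * g u| ≤ δ * |K'| := by
      rw [abs_mul, abs_of_nonneg h0]; exact mul_le_mul_of_nonneg_left (hgb u) h0
    have h4 : |f (u + δ) - f u| ≤ |f (u + δ) - f u - δ * g u| + |δ * g u| := by
      have := abs_add_le (f (u + δ) - f u - δ * g u) (δ * g u)
      rwa [sub_add_cancel] at this
    have h5 : C * δ ^ 2 ≤ C * δ := by gcongr; nlinarith
    linarith
  have hcont : ContinuousOn f (Set.Icc s t) := by
    rw [Metric.continuousOn_iff]
    intro u hu ε hε
    refine ⟨min 1 (ε / (C + |K'| + 1)), by positivity, fun v hv hvu => ?_⟩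
    rw [Real.dist_eq] at hvu ⊢
    have hv1 : |v - u| ≤ 1 := (hvu.le).trans (min_le_left _ _)
    have hv2 : |v - u| * (C + |K'| + 1) < ε := by
      rw [← lt_div_iff₀ (by positivity)]; exact hvu.trans_le (min_le_right _ _)
    have key : |f v - f u| ≤ (C + |K'|) * |v - u| := by
      rcases le_total u v with h | h
      · have := hlip u hu.1 (v - u) (by linarith) (by rwa [abs_of_nonneg (by linarith)] at hv1)
        rw [abs_of_nonneg (sub_nonneg.2 h)]
        simpa using this
      · have := hlip v hv.1 (u - v) (by linarith)
          (by rwa [abs_of_nonpos (by linarith), neg_sub] at hv1)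
        rw [abs_of_nonpos (sub_nonpos.2 h), neg_sub, abs_sub_comm]
        simpa using this
    nlinarith [abs_nonneg (v - u)]
  -- Only increments forward in time are controlled, so `f` is known to have a right derivative;
  -- with the continuity of `f` and the integrability of `g` this suffices for the fundamental
  -- theorem.
  have hder : ∀ u ∈ Set.Ioo s t, HasDerivWithinAt f (g u) (Set.Ioi u) u := by
    intro u hu
    rw [hasDerivWithinAt_iff_isLittleO]
    have : (fun v => f v - f u - (v - u) • g u) =O[𝓝[>] u] fun v => (v - u) ^ 2 := by
      refine Asymptotics.IsBigO.of_bound C ?_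
      filter_upwards [Ioc_mem_nhdsGT (show u < u + 1 by linarith)] with v hv
      have := H' u hu.1.le (v - u) (by linarith [hv.1]) (by linarith [hv.2])
      rw [add_sub_cancel] at this
      simpa using this
    refine this.trans_isLittleO ?_
    have h2 : Tendsto (fun v => v - u) (𝓝[>] u) (𝓝 0) := by
      have : Tendsto (fun v => v - u) (𝓝 u) (𝓝 (u - u)) := (continuous_sub_right u).tendsto u
      rw [sub_self] at this
      exact this.mono_left nhdsWithin_le_nhds
    have := (Asymptotics.isLittleO_pow_id (𝕜 := ℝ) (n := 2) (by norm_num)).comp_tendsto h2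
    simpa [Function.comp_def] using this
  have hjoint : Measurable (fun q : Ω × ℝ => h (X q.2 q.1)) :=
    (measurable_of_countable h).comp (hX.measurable_uncurry.comp measurable_swap)
  have hgm : Measurable g :=
    (StronglyMeasurable.integral_prod_right (f := fun r ω => h (X r ω)) (ν := P.restrict A)
      (hjoint.comp measurable_swap).stronglyMeasurable).measurable
  have hgi : IntervalIntegrable g volume s t :=
    (intervalIntegrable_const (c := |K'|)).mono_fun hgm.aestronglyMeasurable
      (Eventually.of_forall fun r => by simpa using hgb r)
  have hfund := intervalIntegral.integral_eq_sub_of_hasDeriv_right_of_le hst hcont hder hgi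
  have hfub : ∫ r in s..t, g r = ∫ ω in A, (∫ r in s..t, h (X r ω)) ∂P := by
    rw [intervalIntegral.integral_of_le hst]
    simp only [hg, intervalIntegral.integral_of_le hst]
    refine integral_integral_swap ?_
    refine Integrable.of_bound (C := K') ?_ (Eventually.of_forall fun q => hK' _)
    exact (hjoint.comp measurable_swap).aestronglyMeasurable
  have i1 : Integrable (fun ω => F (X t ω) - F (X s ω)) (P.restrict A) := (iF _).sub (iF _)
  rw [integral_sub i1 (integrable_timeIntegral hX hK' s t).integrableOn,
    integral_sub (iF _) (iF _), ← hfub, hfund]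
  simp only [hf]
  ring

end

end

section

/-! ### Optional times -/

/-- `τ` is an optional time of the filtration generated by `X`. -/
def IsOptional {Ω : Type*} (X : ℝ → Ω → ℤ) (τ : Ω → ℝ) : Prop :=
  ∀ s, MeasurableSet[past X s] {ω | τ ω < s}

theorem isOptional_const {Ω : Type*} (X : ℝ → Ω → ℤ) (a : ℝ) : IsOptional X fun _ => a :=
  fun _ => MeasurableSet.const _

variable {Ω : Type*} [MeasurableSpace Ω]

theorem IsOptional.measurable {X : ℝ → Ω → ℤ} (hX : IsProc X) {τ : Ω → ℝ} (hτ : IsOptional X τ) :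
    Measurable τ :=
  measurable_of_Iio fun s => past_le hX.meas s _ (hτ s)

/-- For optional times only the events `τ < s` belong to the past, so `τ` is approximated by grid
points strictly to its right. By right continuity the position there is eventually the position at
`τ`. -/
theorem IsOptional.measurableSet_position {X : ℝ → Ω → ℤ} (hX : IsProc X) {τ : Ω → ℝ}
    (hτ : IsOptional X τ) (h0 : ∀ ω, 0 ≤ τ ω) (C : Set ℤ) (s : ℝ) :
    MeasurableSet[past X s] ({ω | X (τ ω) ω ∈ C} ∩ {ω | τ ω < s}) := by
  have hE : ∀ m : ℕ, MeasurableSet[past X s]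
      {ω | nextGrid m (τ ω) < s ∧ X (nextGrid m (τ ω)) ω ∈ C} := by
    intro m
    have e : {ω | nextGrid m (τ ω) < s ∧ X (nextGrid m (τ ω)) ω ∈ C} =
        ⋃ k : ℕ, {ω | ((k : ℝ) + 1) / ((m : ℝ) + 1) < s} ∩
          ({ω | τ ω < ((k : ℝ) + 1) / ((m : ℝ) + 1)} \ {ω | τ ω < (k : ℝ) / ((m : ℝ) + 1)}) ∩
          X (((k : ℝ) + 1) / ((m : ℝ) + 1)) ⁻¹' C := by
      ext ω
      simp only [Set.mem_ofPred_eq, Set.mem_iUnion, Set.mem_inter_iff, Set.mem_sdiff,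
        Set.mem_preimage, not_lt]
      have hm : (0:ℝ) < (m : ℝ) + 1 := by positivity
      constructor
      · rintro ⟨h1, h2⟩
        obtain ⟨k, hk⟩ := Int.eq_ofNat_of_zero_le
          (Int.floor_nonneg.2 (mul_nonneg (h0 ω) hm.le))
        have hg : nextGrid m (τ ω) = ((k : ℝ) + 1) / ((m : ℝ) + 1) := by
          simp [nextGrid, hk]
        refine ⟨k, ⟨hg ▸ h1, hg ▸ lt_nextGrid m _, ?_⟩, hg ▸ h2⟩
        rw [div_le_iff₀ hm]
        have := Int.floor_le (τ ω * ((m : ℝ) + 1))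
        rwa [hk] at this
      · rintro ⟨k, ⟨h1, h2, h3⟩, h4⟩
        rw [lt_div_iff₀ hm] at h2
        rw [div_le_iff₀ hm] at h3
        have hk : ⌊τ ω * ((m : ℝ) + 1)⌋ = (k : ℤ) := by
          rw [Int.floor_eq_iff]; exact ⟨by exact_mod_cast h3, by exact_mod_cast h2⟩
        have hg : nextGrid m (τ ω) = ((k : ℝ) + 1) / ((m : ℝ) + 1) := by
          simp [nextGrid, hk]
        rw [hg]; exact ⟨h1, h4⟩
    rw [e]
    refine MeasurableSet.iUnion fun k => ?_
    by_cases hk : ((k : ℝ) + 1) / ((m : ℝ) + 1) < s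
    · refine ((MeasurableSet.const _).inter (MeasurableSet.diff ?_ ?_)).inter ?_
      · exact past_mono X hk.le _ (hτ _)
      · exact past_mono X (le_trans (by gcongr; linarith) hk.le) _ (hτ ((k : ℝ) / ((m : ℝ) + 1)))
      · exact measurable_past X (by positivity) hk.le (MeasurableSet.of_discrete)
    · simp [hk]
  have e : ({ω | X (τ ω) ω ∈ C} ∩ {ω | τ ω < s}) =
      ⋃ M : ℕ, ⋂ m ≥ M, {ω | nextGrid m (τ ω) < s ∧ X (nextGrid m (τ ω)) ω ∈ C} := by
    ext ω
    have h1 := (tendsto_nextGrid (τ ω)).eventually ((hX.reg ω).rc (τ ω))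
    simp only [Set.mem_inter_iff, Set.mem_ofPred_eq, Set.mem_iUnion, Set.mem_iInter]
    constructor
    · rintro ⟨hC, hs⟩
      have h2 := (tendsto_nextGrid (τ ω)).eventually
        (mem_nhdsWithin_of_mem_nhds (Iio_mem_nhds hs))
      obtain ⟨M, hM⟩ := eventually_atTop.1 (h1.and h2)
      exact ⟨M, fun m hm => ⟨(hM m hm).2, by rw [(hM m hm).1]; exact hC⟩⟩
    · rintro ⟨M, hM⟩
      obtain ⟨M', hM'⟩ := eventually_atTop.1 h1
      have h2 := hM (max M M') (le_max_left _ _)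
      rw [hM' _ (le_max_right _ _)] at h2
      exact ⟨h2.2, (lt_nextGrid _ _).trans h2.1⟩
  rw [e]
  exact MeasurableSet.iUnion fun M => MeasurableSet.iInter fun m => MeasurableSet.iInter fun _ => hE m

theorem sum_ite_telescope (f : ℕ → ℝ) {a b : ℕ} (hab : a ≤ b) (N : ℕ) :
    ∑ k ∈ Finset.range N, (if a ≤ k ∧ k < b then f (k + 1) - f k else 0) =
      f (min b N) - f (min a N) := by
  induction N with
  | zero => simp
  | succ N ih =>
    rw [Finset.sum_range_succ, ih]
    split_ifs with h
    · rw [min_eq_right (by omega : N ≤ b), min_eq_left (by omega : a ≤ N),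
        min_eq_right (by omega : N + 1 ≤ b), min_eq_left (by omega : a ≤ N + 1)]
      ring
    · rcases not_and_or.1 h with h | h
      · rw [min_eq_right (by omega : N ≤ b), min_eq_right (by omega : N ≤ a),
          min_eq_right (by omega : N + 1 ≤ b), min_eq_right (by omega : N + 1 ≤ a)]
        ring
      · rw [min_eq_left (by omega : b ≤ N), min_eq_left (by omega : a ≤ N),
          min_eq_left (by omega : b ≤ N + 1), min_eq_left (by omega : a ≤ N + 1)]
        ring

section

variable {P : Measure Ω} [IsProbabilityMeasure P] {X : ℝ → Ω → ℤ}

/-- Optional sampling for martingale pairs. -/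
theorem MartPair.optional_sampling (hX : IsProc X) {F h : ℤ → ℝ} (hM : MartPair P X F h)
    {τ₁ τ₂ : Ω → ℝ} (h0 : ∀ ω, 0 ≤ τ₁ ω) (h12 : ∀ ω, τ₁ ω ≤ τ₂ ω) (ho1 : IsOptional X τ₁)
    (ho2 : IsOptional X τ₂) {A : Set Ω}
    (hA1 : ∀ s, MeasurableSet[past X s] (A ∩ {ω | τ₁ ω < s})) {C : ℝ}
    (hC : ∀ ω a b, 0 ≤ a → a ≤ b → b ≤ τ₂ ω + 1 → |∫ r in a..b, h (X r ω)| ≤ C) :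
    ∫ ω in A, (F (X (τ₂ ω) ω) - F (X (τ₁ ω) ω) - ∫ r in τ₁ ω..τ₂ ω, h (X r ω)) ∂P = 0 := by
  obtain ⟨K, hK⟩ := hM.bdd_left
  obtain ⟨K', hK'⟩ := hM.bdd_right
  have hτ1 := ho1.measurable hX
  have hτ2 := ho2.measurable hX
  have hint : ∀ ω a b, IntervalIntegrable (fun r => h (X r ω)) volume a b := fun ω a b =>
    intervalIntegrable_comp (hX.reg ω).measurable hK' a b
  -- the value of the martingale at time `k / (m + 1)`
  let f : ℕ → Ω → ℕ → ℝ := fun m ω k =>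
    F (X ((k : ℝ) / ((m : ℝ) + 1)) ω) - ∫ r in (0 : ℝ)..(k : ℝ) / ((m : ℝ) + 1), h (X r ω)
  let κ : ℕ → (Ω → ℝ) → Ω → ℕ := fun m τ ω => ⌊τ ω * ((m : ℝ) + 1)⌋₊ + 1
  -- The cap is the time `m + 1`. It makes the telescoping sum finite and is inactive for each fixed
  -- path once `m` is large.
  let σ : ℕ → (Ω → ℝ) → Ω → ℝ := fun m τ ω =>
    ((min (κ m τ ω) ((m + 1) * (m + 1)) : ℕ) : ℝ) / ((m : ℝ) + 1)
  let G : ℕ → Ω → ℝ := fun m ω => F (X (σ m τ₂ ω) ω) - F (X (σ m τ₁ ω) ω) -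
    ∫ r in σ m τ₁ ω..σ m τ₂ ω, h (X r ω)
  have hκ : ∀ m τ ω, 0 ≤ τ ω → (κ m τ ω : ℝ) / ((m : ℝ) + 1) = nextGrid m (τ ω) := by
    intro m τ ω hτ
    have : 0 ≤ τ ω * ((m : ℝ) + 1) := mul_nonneg hτ (by positivity)
    simp only [κ, nextGrid, ← natCast_floor_eq_intCast_floor this]
    push_cast; rfl
  have hκle' : ∀ m τ ω k, 0 ≤ τ ω → (κ m τ ω ≤ k ↔ τ ω < (k : ℝ) / ((m : ℝ) + 1)) := by
    intro m τ ω k hτ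
    have hm : (0 : ℝ) < (m : ℝ) + 1 := by positivity
    simp only [κ, Nat.succ_le_iff]
    rw [lt_div_iff₀ hm, Nat.floor_lt (mul_nonneg hτ hm.le)]
  have h02 : ∀ ω, 0 ≤ τ₂ ω := fun ω => (h0 ω).trans (h12 ω)
  have hG0 : ∀ m, ∫ ω in A, G m ω ∂P = 0 := by
    intro m
    have hm : (0 : ℝ) < (m : ℝ) + 1 := by positivity
    have e : ∀ ω, G m ω = ∑ k ∈ Finset.range ((m + 1) * (m + 1)),
        (if κ m τ₁ ω ≤ k ∧ k < κ m τ₂ ω then f m ω (k + 1) - f m ω k else 0) := by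
      intro ω
      have hle : κ m τ₁ ω ≤ κ m τ₂ ω := by
        simp only [κ]; gcongr; exact h12 ω
      rw [sum_ite_telescope _ hle]
      simp only [G, f, σ]
      rw [← intervalIntegral.integral_interval_sub_left (hint ω 0 _) (hint ω 0 _)]
      ring
    simp only [e]
    have hterm : ∀ k : ℕ, ∀ ω, f m ω (k + 1) - f m ω k =
        F (X (((k + 1 : ℕ) : ℝ) / ((m : ℝ) + 1)) ω) - F (X ((k : ℝ) / ((m : ℝ) + 1)) ω) -
          ∫ r in (k : ℝ) / ((m : ℝ) + 1)..((k + 1 : ℕ) : ℝ) / ((m : ℝ) + 1), h (X r ω) := by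
      intro k ω
      simp only [f]
      rw [← intervalIntegral.integral_interval_sub_left (hint ω 0 (((k + 1 : ℕ) : ℝ) / ((m : ℝ) + 1)))
        (hint ω 0 ((k : ℝ) / ((m : ℝ) + 1)))]
      ring
    -- Whether the `k`-th increment is counted is decided by time `k / (m + 1)`, so the increment
    -- has mean zero on this event.
    have hset : ∀ k : ℕ, MeasurableSet[past X ((k : ℝ) / ((m : ℝ) + 1))]
        (A ∩ {ω | κ m τ₁ ω ≤ k ∧ k < κ m τ₂ ω}) := by
      intro k
      have : A ∩ {ω | κ m τ₁ ω ≤ k ∧ k < κ m τ₂ ω} =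
          (A ∩ {ω | τ₁ ω < (k : ℝ) / ((m : ℝ) + 1)}) \ {ω | τ₂ ω < (k : ℝ) / ((m : ℝ) + 1)} := by
        ext ω
        simp only [Set.mem_inter_iff, Set.mem_ofPred_eq, Set.mem_sdiff]
        rw [← not_le, hκle' m τ₁ ω k (h0 ω), hκle' m τ₂ ω k (h02 ω)]
        tauto
      rw [this]
      exact (hA1 _).diff (ho2 _)
    have hS : ∀ k : ℕ, MeasurableSet {ω | κ m τ₁ ω ≤ k ∧ k < κ m τ₂ ω} := by
      intro k
      have : {ω | κ m τ₁ ω ≤ k ∧ k < κ m τ₂ ω} =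
          {ω | τ₁ ω < (k : ℝ) / ((m : ℝ) + 1)} \ {ω | τ₂ ω < (k : ℝ) / ((m : ℝ) + 1)} := by
        ext ω
        simp only [Set.mem_ofPred_eq, Set.mem_sdiff]
        rw [← not_le, hκle' m τ₁ ω k (h0 ω), hκle' m τ₂ ω k (h02 ω)]
      rw [this]
      exact (measurableSet_lt hτ1 measurable_const).diff (measurableSet_lt hτ2 measurable_const)
    have hi : ∀ k : ℕ, Integrable (fun ω => f m ω (k + 1) - f m ω k) P := by
      intro k
      simp only [hterm]
      exact integrable_increment hX hM.bdd_left hM.bdd_right _ _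
    have hind : ∀ k : ℕ, (fun ω => if κ m τ₁ ω ≤ k ∧ k < κ m τ₂ ω then
        f m ω (k + 1) - f m ω k else 0) =
        Set.indicator {ω | κ m τ₁ ω ≤ k ∧ k < κ m τ₂ ω} fun ω => f m ω (k + 1) - f m ω k := by
      intro k; ext ω; simp only [Set.indicator_apply, Set.mem_ofPred_eq]
    rw [integral_finsetSum _ fun k _ => by
      rw [hind]; exact ((hi k).indicator (hS k)).integrableOn]
    refine Finset.sum_eq_zero fun k _ => ?_
    rw [hind, setIntegral_indicator (hS k)]
    simp only [hterm]
    exact hM.eq _ _ (by positivity) (by gcongr; simp) _ (hset k)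
  have hlim : ∀ ω, Tendsto (fun m => G m ω) atTop (𝓝 (F (X (τ₂ ω) ω) - F (X (τ₁ ω) ω) -
      ∫ r in τ₁ ω..τ₂ ω, h (X r ω))) := by
    intro ω
    have hσ : ∀ τ : Ω → ℝ, 0 ≤ τ ω → Tendsto (fun m => σ m τ ω) atTop (𝓝[>] (τ ω)) := by
      intro τ hτ
      refine (tendsto_nextGrid (τ ω)).congr' ?_
      obtain ⟨M, hM⟩ := exists_nat_gt (τ ω)
      filter_upwards [eventually_ge_atTop M] with m hm
      rw [← hκ m τ ω hτ]
      simp only [σ]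
      rw [min_eq_left]
      simp only [κ]
      have hmM : (M : ℝ) ≤ m := by exact_mod_cast hm
      refine Nat.succ_le_of_lt ((Nat.floor_lt (mul_nonneg hτ (by positivity))).2 ?_)
      push_cast
      have : (0:ℝ) < (m : ℝ) + 1 := by positivity
      apply mul_lt_mul_of_pos_right _ this
      linarith
    have hF : ∀ τ : Ω → ℝ, 0 ≤ τ ω →
        Tendsto (fun m => F (X (σ m τ ω) ω)) atTop (𝓝 (F (X (τ ω) ω))) := by
      intro τ hτ
      refine tendsto_const_nhds.congr' ?_
      filter_upwards [(hσ τ hτ).eventually ((hX.reg ω).rc (τ ω))] with m hm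
      rw [hm]
    have hcont : Continuous fun b => ∫ r in (0 : ℝ)..b, h (X r ω) :=
      intervalIntegral.continuous_primitive (hint ω) 0
    have hI : ∀ τ : Ω → ℝ, 0 ≤ τ ω → Tendsto (fun m => ∫ r in (0 : ℝ)..σ m τ ω, h (X r ω)) atTop
        (𝓝 (∫ r in (0 : ℝ)..τ ω, h (X r ω))) := fun τ hτ =>
      (hcont.tendsto _).comp ((hσ τ hτ).mono_right nhdsWithin_le_nhds)
    rw [← intervalIntegral.integral_interval_sub_left (hint ω 0 (τ₂ ω)) (hint ω 0 (τ₁ ω))]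
    have e : ∀ m, G m ω = F (X (σ m τ₂ ω) ω) - F (X (σ m τ₁ ω) ω) -
        ((∫ r in (0 : ℝ)..σ m τ₂ ω, h (X r ω)) - ∫ r in (0 : ℝ)..σ m τ₁ ω, h (X r ω)) := fun m => by
      rw [intervalIntegral.integral_interval_sub_left (hint ω 0 _) (hint ω 0 _)]
    simp only [e]
    exact ((hF _ (h02 ω)).sub (hF _ (h0 ω))).sub ((hI _ (h02 ω)).sub (hI _ (h0 ω)))
  have hσm : ∀ m τ, Measurable τ → Measurable (σ m τ) := by
    intro m τ hτ
    have h1 : Measurable (κ m τ) := (Nat.measurable_floor.comp (hτ.mul_const _)).add_const 1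
    have h2 : Measurable fun k : ℕ => ((min k ((m + 1) * (m + 1)) : ℕ) : ℝ) / ((m : ℝ) + 1) :=
      measurable_of_countable _
    exact h2.comp h1
  have hGm : ∀ m, Measurable (G m) := fun m =>
    (((measurable_of_countable F).comp (hX.measurable_comp (hσm m _ hτ2))).sub
      ((measurable_of_countable F).comp (hX.measurable_comp (hσm m _ hτ1)))).sub
      (measurable_timeIntegral hX hK' (hσm m _ hτ1) (hσm m _ hτ2))
  -- The hypothesis on the compensator replaces boundedness of `τ₂`; the margin `+ 1` in it covers
  -- the overshoot of the grid.
  have hGb : ∀ m ω, ‖G m ω‖ ≤ K + K + C := by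
    intro m ω
    have hm : (0 : ℝ) < (m : ℝ) + 1 := by positivity
    have hle : κ m τ₁ ω ≤ κ m τ₂ ω := by
      simp only [κ]; gcongr; exact h12 ω
    have h1 : |∫ r in σ m τ₁ ω..σ m τ₂ ω, h (X r ω)| ≤ C := by
      refine hC ω _ _ (by simp only [σ]; positivity) (by simp only [σ]; gcongr) ?_
      calc σ m τ₂ ω ≤ (κ m τ₂ ω : ℝ) / ((m : ℝ) + 1) := by
            simp only [σ]; gcongr; exact min_le_left _ _
        _ = nextGrid m (τ₂ ω) := hκ m τ₂ ω (h02 ω)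
        _ ≤ τ₂ ω + 1 / ((m : ℝ) + 1) := nextGrid_le _ _
        _ ≤ τ₂ ω + 1 := by
            gcongr; rw [div_le_one hm]; linarith [(Nat.cast_nonneg m : (0:ℝ) ≤ m)]
    rw [Real.norm_eq_abs]
    refine (abs_sub _ _).trans (add_le_add ((abs_sub _ _).trans (add_le_add (hK _) (hK _))) h1)
  have := tendsto_integral_of_dominated_convergence (μ := P.restrict A) (F := G)
    (fun _ => K + K + C) (fun m => (hGm m).aestronglyMeasurable) (integrable_const _)
    (fun m => Eventually.of_forall (hGb m)) (Eventually.of_forall hlim)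
  simp only [hG0] at this
  exact (tendsto_nhds_unique this tendsto_const_nhds)

/-- Time change of a martingale pair by a family of optional times. -/
theorem MartPair.timeChange (hX : IsProc X) {F h h' : ℤ → ℝ} (hM : MartPair P X F h)
    {τ : ℝ → Ω → ℝ} (h0 : ∀ t ω, 0 ≤ τ t ω)
    (hmono : ∀ s t ω, 0 ≤ s → s ≤ t → τ s ω ≤ τ t ω) (hopt : ∀ t, 0 ≤ t → IsOptional X (τ t))
    {X' : ℝ → Ω → ℤ} (hX' : IsProc X') {π : ℤ → ℤ}
    (he : ∀ t ω, 0 ≤ t → X' t ω = π (X (τ t ω) ω)) (hπ : ∀ k, F (π k) = F k)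
    (hh' : ∃ K, ∀ k, |h' k| ≤ K)
    (hint : ∀ s t ω, 0 ≤ s → s ≤ t →
      ∫ r in τ s ω..τ t ω, h (X r ω) = ∫ r in s..t, h' (X' r ω))
    (hC : ∀ t, 0 ≤ t → ∃ C, ∀ ω a b, 0 ≤ a → a ≤ b → b ≤ τ t ω + 1 →
      |∫ r in a..b, h (X r ω)| ≤ C) : MartPair P X' F h' := by
  refine MartPair.of_cylinder hX' hM.bdd_left hh' fun s t hs hst I v hI => ?_
  obtain ⟨C, hC⟩ := hC t (hs.trans hst)
  have := hM.optional_sampling hX (h0 s) (fun ω => hmono s t ω hs hst) (hopt s hs)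
    (hopt t (hs.trans hst)) (A := cylinderSet X' I v) (fun r => ?_) hC
  · simpa only [hint s t _ hs hst, he s _ hs, he t _ (hs.trans hst), hπ] using this
  -- As `τ u ≤ τ s` for `u ≤ s`, each position may be intersected with `τ u < r`, and then it is an
  -- event of the past of `X` at `r`.
  · have e : cylinderSet X' I v ∩ {ω | τ s ω < r} =
        (⋂ u ∈ I, {ω | X (τ u ω) ω ∈ π ⁻¹' {v u}} ∩ {ω | τ u ω < r}) ∩ {ω | τ s ω < r} := by
      ext ω
      simp only [cylinderSet, Set.mem_inter_iff, Set.mem_ofPred_eq, Set.mem_iInter, Set.mem_preimage,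
        Set.mem_singleton_iff]
      constructor
      · rintro ⟨h1, h2⟩
        refine ⟨fun u hu => ⟨by rw [← he u ω (hI u hu).1]; exact h1 u hu, ?_⟩, h2⟩
        exact (hmono u s ω (hI u hu).1 (hI u hu).2).trans_lt h2
      · rintro ⟨h1, h2⟩
        exact ⟨fun u hu => by rw [he u ω (hI u hu).1]; exact (h1 u hu).1, h2⟩
    rw [e]
    exact (Finset.measurableSet_biInter I fun u hu =>
      (hopt u (hI u hu).1).measurableSet_position hX (h0 u) _ r).inter (hopt s hs r)

end

end

section

/-! ### Occupation times and fast-forwarding of integer-valued paths -/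

section Path

variable {x : ℝ → ℤ} {B : Set ℤ}

theorem abs_indicator_one_le (B : Set ℤ) (k : ℤ) : |B.indicator (1 : ℤ → ℝ) k| ≤ 1 := by
  by_cases h : k ∈ B <;> simp [h]

/-- The time spent by `x` in `B` up to time `t`. -/
def occTime (B : Set ℤ) (x : ℝ → ℤ) (t : ℝ) : ℝ := ∫ r in (0 : ℝ)..t, B.indicator 1 (x r)

/-- The right continuous inverse of the occupation time. -/
def invOcc (B : Set ℤ) (x : ℝ → ℤ) (t : ℝ) : ℝ := sInf {s | 0 < s ∧ t < occTime B x s}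

/-- The path `x` run only while it is in `B`. -/
def ffPath (B : Set ℤ) (x : ℝ → ℤ) (t : ℝ) : ℤ := x (invOcc B x (max t 0))

theorem RegPath.integrable_indicator (hx : RegPath x) (B : Set ℤ) (a b : ℝ) :
    IntervalIntegrable (fun r => B.indicator (1 : ℤ → ℝ) (x r)) volume a b :=
  intervalIntegrable_comp hx.measurable (abs_indicator_one_le B) a b

theorem RegPath.occTime_sub (hx : RegPath x) (B : Set ℤ) (a b : ℝ) :
    occTime B x b - occTime B x a = ∫ r in a..b, B.indicator 1 (x r) := by
  rw [occTime, occTime, intervalIntegral.integral_interval_sub_left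
    (hx.integrable_indicator B _ _) (hx.integrable_indicator B _ _)]

theorem RegPath.occTime_mono (hx : RegPath x) (B : Set ℤ) : Monotone (occTime B x) := by
  intro a b hab
  rw [← sub_nonneg, hx.occTime_sub]
  exact intervalIntegral.integral_nonneg hab fun r _ =>
    Set.indicator_nonneg (fun _ _ => zero_le_one) _

theorem RegPath.occTime_sub_le (hx : RegPath x) (B : Set ℤ) {a b : ℝ} (hab : a ≤ b) :
    occTime B x b - occTime B x a ≤ b - a := by
  rw [hx.occTime_sub]
  have := abs_timeIntegral_le (x := x) (abs_indicator_one_le B) a b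
  rw [one_mul, abs_of_nonneg (sub_nonneg.2 hab)] at this
  exact (le_abs_self _).trans this

@[simp] theorem occTime_zero (B : Set ℤ) (x : ℝ → ℤ) : occTime B x 0 = 0 := by simp [occTime]

theorem RegPath.continuous_occTime (hx : RegPath x) (B : Set ℤ) : Continuous (occTime B x) :=
  intervalIntegral.continuous_primitive (fun a b => hx.integrable_indicator B a b) 0

theorem RegPath.abs_integral_le_occTime (hx : RegPath x) {h : ℤ → ℝ} {K : ℝ}
    (hK : ∀ k, |h k| ≤ K) (hB : ∀ k, k ∉ B → h k = 0) {a b : ℝ} (hab : a ≤ b) :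
    |∫ r in a..b, h (x r)| ≤ K * (occTime B x b - occTime B x a) := by
  rw [hx.occTime_sub, ← intervalIntegral.integral_const_mul, ← Real.norm_eq_abs]
  refine intervalIntegral.norm_integral_le_of_norm_le hab (Eventually.of_forall fun r _ => ?_)
    ((hx.integrable_indicator B a b).const_mul K)
  by_cases hr : x r ∈ B
  · simpa [hr] using hK (x r)
  · simp [hr, hB _ hr]

theorem RegPath.occTime_sub_of_forall_mem (hx : RegPath x) {a b : ℝ} (hab : a ≤ b)
    (h : ∀ r, a < r → r < b → x r ∈ B) : occTime B x b - occTime B x a = b - a := by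
  rw [hx.occTime_sub]
  rw [intervalIntegral.integral_congr_ae (g := fun _ => (1 : ℝ))]
  · simp
  · have : ∀ᵐ r : ℝ, r ≠ b := by simp [ae_iff, measure_singleton]
    filter_upwards [this] with r hrb hr
    rw [Set.uIoc_of_le hab] at hr
    simp [h r hr.1 (lt_of_le_of_ne hr.2 hrb)]

theorem RegPath.occTime_sub_of_forall_notMem (hx : RegPath x) {a b : ℝ} (hab : a ≤ b)
    (h : ∀ r, a < r → r < b → x r ∉ B) : occTime B x b - occTime B x a = 0 := by
  rw [hx.occTime_sub]
  rw [intervalIntegral.integral_congr_ae (g := fun _ => (0 : ℝ))]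
  · simp
  · have : ∀ᵐ r : ℝ, r ≠ b := by simp [ae_iff, measure_singleton]
    filter_upwards [this] with r hrb hr
    rw [Set.uIoc_of_le hab] at hr
    simp [h r hr.1 (lt_of_le_of_ne hr.2 hrb)]

theorem bddBelow_invOcc (B : Set ℤ) (x : ℝ → ℤ) (t : ℝ) :
    BddBelow {s | 0 < s ∧ t < occTime B x s} := ⟨0, fun _ hs => hs.1.le⟩

theorem invOcc_nonneg (B : Set ℤ) (x : ℝ → ℤ) (t : ℝ) : 0 ≤ invOcc B x t :=
  Real.sInf_nonneg fun _ hs => hs.1.le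

/-- The path spends an infinite amount of time in `B`. -/
def OccInfinite (B : Set ℤ) (x : ℝ → ℤ) : Prop := ∀ T, ∃ s, T < occTime B x s

theorem RegPath.nonempty_invOcc (hx : RegPath x) (hB : OccInfinite B x) (t : ℝ) :
    {s | 0 < s ∧ t < occTime B x s}.Nonempty := by
  obtain ⟨s, hs⟩ := hB t
  exact ⟨max s 1, by positivity, hs.trans_le (hx.occTime_mono B (le_max_left _ _))⟩

/-- By continuity of the occupation time its level `t` is already exceeded slightly before `s`, so
the infimum is strictly smaller. This form exhibits the inverse as an optional time. -/
theorem RegPath.invOcc_lt_iff (hx : RegPath x) (hB : OccInfinite B x) {t s : ℝ} (ht : 0 ≤ t) :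
    invOcc B x t < s ↔ t < occTime B x s := by
  constructor
  · intro h
    obtain ⟨r, ⟨_, h2⟩, h3⟩ := exists_lt_of_csInf_lt (hx.nonempty_invOcc hB t) h
    exact h2.trans_le (hx.occTime_mono B h3.le)
  · intro h
    have hs : 0 < s := by
      by_contra! hs
      have := hx.occTime_mono B hs
      rw [occTime_zero] at this
      linarith
    have h1 : ∀ᶠ r in 𝓝 s, t < occTime B x r :=
      (hx.continuous_occTime B).tendsto s (Ioi_mem_nhds h)
    have h2 : ∀ᶠ r in 𝓝[<] s, 0 < r ∧ t < occTime B x r ∧ r < s := by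
      filter_upwards [mem_nhdsWithin_of_mem_nhds h1, self_mem_nhdsWithin,
        mem_nhdsWithin_of_mem_nhds (Ioi_mem_nhds hs)] with r a b c
      exact ⟨c, a, b⟩
    obtain ⟨r, h3, h4, h5⟩ := h2.exists
    exact (csInf_le (bddBelow_invOcc B x t) ⟨h3, h4⟩).trans_lt h5

theorem RegPath.occTime_invOcc (hx : RegPath x) (hB : OccInfinite B x) {t : ℝ} (ht : 0 ≤ t) :
    occTime B x (invOcc B x t) = t := by
  refine le_antisymm (not_lt.1 fun h => lt_irrefl _ ((hx.invOcc_lt_iff hB ht).2 h)) ?_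
  refine ge_of_tendsto (((hx.continuous_occTime B).tendsto (invOcc B x t)).mono_left
    nhdsWithin_le_nhds : Tendsto _ (𝓝[>] (invOcc B x t)) _) ?_
  filter_upwards [self_mem_nhdsWithin] with s hs
  exact ((hx.invOcc_lt_iff hB ht).1 hs).le

/-- Outside of `B` the path would stay there for a while and the occupation time would be constant,
whereas it exceeds `t` immediately after its inverse. -/
theorem RegPath.mem_invOcc (hx : RegPath x) (hB : OccInfinite B x) {t : ℝ} (ht : 0 ≤ t) :
    x (invOcc B x t) ∈ B := by
  by_contra h
  obtain ⟨b, hb, hb'⟩ := mem_nhdsGT_iff_exists_Ioo_subset.1 (hx.rc (invOcc B x t))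
  have h1 := hx.occTime_sub_of_forall_notMem (B := B) (le_of_lt hb) fun r h1 h2 => by
    rw [(hb' ⟨h1, h2⟩ : x r = _)]; exact h
  have h2 := (hx.invOcc_lt_iff hB ht).1 hb
  rw [hx.occTime_invOcc hB ht] at h1
  linarith

theorem RegPath.invOcc_mono (hx : RegPath x) (hB : OccInfinite B x) : Monotone (invOcc B x) :=
  fun _ t hst => csInf_le_csInf (bddBelow_invOcc B x _) (hx.nonempty_invOcc hB t)
    fun _ hr => ⟨hr.1, hst.trans_lt hr.2⟩

theorem RegPath.invOcc_strictMono (hx : RegPath x) (hB : OccInfinite B x) {s t : ℝ} (hs : 0 ≤ s)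
    (hst : s < t) : invOcc B x s < invOcc B x t := by
  rw [hx.invOcc_lt_iff hB hs, hx.occTime_invOcc hB (hs.trans hst.le)]
  exact hst

/-- Right of `t` the inverse of the occupation time grows at unit speed. -/
theorem RegPath.invOcc_add (hx : RegPath x) (hB : OccInfinite B x) {t : ℝ} (ht : 0 ≤ t) :
    ∀ᶠ u in 𝓝[>] t, invOcc B x u = invOcc B x t + (u - t) := by
  obtain ⟨b, hb, hb'⟩ := mem_nhdsGT_iff_exists_Ioo_subset.1 (hx.rc (invOcc B x t))
  have hb : invOcc B x t < b := hb
  have hmem : ∀ r, invOcc B x t < r → r < b → x r ∈ B := fun r h1 h2 => by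
    rw [(hb' ⟨h1, h2⟩ : x r = _)]; exact hx.mem_invOcc hB ht
  have hocc : ∀ r, invOcc B x t ≤ r → r ≤ b → occTime B x r = t + (r - invOcc B x t) := by
    intro r h1 h2
    have := hx.occTime_sub_of_forall_mem h1 fun q h3 h4 => hmem q h3 (h4.trans_le h2)
    rw [hx.occTime_invOcc hB ht] at this
    linarith
  filter_upwards [Ioo_mem_nhdsGT (show t < t + (b - invOcc B x t) by linarith)] with u hu
  have hu0 : 0 ≤ u := ht.trans hu.1.le
  refine le_antisymm (le_of_forall_gt_imp_ge_of_dense fun r hr => ?_) (not_lt.1 fun h => ?_)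
  · rcases lt_or_ge r b with hrb | hrb
    · refine ((hx.invOcc_lt_iff hB hu0).2 ?_).le
      rw [hocc r (by linarith [hu.1]) hrb.le]
      linarith
    · refine ((hx.invOcc_lt_iff hB hu0).2 ?_).le
      have := hx.occTime_mono B hrb
      rw [hocc b hb.le le_rfl] at this
      linarith [hu.2]
  · have := (hx.invOcc_lt_iff hB hu0).1 h
    rw [hocc _ (by linarith [hu.1]) (by linarith [hu.2])] at this
    linarith

/-- The inverse is strictly increasing, so it approaches its one-sided limits strictly from one
side, where `x` is locally constant. -/
theorem RegPath.ffPath (hx : RegPath x) (hB : OccInfinite B x) : RegPath (ffPath B x) := by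
  refine RegPath.of_max (y := fun t => x (invOcc B x t)) (fun t ht => ?_) fun t ht => ?_
  · have h1 : Tendsto (invOcc B x) (𝓝[>] t) (𝓝[>] (invOcc B x t)) := by
      refine tendsto_nhdsWithin_iff.2 ⟨?_, ?_⟩
      · have : Tendsto (fun u => invOcc B x t + (u - t)) (𝓝[>] t) (𝓝 (invOcc B x t)) := by
          have : Continuous fun u => invOcc B x t + (u - t) := by fun_prop
          simpa using (this.tendsto t).mono_left (nhdsWithin_le_nhds (s := Set.Ioi t))
        exact this.congr' ((hx.invOcc_add hB ht).mono fun u hu => hu.symm)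
      · filter_upwards [self_mem_nhdsWithin] with u hu
        exact hx.invOcc_strictMono hB ht hu
    exact h1.eventually (hx.rc _)
  · have h1 := (hx.invOcc_mono hB).tendsto_nhdsLT t
    obtain ⟨l, hl⟩ := hx.ll (sSup (invOcc B x '' Set.Iio t))
    refine ⟨l, ?_⟩
    have h2 : Tendsto (invOcc B x) (𝓝[<] t) (𝓝[<] (sSup (invOcc B x '' Set.Iio t))) := by
      refine tendsto_nhdsWithin_iff.2 ⟨h1, ?_⟩
      filter_upwards [self_mem_nhdsWithin, mem_nhdsWithin_of_mem_nhds (Ioi_mem_nhds ht)]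
        with s hs hs0
      have hs : s < t := hs
      have hs0 : 0 < s := hs0
      have hbdd : BddAbove (invOcc B x '' Set.Iio t) := by
        refine ⟨invOcc B x t, ?_⟩
        rintro _ ⟨r, hr, rfl⟩
        exact hx.invOcc_mono hB (le_of_lt hr)
      exact (hx.invOcc_strictMono hB hs0.le (by linarith : s < (s + t) / 2)).trans_le
        (le_csSup hbdd ⟨_, by simp; linarith, rfl⟩)
    exact h2.eventually hl

theorem RegPath.ffPath_mem (hx : RegPath x) (hB : OccInfinite B x) (t : ℝ) :
    GrunwaldChain.ffPath B x t ∈ B := hx.mem_invOcc hB (le_max_right _ _)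

theorem RegPath.ffPath_zero (hx : RegPath x) (hB : OccInfinite B x) (h0 : x 0 ∈ B) :
    GrunwaldChain.ffPath B x 0 = x 0 := by
  have : invOcc B x 0 = 0 := by
    refine le_antisymm (le_of_forall_gt_imp_ge_of_dense fun r hr => ?_) (invOcc_nonneg _ _ _)
    refine ((hx.invOcc_lt_iff hB le_rfl).2 ?_).le
    obtain ⟨b, hb, hb'⟩ := mem_nhdsGT_iff_exists_Ioo_subset.1 (hx.rc 0)
    have hb : 0 < b := hb
    have h1 := hx.occTime_sub_of_forall_mem (B := B) (a := 0) (b := min b r) (by positivity)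
      fun q h1 h2 => by
        rw [(hb' ⟨h1, h2.trans_le (min_le_left _ _)⟩ : x q = _)]; exact h0
    have h2 := hx.occTime_mono B (min_le_right b r)
    have h3 : 0 < min b r := by positivity
    rw [occTime_zero] at h1
    linarith
  rw [GrunwaldChain.ffPath, max_self, this]

/-- Substitution without a description of the excursions: the left side is Lipschitz in `t` because
`h` vanishes off `B`, and its right derivative is the integrand on the right since the inverse grows
at unit speed to the right of each point. -/
theorem RegPath.integral_invOcc (hx : RegPath x) (hB : OccInfinite B x) {h : ℤ → ℝ} {K : ℝ}
    (hK : ∀ k, |h k| ≤ K) (hh : ∀ k, k ∉ B → h k = 0) {s t : ℝ} (hs : 0 ≤ s) (hst : s ≤ t) :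
    ∫ r in invOcc B x s..invOcc B x t, h (x r) =
      ∫ r in s..t, h (GrunwaldChain.ffPath B x r) := by
  have hint : ∀ a b, IntervalIntegrable (fun r => h (x r)) volume a b :=
    intervalIntegrable_comp hx.measurable hK
  set J : ℝ → ℝ := fun t => ∫ r in (0 : ℝ)..invOcc B x t, h (x r) with hJ
  have hsub : ∀ u v, J v - J u = ∫ r in invOcc B x u..invOcc B x v, h (x r) := fun u v =>
    intervalIntegral.integral_interval_sub_left (hint _ _) (hint _ _)
  have hK0 : 0 ≤ K := (abs_nonneg _).trans (hK 0)
  have hlip : ∀ u v, 0 ≤ u → u ≤ v → |J v - J u| ≤ K * (v - u) := by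
    intro u v hu huv
    rw [hsub]
    have := hx.abs_integral_le_occTime hK hh (hx.invOcc_mono hB huv)
    rwa [hx.occTime_invOcc hB hu, hx.occTime_invOcc hB (hu.trans huv)] at this
  have hcont : ContinuousOn J (Set.Icc s t) := by
    have : LipschitzOnWith K.toNNReal J (Set.Icc s t) := by
      refine LipschitzOnWith.of_le_add_mul' K fun u hu v hv => ?_
      rcases le_total u v with h | h
      · have := (abs_le.1 (hlip u v (hs.trans hu.1) h)).1
        rw [Real.dist_eq, abs_of_nonpos (by linarith)]; linarith
      · have := (abs_le.1 (hlip v u (hs.trans hv.1) h)).2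
        rw [Real.dist_eq, abs_of_nonneg (by linarith)]; linarith
    exact this.continuousOn
  have hder : ∀ u ∈ Set.Ioo s t,
      HasDerivWithinAt J (h (GrunwaldChain.ffPath B x u)) (Set.Ioi u) u := by
    intro u hu
    have hu0 : 0 ≤ u := hs.trans hu.1.le
    have h1 : HasDerivWithinAt (fun v => J u + (v - u) * h (GrunwaldChain.ffPath B x u))
        (h (GrunwaldChain.ffPath B x u)) (Set.Ioi u) u := by
      have := (((hasDerivWithinAt_id u (Set.Ioi u)).sub_const u).mul_const
        (h (GrunwaldChain.ffPath B x u))).const_add (J u)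
      simpa using this
    refine h1.congr_of_eventuallyEq ?_ (by simp)
    obtain ⟨b, hb, hb'⟩ := mem_nhdsGT_iff_exists_Ioo_subset.1 (hx.rc (invOcc B x u))
    have hb : invOcc B x u < b := hb
    filter_upwards [hx.invOcc_add hB hu0, self_mem_nhdsWithin,
      Ioo_mem_nhdsGT (show u < u + (b - invOcc B x u) by linarith)] with v hv huv hvb
    have huv : u < v := huv
    have : J v - J u = (v - u) * h (GrunwaldChain.ffPath B x u) := by
      rw [hsub, hv, intervalIntegral.integral_congr_ae
        (g := fun _ => h (GrunwaldChain.ffPath B x u))]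
      · simp
      · refine Eventually.of_forall fun r hr => ?_
        rw [Set.uIoc_of_le (by linarith)] at hr
        rw [(hb' ⟨hr.1, by linarith [hr.2, hvb.2]⟩ : x r = _), GrunwaldChain.ffPath,
          max_eq_left hu0]
    linarith
  have := intervalIntegral.integral_eq_sub_of_hasDeriv_right_of_le hst hcont hder
    (intervalIntegrable_comp (hx.ffPath hB).measurable hK s t)
  rw [this, hsub]

/-- A set visited for a finite time only is visited for a finite time after fast-forwarding. -/
theorem RegPath.occInfinite_of_ffPath (hx : RegPath x) (hB : OccInfinite B x) {C : Set ℤ}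
    (hC : OccInfinite C (GrunwaldChain.ffPath B x)) : OccInfinite (B ∩ C) x := by
  intro T
  obtain ⟨s, hs⟩ := hC (max T 0)
  have hs0 : 0 ≤ s := by
    by_contra! h
    have := (hx.ffPath hB).occTime_mono C h.le
    rw [occTime_zero] at this
    exact absurd ((le_max_right T 0).trans hs.le) (by linarith [hs, le_max_right T 0])
  have h1 := hx.integral_invOcc hB (h := (B ∩ C).indicator 1) (abs_indicator_one_le _)
    (fun k hk => Set.indicator_of_notMem (fun h => hk h.1) _) le_rfl hs0
  have h2 : ∫ r in (0:ℝ)..s, (B ∩ C).indicator (1 : ℤ → ℝ) (GrunwaldChain.ffPath B x r) =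
      occTime C (GrunwaldChain.ffPath B x) s := by
    refine intervalIntegral.integral_congr fun r _ => ?_
    have := hx.ffPath_mem hB r
    by_cases h : GrunwaldChain.ffPath B x r ∈ C <;> simp [h, this]
  have h3 := hx.occTime_mono (B ∩ C) (invOcc_nonneg B x 0)
  rw [occTime_zero] at h3
  refine ⟨invOcc B x s, ?_⟩
  have h4 := hx.occTime_sub (B ∩ C) (invOcc B x 0) (invOcc B x s)
  rw [h1, h2] at h4
  linarith [le_max_left T 0]

/-- The path stopped at time `s`. -/
theorem RegPath.stopped (hx : RegPath x) (s : ℝ) : RegPath (fun t => x (min (max t 0) s)) := by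
  refine RegPath.of_max (y := fun t => x (min t s)) (fun t _ => ?_) (fun t _ => ?_)
  · rcases lt_or_ge t s with h | h
    · filter_upwards [hx.rc t, mem_nhdsWithin_of_mem_nhds (Iio_mem_nhds h)] with r h1 h2
      rw [min_eq_left (le_of_lt h2), min_eq_left h.le, h1]
    · filter_upwards [self_mem_nhdsWithin] with r hr
      rw [min_eq_right h, min_eq_right (h.trans (le_of_lt hr))]
  · rcases le_or_gt t s with h | h
    · obtain ⟨l, hl⟩ := hx.ll t
      refine ⟨l, ?_⟩
      filter_upwards [hl, self_mem_nhdsWithin] with r h1 h2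
      rw [min_eq_left ((le_of_lt h2).trans h), h1]
    · refine ⟨x s, ?_⟩
      filter_upwards [mem_nhdsWithin_of_mem_nhds (Ioi_mem_nhds h)] with r hr
      rw [min_eq_right (le_of_lt hr)]

end Path

/-! ### Fast-forwarding of processes and of their martingale pairs -/

section

variable {Ω : Type*} [MeasurableSpace Ω] {P : Measure Ω} [IsProbabilityMeasure P]
  {X : ℝ → Ω → ℤ} {B : Set ℤ}

theorem IsProc.stopped {Ω : Type*} [MeasurableSpace Ω] {X : ℝ → Ω → ℤ} (hX : IsProc X) {s : ℝ}
    (hs : 0 ≤ s) : @IsProc Ω (past X s) (fun t => X (min (max t 0) s)) :=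
  @IsProc.mk Ω (past X s) _
    (fun _ => measurable_past X (le_min (le_max_right _ _) hs) (min_le_right _ _))
    fun ω => (hX.reg ω).stopped s

/-- Up to time `s` the path may be replaced by the path stopped at `s`, which is a process for the
smaller σ-algebra `past X s`. -/
theorem IsProc.measurable_occTime {Ω : Type*} [MeasurableSpace Ω] {X : ℝ → Ω → ℤ} (hX : IsProc X)
    (B : Set ℤ) {s : ℝ} (hs : 0 ≤ s) :
    Measurable[past X s] (fun ω => occTime B (fun t => X t ω) s) := by
  have := @measurable_timeIntegral Ω (past X s) _ (hX.stopped hs) _ 1 (abs_indicator_one_le B)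
    (fun _ => 0) (fun _ => s) (@measurable_const _ _ _ (past X s) _)
    (@measurable_const _ _ _ (past X s) _)
  refine Eq.mp ?_ this
  congr 1
  ext ω
  refine intervalIntegral.integral_congr fun r hr => ?_
  rw [Set.uIcc_of_le hs] at hr
  simp only [max_eq_left hr.1, min_eq_left hr.2]

theorem IsProc.isOptional_invOcc {Ω : Type*} [MeasurableSpace Ω] {X : ℝ → Ω → ℤ} (hX : IsProc X)
    (hB : ∀ ω, OccInfinite B fun t => X t ω) {t : ℝ} (ht : 0 ≤ t) :
    IsOptional X fun ω => invOcc B (fun t => X t ω) t := by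
  intro s
  simp only [fun ω => (hX.reg ω).invOcc_lt_iff (hB ω) (s := s) ht]
  rcases le_or_gt 0 s with hs | hs
  · exact hX.measurable_occTime B hs measurableSet_Ioi
  · have : {ω | t < occTime B (fun t => X t ω) s} = ∅ := by
      ext ω
      have := (hX.reg ω).occTime_mono B hs.le
      rw [occTime_zero] at this
      simp
      linarith
    rw [this]
    exact @MeasurableSet.empty Ω (past X s)

theorem IsProc.ffPath {Ω : Type*} [MeasurableSpace Ω] {X : ℝ → Ω → ℤ} (hX : IsProc X)
    (hB : ∀ ω, OccInfinite B fun t => X t ω) :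
    IsProc fun t ω => GrunwaldChain.ffPath B (fun t => X t ω) t :=
  ⟨fun t => hX.measurable_comp ((hX.isOptional_invOcc hB (le_max_right t 0)).measurable hX),
    fun ω => (hX.reg ω).ffPath (hB ω)⟩

/-- Fast-forwarding preserves the martingale pairs that are at rest outside of the set. -/
theorem MartPair.ffPath (hX : IsProc X) {F h : ℤ → ℝ} (hM : MartPair P X F h)
    (hB : ∀ ω, OccInfinite B fun t => X t ω) (hh : ∀ k, k ∉ B → h k = 0) :
    MartPair P (fun t ω => GrunwaldChain.ffPath B (fun t => X t ω) t) F h := by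
  obtain ⟨K, hK⟩ := hM.bdd_right
  have hK0 : 0 ≤ K := (abs_nonneg _).trans (hK 0)
  refine hM.timeChange hX (τ := fun t ω => invOcc B (fun t => X t ω) t) (π := id)
    (fun t ω => invOcc_nonneg _ _ _) (fun s t ω _ hst => (hX.reg ω).invOcc_mono (hB ω) hst)
    (fun t ht => hX.isOptional_invOcc hB ht) (hX.ffPath hB)
    (fun t ω ht => by simp [GrunwaldChain.ffPath, max_eq_left ht]) (fun _ => rfl) ⟨K, hK⟩
    (fun s t ω hs hst => (hX.reg ω).integral_invOcc (hB ω) hK hh hs hst)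
    -- The compensator moves only while the path is in `B`; this occupation time is `t` at the
    -- inverse and at most `t + 1` one unit later, although the inverse itself is unbounded in `ω`.
    fun t ht => ⟨K * (t + 1), fun ω a b ha hab hb => ?_⟩
  refine ((hX.reg ω).abs_integral_le_occTime hK hh hab).trans ?_
  have h1 := (hX.reg ω).occTime_mono B ha
  rw [occTime_zero] at h1
  have h2 := (hX.reg ω).occTime_mono B hb
  have h3 := (hX.reg ω).occTime_sub_le B
    (show invOcc B (fun t => X t ω) t ≤ invOcc B (fun t => X t ω) t + 1 by linarith)
  rw [(hX.reg ω).occTime_invOcc (hB ω) ht] at h3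
  gcongr
  linarith

end

/-! ### Killing of integer-valued paths -/

section Path

variable {x : ℝ → ℤ} {B : Set ℤ}

open Classical in
/-- The path `x` sent to `c` for ever when it leaves `B`. -/
def killPath (B : Set ℤ) (c : ℤ) (x : ℝ → ℤ) (t : ℝ) : ℤ :=
  if ∃ s ∈ Set.Icc 0 (max t 0), x s ∉ B then c else x (max t 0)

/-- The minimum of `t` and the first time at which `x` is not in `B`. -/
def exitMin (B : Set ℤ) (x : ℝ → ℤ) (t : ℝ) : ℝ := sInf ({s | 0 ≤ s ∧ x s ∉ B} ∪ {t})

theorem bddBelow_exitMin (B : Set ℤ) (x : ℝ → ℤ) (t : ℝ) :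
    BddBelow ({s | 0 ≤ s ∧ x s ∉ B} ∪ {t}) :=
  BddBelow.union ⟨0, fun _ hs => hs.1⟩ (bddBelow_singleton)

theorem exitMin_le (B : Set ℤ) (x : ℝ → ℤ) (t : ℝ) : exitMin B x t ≤ t :=
  csInf_le (bddBelow_exitMin B x t) (Or.inr rfl)

theorem exitMin_nonneg (B : Set ℤ) (x : ℝ → ℤ) {t : ℝ} (ht : 0 ≤ t) : 0 ≤ exitMin B x t := by
  refine le_csInf ⟨t, Or.inr rfl⟩ ?_
  rintro s (hs | rfl)
  exacts [hs.1, ht]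

theorem exitMin_lt_iff (B : Set ℤ) (x : ℝ → ℤ) (t s : ℝ) :
    exitMin B x t < s ↔ t < s ∨ ∃ u, 0 ≤ u ∧ u < s ∧ x u ∉ B := by
  rw [exitMin, csInf_lt_iff (bddBelow_exitMin B x t) ⟨t, Or.inr rfl⟩]
  constructor
  · rintro ⟨u, hu | rfl, hus⟩
    exacts [Or.inr ⟨u, hu.1, hus, hu.2⟩, Or.inl hus]
  · rintro (h | ⟨u, h1, h2, h3⟩)
    exacts [⟨t, Or.inr rfl, h⟩, ⟨u, Or.inl ⟨h1, h3⟩, h2⟩]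

theorem mem_of_lt_exitMin {t u : ℝ} (h0 : 0 ≤ u) (h : u < exitMin B x t) : x u ∈ B := by
  by_contra hu
  exact absurd (csInf_le (bddBelow_exitMin B x t) (Or.inl ⟨h0, hu⟩)) (not_le.2 h)

theorem exitMin_mono {s t : ℝ} (hst : s ≤ t) : exitMin B x s ≤ exitMin B x t := by
  refine le_csInf ⟨t, Or.inr rfl⟩ ?_
  rintro u (hu | rfl)
  · exact csInf_le (bddBelow_exitMin B x s) (Or.inl hu)
  · exact (exitMin_le B x s).trans hst

theorem RegPath.exitMin_eq_or (hx : RegPath x) (B : Set ℤ) (t : ℝ) :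
    exitMin B x t = t ∨ x (exitMin B x t) ∉ B := by
  by_contra! h
  have hlt : exitMin B x t < t := lt_of_le_of_ne (exitMin_le B x t) h.1
  obtain ⟨b, hb, hb'⟩ := mem_nhdsGT_iff_exists_Ioo_subset.1 (hx.rc (exitMin B x t))
  have hb : exitMin B x t < b := hb
  rcases (exitMin_lt_iff B x t (min b t)).1 (lt_min hb hlt) with h1 | ⟨u, h1, h2, h3⟩
  · exact absurd (h1.trans_le (min_le_right _ _)) (lt_irrefl _)
  · rcases lt_trichotomy u (exitMin B x t) with h4 | h4 | h4
    · exact h3 (mem_of_lt_exitMin h1 h4)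
    · rw [h4] at h3; exact h3 h.2
    · rw [(hb' ⟨h4, h2.trans_le (min_le_left _ _)⟩ : x u = _)] at h3
      exact h3 h.2

-- Writes killing as evaluation at a bounded optional time, followed by the collapse of the
-- complement of `B` to `c`; this is the form that `MartPair.timeChange` accepts.
open Classical in
theorem RegPath.killPath_eq (hx : RegPath x) (B : Set ℤ) (c : ℤ) {t : ℝ} (ht : 0 ≤ t) :
    killPath B c x t = if x (exitMin B x t) ∈ B then x (exitMin B x t) else c := by
  rw [killPath, max_eq_left ht]
  by_cases h : ∃ s ∈ Set.Icc 0 t, x s ∉ B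
  · rw [if_pos h, if_neg]
    obtain ⟨s, hs, hsB⟩ := h
    rcases hx.exitMin_eq_or B t with h1 | h1
    · rcases hs.2.eq_or_lt with rfl | h2
      · rwa [h1]
      · rw [← h1] at h2
        exact absurd (mem_of_lt_exitMin hs.1 h2) hsB
    · exact h1
  · rw [if_neg h]
    push Not at h
    have h1 : exitMin B x t = t := by
      rcases hx.exitMin_eq_or B t with h1 | h1
      · exact h1
      · exact absurd (h _ ⟨exitMin_nonneg B x ht, exitMin_le B x t⟩) h1
    rw [h1, if_pos (h t ⟨ht, le_rfl⟩)]

theorem RegPath.killPath (hx : RegPath x) (B : Set ℤ) (c : ℤ) : RegPath (killPath B c x) := by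
  classical
  have e : GrunwaldChain.killPath B c x = fun t => (fun t =>
      if ∃ s ∈ Set.Icc 0 t, x s ∉ B then c else x t) (max t 0) := by
    ext t; rw [GrunwaldChain.killPath]
  rw [e]
  refine RegPath.of_max (y := fun t => if ∃ s ∈ Set.Icc 0 t, x s ∉ B then c else x t)
    (fun t ht => ?_) fun t ht => ?_
  · by_cases h : ∃ s ∈ Set.Icc 0 t, x s ∉ B
    · filter_upwards [self_mem_nhdsWithin] with u hu
      obtain ⟨s, hs, hsB⟩ := h
      rw [if_pos ⟨s, ⟨hs.1, hs.2.trans (le_of_lt hu)⟩, hsB⟩, if_pos ⟨s, hs, hsB⟩]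
    · obtain ⟨b, hb, hb'⟩ := mem_nhdsGT_iff_exists_Ioo_subset.1 (hx.rc t)
      filter_upwards [Ioo_mem_nhdsGT hb] with u hu
      have hu' : x u = x t := hb' hu
      rw [if_neg h, if_neg, hu']
      push Not at h ⊢
      intro s hs
      rcases le_or_gt s t with hst | hst
      · exact h s ⟨hs.1, hst⟩
      · rw [(hb' ⟨hst, hs.2.trans_lt hu.2⟩ : x s = x t)]
        exact h t ⟨ht, le_rfl⟩
  · by_cases h : ∃ s ∈ Set.Ico 0 t, x s ∉ B
    · obtain ⟨s, hs, hsB⟩ := h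
      refine ⟨c, ?_⟩
      filter_upwards [mem_nhdsWithin_of_mem_nhds (Ioi_mem_nhds hs.2)] with u hu
      rw [if_pos ⟨s, ⟨hs.1, le_of_lt hu⟩, hsB⟩]
    · obtain ⟨l, hl⟩ := hx.ll t
      refine ⟨l, ?_⟩
      filter_upwards [hl, self_mem_nhdsWithin] with u h1 h2
      rw [if_neg, h1]
      push Not at h ⊢
      exact fun s hs => h s ⟨hs.1, hs.2.trans_lt h2⟩

theorem killPath_eq_or (B : Set ℤ) (c : ℤ) (x : ℝ → ℤ) (t : ℝ) :
    killPath B c x t = c ∨ killPath B c x t ∈ B ∧ killPath B c x t = x (max t 0) := by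
  rw [killPath]
  split_ifs with h
  · exact Or.inl rfl
  · push Not at h
    exact Or.inr ⟨h _ ⟨le_max_right _ _, le_rfl⟩, rfl⟩

theorem killPath_zero (c : ℤ) (h : x 0 ∈ B) : killPath B c x 0 = x 0 := by
  rw [killPath, max_self, if_neg]
  push Not
  intro s hs
  rwa [le_antisymm hs.2 hs.1]

theorem RegPath.integral_exitMin (hx : RegPath x) (B : Set ℤ) {c : ℤ} (hc : c ∉ B) {h : ℤ → ℝ}
    {K : ℝ} (hK : ∀ k, |h k| ≤ K) {t : ℝ} (ht : 0 ≤ t) :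
    ∫ r in (0 : ℝ)..exitMin B x t, h (x r) =
      ∫ r in (0 : ℝ)..t, B.indicator h (GrunwaldChain.killPath B c x r) := by
  have hK' : ∀ k, |B.indicator h k| ≤ K := fun k => by
    by_cases hk : k ∈ B
    · simpa [hk] using hK k
    · simpa [hk] using (abs_nonneg _).trans (hK 0)
  have hint : ∀ a b, IntervalIntegrable
      (fun r => B.indicator h (GrunwaldChain.killPath B c x r)) volume a b :=
    intervalIntegrable_comp (hx.killPath B c).measurable hK'
  have h0 := exitMin_nonneg B x ht
  have hne : ∀ᵐ r : ℝ, r ≠ exitMin B x t := by simp [ae_iff, measure_singleton]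
  rw [← intervalIntegral.integral_add_adjacent_intervals (hint 0 (exitMin B x t)) (hint _ t)]
  have e1 : ∫ r in exitMin B x t..t, B.indicator h (GrunwaldChain.killPath B c x r) = 0 := by
    rw [intervalIntegral.integral_congr_ae (g := fun _ => (0 : ℝ))]
    · simp
    · refine Eventually.of_forall fun r hr => ?_
      rw [Set.uIoc_of_le (exitMin_le B x t)] at hr
      have hr0 : 0 ≤ r := h0.trans hr.1.le
      rw [GrunwaldChain.killPath, if_pos, Set.indicator_of_notMem hc]
      rw [max_eq_left hr0]
      rcases hx.exitMin_eq_or B t with h1 | h1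
      · linarith [hr.1, hr.2]
      · exact ⟨_, ⟨h0, hr.1.le⟩, h1⟩
  rw [e1, add_zero]
  refine intervalIntegral.integral_congr_ae ?_
  filter_upwards [hne] with r hr1 hr
  rw [Set.uIoc_of_le h0] at hr
  have hr2 : r < exitMin B x t := lt_of_le_of_ne hr.2 hr1
  have : ¬ ∃ s ∈ Set.Icc 0 r, x s ∉ B := by
    push Not
    exact fun s hs => mem_of_lt_exitMin hs.1 (hs.2.trans_lt hr2)
  rw [GrunwaldChain.killPath, max_eq_left hr.1.le, if_neg this,
    Set.indicator_of_mem (mem_of_lt_exitMin hr.1.le hr2)]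

/-- By right continuity a visit to the complement lasts for a while, so rational times detect it.
The strict inequality `u < s` leaves room for such a time. -/
theorem RegPath.exists_notMem_iff (hx : RegPath x) (B : Set ℤ) {s : ℝ} :
    (∃ u, 0 ≤ u ∧ u < s ∧ x u ∉ B) ↔ ∃ q : ℚ, 0 ≤ (q : ℝ) ∧ (q : ℝ) < s ∧ x q ∉ B := by
  constructor
  · rintro ⟨u, h0, h1, h2⟩
    obtain ⟨b, hb, hb'⟩ := mem_nhdsGT_iff_exists_Ioo_subset.1 (hx.rc u)
    obtain ⟨q, hq1, hq2⟩ := exists_rat_btwn (lt_min hb h1)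
    refine ⟨q, h0.trans hq1.le, hq2.trans_le (min_le_right _ _), ?_⟩
    rwa [(hb' ⟨hq1, hq2.trans_le (min_le_left _ _)⟩ : x q = x u)]
  · rintro ⟨q, h⟩
    exact ⟨q, h⟩

end Path

section

variable {Ω : Type*} [MeasurableSpace Ω] {X : ℝ → Ω → ℤ}

theorem IsProc.measurableSet_exists_notMem (hX : IsProc X) (B : Set ℤ) (s : ℝ) :
    MeasurableSet[past X s] {ω | ∃ u, 0 ≤ u ∧ u < s ∧ X u ω ∉ B} := by
  have : {ω | ∃ u, 0 ≤ u ∧ u < s ∧ X u ω ∉ B} =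
      ⋃ q : ℚ, {ω | 0 ≤ (q : ℝ) ∧ (q : ℝ) < s ∧ X q ω ∉ B} := by
    ext ω
    rw [Set.mem_iUnion]
    exact (hX.reg ω).exists_notMem_iff B
  rw [this]
  refine MeasurableSet.iUnion fun q => ?_
  by_cases hq : 0 ≤ (q : ℝ) ∧ (q : ℝ) < s
  · have e : {ω | 0 ≤ (q : ℝ) ∧ (q : ℝ) < s ∧ X q ω ∉ B} = X q ⁻¹' Bᶜ := by
      ext; simp [hq.1, hq.2]
    rw [e]
    exact measurable_past X hq.1 hq.2.le (MeasurableSet.of_discrete)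
  · have e : {ω | 0 ≤ (q : ℝ) ∧ (q : ℝ) < s ∧ X q ω ∉ B} = ∅ := by
      ext; simp only [Set.mem_ofPred_eq, Set.mem_empty_iff_false]; tauto
    rw [e]
    exact @MeasurableSet.empty Ω (past X s)

theorem IsProc.isOptional_exitMin (hX : IsProc X) (B : Set ℤ) (t : ℝ) :
    IsOptional X fun ω => exitMin B (fun t => X t ω) t := by
  intro s
  simp only [exitMin_lt_iff]
  exact (MeasurableSet.const _).union (hX.measurableSet_exists_notMem B s)

theorem IsProc.killPath (hX : IsProc X) (B : Set ℤ) (c : ℤ) :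
    IsProc fun t ω => GrunwaldChain.killPath B c (fun t => X t ω) t := by
  classical
  refine ⟨fun t => ?_, fun ω => (hX.reg ω).killPath B c⟩
  have h1 : Measurable fun ω => X (exitMin B (fun t => X t ω) (max t 0)) ω :=
    hX.measurable_comp ((hX.isOptional_exitMin B _).measurable hX)
  have h2 : Measurable fun k : ℤ => if k ∈ B then k else c := measurable_of_countable _
  convert! h2.comp h1 using 1
  ext ω
  rw [Function.comp_apply, ← (hX.reg ω).killPath_eq B c (le_max_right t 0)]
  simp [GrunwaldChain.killPath]

/-- Killing a process at the exit from a set. -/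
theorem MartPair.killPath {P : Measure Ω} [IsProbabilityMeasure P] (hX : IsProc X) {F h : ℤ → ℝ}
    (hM : MartPair P X F h) (B : Set ℤ) {c : ℤ} (hc : c ∉ B) (hF : ∀ k, k ∉ B → F k = F c) :
    MartPair P (fun t ω => GrunwaldChain.killPath B c (fun t => X t ω) t) F (B.indicator h) := by
  classical
  obtain ⟨K, hK⟩ := hM.bdd_right
  have hint : ∀ ω a b, IntervalIntegrable (fun r => h (X r ω)) volume a b := fun ω a b =>
    intervalIntegrable_comp (hX.reg ω).measurable hK a b
  have hK' : ∀ k, |B.indicator h k| ≤ K := fun k => by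
    by_cases hk : k ∈ B
    · simpa [hk] using hK k
    · simpa [hk] using (abs_nonneg _).trans (hK 0)
  have hint' : ∀ ω a b, IntervalIntegrable (fun r => B.indicator h
      (GrunwaldChain.killPath B c (fun t => X t ω) r)) volume a b := fun ω a b =>
    intervalIntegrable_comp ((hX.reg ω).killPath B c).measurable hK' a b
  refine hM.timeChange hX (τ := fun t ω => exitMin B (fun t => X t ω) (max t 0))
    (π := fun k => if k ∈ B then k else c)
    (fun t ω => exitMin_nonneg _ _ (le_max_right _ _))
    (fun s t ω _ hst => exitMin_mono (max_le_max_right 0 hst))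
    (fun t _ => hX.isOptional_exitMin B _) (hX.killPath B c)
    (fun t ω ht => by rw [max_eq_left ht]; exact (hX.reg ω).killPath_eq B c ht)
    (fun k => by by_cases hk : k ∈ B <;> simp [hk, hF]) ⟨K, hK'⟩
    (fun s t ω hs hst => ?_)
    fun t ht => ⟨K * (t + 1), fun ω a b ha hab hb => ?_⟩
  · rw [max_eq_left hs, max_eq_left (hs.trans hst),
      ← intervalIntegral.integral_interval_sub_left (hint ω 0 _) (hint ω 0 _),
      ← intervalIntegral.integral_interval_sub_left (hint' ω 0 t) (hint' ω 0 s),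
      ← (hX.reg ω).integral_exitMin B hc hK hs,
      ← (hX.reg ω).integral_exitMin B hc hK (hs.trans hst)]
  · have h1 := abs_timeIntegral_le (x := fun t => X t ω) hK a b
    have h2 := exitMin_le B (fun t => X t ω) (max t 0)
    rw [max_eq_left ht] at h2 hb
    rw [abs_of_nonneg (sub_nonneg.2 hab)] at h1
    refine h1.trans ?_
    have : 0 ≤ K := (abs_nonneg _).trans (hK 0)
    gcongr
    linarith

end

end

section

/-! ### The generator of a skip free random walk -/

/-- The transition rates of the random walk with rates `c j` for the jumps `j - 1`. -/
def walkRates (c : ℕ → ℝ) (i j : ℤ) : ℝ := if 0 ≤ j - i + 1 then c (j - i + 1).toNat else 0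

/-- The generator of the random walk with rates `c j` for the jumps `j - 1`. -/
def walkGen (c : ℕ → ℝ) (F : ℤ → ℝ) (x : ℤ) : ℝ := ∑' j : ℕ, c j * F (x + j - 1)

theorem IsCenteredSkipFree.one_neg {c : ℕ → ℝ} (hc : IsCenteredSkipFree c) : c 1 < 0 := by
  have := sum_le_hasSum {0, 1} (fun j hj => hc.nonneg j (by
    simp only [Finset.mem_insert, Finset.mem_singleton, not_or] at hj; omega)) hc.hasSum
  rw [Finset.sum_pair (by norm_num)] at this
  linarith [hc.zero_pos]

theorem IsCenteredSkipFree.hasSum_abs {c : ℕ → ℝ} (hc : IsCenteredSkipFree c) :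
    HasSum (fun j => |c j|) (-2 * c 1) := by
  refine hasSum_abs_of_hasSum_zero (fun k hk => ?_) hc.one_neg.le hc.hasSum
  rcases k with _ | _ | k
  · exact hc.zero_pos.le
  · omega
  · exact hc.nonneg _ (by omega)

theorem injective_walk_shift (i : ℤ) : Function.Injective fun j : ℕ => i + j - 1 := by
  intro a b h
  simp only at h
  omega

theorem walkRates_of_notMem (c : ℕ → ℝ) (i : ℤ) {k : ℤ} (hk : k ∉ Set.range fun j : ℕ => i + j - 1) :
    walkRates c i k = 0 := by
  rw [walkRates, if_neg]
  intro h
  exact hk ⟨(k - i + 1).toNat, by simp only; omega⟩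

theorem walkRates_shift (c : ℕ → ℝ) (i : ℤ) (j : ℕ) : walkRates c i (i + j - 1) = c j := by
  rw [walkRates, if_pos (by omega)]
  congr 1
  omega

theorem tsum_walkRates_mul (c : ℕ → ℝ) (F : ℤ → ℝ) (i : ℤ) :
    ∑' k, walkRates c i k * F k = walkGen c F i := by
  rw [walkGen, ← (injective_walk_shift i).tsum_eq]
  · simp only [walkRates_shift]
  · intro k hk
    by_contra h
    exact hk (by simp [walkRates_of_notMem c i h])

theorem IsCenteredSkipFree.hasSum_abs_walkRates {c : ℕ → ℝ} (hc : IsCenteredSkipFree c) (i : ℤ) :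
    HasSum (fun k => |walkRates c i k|) (-2 * c 1) := by
  rw [← (injective_walk_shift i).hasSum_iff]
  · simpa only [Function.comp_def, walkRates_shift] using hc.hasSum_abs
  · intro k hk
    rw [walkRates_of_notMem c i hk, abs_zero]

theorem IsCenteredSkipFree.summable_mul {c : ℕ → ℝ} (hc : IsCenteredSkipFree c) {f : ℕ → ℝ} {K : ℝ}
    (hf : ∀ j, |f j| ≤ K) : Summable fun j => c j * f j :=
  summable_mul_of_abs_le hc.hasSum_abs.summable hf

theorem IsCenteredSkipFree.abs_tsum_mul_le {c : ℕ → ℝ} (hc : IsCenteredSkipFree c) {f : ℕ → ℝ}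
    {K : ℝ} (hf : ∀ j, |f j| ≤ K) : |∑' j, c j * f j| ≤ -2 * c 1 * K :=
  GrunwaldChain.abs_tsum_mul_le hc.hasSum_abs.summable hc.hasSum_abs.tsum_eq.le
    ((abs_nonneg _).trans (hf 0)) hf

/-! ### Markov property -/

/-- The times in `I` are put in increasing order; the last one is `s`, and `s + δ` is appended. The
two product formulas differ by the last factor. -/
theorem cylinderSet_succ_of_fdd {Ω : Type*} [MeasurableSpace Ω] {P : Measure Ω}
    {X : ℝ → Ω → ℤ} {p : ℝ≥0 → ℤ → ℤ → ℝ}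
    (hfdd : ∀ (k : ℕ) (t : Fin (k + 1) → ℝ≥0), Monotone t → ∀ s : Fin (k + 1) → ℤ,
      P.real {ω | ∀ i, X (t i) ω = s i} = P.real {ω | X (t 0) ω = s 0} *
        ∏ i : Fin k, p (t i.succ - t i.castSucc) (s i.castSucc) (s i.succ))
    {s : ℝ} (δ : ℝ≥0) {I : Finset ℝ} (hI : ∀ u ∈ I, 0 ≤ u ∧ u ≤ s) (hsI : s ∈ I)
    (v : ℝ → ℤ) (j : ℤ) :
    P.real (cylinderSet X I v ∩ {ω | X (s + δ) ω = j}) =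
      P.real (cylinderSet X I v) * p δ (v s) j := by
  obtain ⟨k, hk⟩ : ∃ k, I.card = k + 1 :=
    Nat.exists_eq_succ_of_ne_zero (Finset.card_ne_zero.2 ⟨s, hsI⟩)
  let e := I.orderEmbOfFin hk
  have heI : ∀ i, e i ∈ I := fun i => I.orderEmbOfFin_mem hk i
  have he0 : ∀ i, 0 ≤ e i := fun i => (hI _ (heI i)).1
  have hlast : e (Fin.last k) = s := by
    have h1 : s ∈ Set.range e := by
      rw [I.range_orderEmbOfFin hk]; exact hsI
    obtain ⟨i, hi⟩ := h1
    refine le_antisymm (hI _ (heI _)).2 ?_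
    rw [← hi]
    exact e.monotone (Fin.le_last i)
  let t : Fin (k + 1) → ℝ≥0 := fun i => (e i).toNNReal
  have ht : ∀ i, (t i : ℝ) = e i := fun i => Real.coe_toNNReal _ (he0 i)
  have htm : Monotone t := fun a b hab => Real.toNNReal_le_toNNReal (e.monotone hab)
  let t' : Fin (k + 2) → ℝ≥0 := Fin.snoc t (t (Fin.last k) + δ)
  let x' : Fin (k + 2) → ℤ := Fin.snoc (fun i => v (e i)) j
  have ht'm : Monotone t' := by
    intro a b hab
    induction b using Fin.lastCases with
    | last =>
      induction a using Fin.lastCases with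
      | last => exact le_rfl
      | cast a =>
        simp only [t', Fin.snoc_castSucc, Fin.snoc_last]
        exact (htm (Fin.le_last a)).trans le_self_add
    | cast b =>
      induction a using Fin.lastCases with
      | last => exact absurd hab (not_le.2 (Fin.castSucc_lt_last b))
      | cast a =>
        simp only [t', Fin.snoc_castSucc]
        exact htm (Fin.castSucc_le_castSucc_iff.1 hab)
  have hcyl : cylinderSet X I v = {ω | ∀ i, X (t i) ω = v (e i)} := by
    ext ω
    simp only [cylinderSet, Set.mem_ofPred_eq, ht]
    constructor
    · exact fun h i => h _ (heI i)
    · intro h u hu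
      have h1 : u ∈ Set.range e := by
        rw [I.range_orderEmbOfFin hk]; exact hu
      obtain ⟨i, rfl⟩ := h1
      exact h i
  have hcyl' : cylinderSet X I v ∩ {ω | X (s + δ) ω = j} = {ω | ∀ i, X (t' i) ω = x' i} := by
    rw [hcyl]
    ext ω
    simp only [Set.mem_inter_iff, Set.mem_ofPred_eq, Fin.forall_fin_succ', t', x',
      Fin.snoc_castSucc, Fin.snoc_last, NNReal.coe_add, ht, hlast]
  have h1 := hfdd (k + 1) t' ht'm x'
  have h2 := hfdd k t htm fun i => v (e i)
  rw [hcyl', hcyl, h1, h2, Fin.prod_univ_castSucc]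
  have e1 : t' 0 = t 0 := Fin.snoc_castSucc (α := fun _ => ℝ≥0) _ _ (0 : Fin (k + 1))
  have e2 : x' 0 = v (e 0) := Fin.snoc_castSucc (α := fun _ => ℤ) _ _ (0 : Fin (k + 1))
  have e3 : ∀ i : Fin k, t' i.castSucc.succ = t i.succ := fun i => by
    rw [Fin.succ_castSucc]; exact Fin.snoc_castSucc (α := fun _ => ℝ≥0) _ _ _
  have e4 : ∀ i : Fin k, x' i.castSucc.succ = v (e i.succ) := fun i => by
    rw [Fin.succ_castSucc]; exact Fin.snoc_castSucc (α := fun _ => ℤ) _ _ _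
  have e5 : t' (Fin.last k).succ = t (Fin.last k) + δ := by
    rw [Fin.succ_last]; exact Fin.snoc_last (α := fun _ => ℝ≥0) _ _
  have e6 : x' (Fin.last k).succ = j := by
    rw [Fin.succ_last]; exact Fin.snoc_last (α := fun _ => ℤ) _ _
  have e7 : ∀ i : Fin (k + 1), t' i.castSucc = t i := fun i =>
    Fin.snoc_castSucc (α := fun _ => ℝ≥0) _ _ _
  have e8 : ∀ i : Fin (k + 1), x' i.castSucc = v (e i) := fun i =>
    Fin.snoc_castSucc (α := fun _ => ℤ) _ _ _
  simp only [e1, e2, e3, e4, e5, e6, e7, e8, hlast, add_tsub_cancel_left]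
  ring

section

variable {Ω : Type*} [MeasurableSpace Ω] {P : Measure Ω} [IsProbabilityMeasure P]
  {X : ℝ → Ω → ℤ}

/-- The Markov property with respect to the past. -/
def HasTransition (P : Measure Ω) (X : ℝ → Ω → ℤ) (p : ℝ≥0 → ℤ → ℤ → ℝ) : Prop :=
  ∀ (s : ℝ) (δ : ℝ≥0), 0 ≤ s → ∀ i j A, MeasurableSet[past X s] A → (∀ ω ∈ A, X s ω = i) →
    P.real (A ∩ {ω | X (s + δ) ω = j}) = P.real A * p δ i j

theorem hasTransition_of_fdd (hX : ∀ t, Measurable (X t)) {p : ℝ≥0 → ℤ → ℤ → ℝ}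
    (hfdd : ∀ (k : ℕ) (t : Fin (k + 1) → ℝ≥0), Monotone t → ∀ s : Fin (k + 1) → ℤ,
      P.real {ω | ∀ i, X (t i) ω = s i} = P.real {ω | X (t 0) ω = s 0} *
        ∏ i : Fin k, p (t i.succ - t i.castSucc) (s i.castSucc) (s i.succ)) :
    HasTransition P X p := by
  classical
  intro s δ hs i j A hA hAi
  have hSi : MeasurableSet {ω | X s ω = i} := hX s (measurableSet_singleton i)
  have hSj : MeasurableSet {ω | X (s + δ) ω = j} := hX _ (measurableSet_singleton j)
  let N : Ω → ℝ := fun ω => ({ω | X s ω = i} ∩ {ω | X (s + δ) ω = j}).indicator 1 ω -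
    p δ i j * {ω | X s ω = i}.indicator 1 ω
  have i1 : Integrable (({ω | X s ω = i} ∩ {ω | X (s + δ) ω = j}).indicator (1 : Ω → ℝ)) P :=
    (integrable_const 1).indicator (hSi.inter hSj)
  have i2 : Integrable ({ω | X s ω = i}.indicator (1 : Ω → ℝ)) P :=
    (integrable_const 1).indicator hSi
  have hNi : Integrable N P := i1.sub (i2.const_mul _)
  have hN : ∀ B, MeasurableSet B → ∫ ω in B, N ω ∂P =
      P.real (B ∩ {ω | X s ω = i} ∩ {ω | X (s + δ) ω = j}) -
        p δ i j * P.real (B ∩ {ω | X s ω = i}) := by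
    intro B hB
    rw [integral_sub i1.integrableOn (i2.const_mul _).integrableOn, integral_const_mul,
      setIntegral_indicator (hSi.inter hSj), setIntegral_indicator hSi]
    simp [Set.inter_assoc]
  have key := setIntegral_eq_zero_of_past hX (s := s) hNi (fun I v hI => ?_) hA
  · rw [hN A (past_le hX s A hA)] at key
    have : A ∩ {ω | X s ω = i} = A := Set.inter_eq_left.2 hAi
    rw [this] at key
    linarith
  · rw [hN _ (measurableSet_cylinderSet hX I v)]
    -- Either the cylinder prescribes another value at `s` and the event is empty, or the condition
    -- `X s = i` can be added to it, which makes `s` its last time.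
    by_cases h : s ∈ I ∧ v s ≠ i
    · have : cylinderSet X I v ∩ {ω | X s ω = i} = ∅ := by
        ext ω
        simp only [Set.mem_inter_iff, Set.mem_ofPred_eq, Set.mem_empty_iff_false, iff_false,
          cylinderSet]
        rintro ⟨h1, h2⟩
        exact h.2 ((h1 s h.1).symm.trans h2)
      simp [this]
    · have : cylinderSet X I v ∩ {ω | X s ω = i} =
          cylinderSet X (insert s I) (Function.update v s i) := by
        ext ω
        simp only [Set.mem_inter_iff, Set.mem_ofPred_eq, cylinderSet, Finset.forall_mem_insert,
          Function.update_self]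
        constructor
        · rintro ⟨h1, h2⟩
          refine ⟨h2, fun u hu => ?_⟩
          by_cases hus : u = s
          · subst hus; simpa using h2
          · simpa [hus] using h1 u hu
        · rintro ⟨h1, h2⟩
          refine ⟨fun u hu => ?_, h1⟩
          by_cases hus : u = s
          · subst hus
            rw [h1]
            by_contra hne
            exact h ⟨hu, fun e => hne e.symm⟩
          · simpa [hus] using h2 u hu
      rw [this, cylinderSet_succ_of_fdd hfdd δ (I := insert s I) ?_ (Finset.mem_insert_self _ _)]
      · rw [Function.update_self]; ring
      · intro u hu
        rcases Finset.mem_insert.1 hu with rfl | hu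
        exacts [⟨hs, le_rfl⟩, hI u hu]

theorem setIntegral_eq_tsum_fiber {Z : Ω → ℤ} (hZ : Measurable Z) {F : ℤ → ℝ} {K : ℝ}
    (hF : ∀ k, |F k| ≤ K) {A : Set Ω} (hA : MeasurableSet A) :
    ∫ ω in A, F (Z ω) ∂P = ∑' j, P.real (A ∩ {ω | Z ω = j}) * F j := by
  have e : A = ⋃ j, A ∩ {ω | Z ω = j} := by ext ω; simp
  have hm : ∀ j, MeasurableSet (A ∩ {ω | Z ω = j}) := fun j =>
    hA.inter (hZ (measurableSet_singleton j))
  conv_lhs => rw [e]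
  rw [integral_iUnion hm]
  · refine tsum_congr fun j => ?_
    rw [setIntegral_congr_fun (g := fun _ => F j) (hm j) (fun ω hω => by rw [hω.2])]
    simp
  · intro a b hab
    exact Set.disjoint_left.2 fun ω h1 h2 => hab (h1.2.symm.trans h2.2)
  · exact (integrable_of_bdd ((measurable_of_countable F).comp hZ) fun _ => hF _).integrableOn

/-- The Markov estimates hold on events that fix the present state; since their constants are
uniform in the state, they add up over the partition. -/
theorem abs_setIntegral_le_of_partition {ι : Type*} [Countable ι] [MeasurableSpace ι]
    [MeasurableSingletonClass ι] {Z : Ω → ι} (hZ : Measurable Z) {N : Ω → ℝ} (hN : Integrable N P)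
    {A : Set Ω} (hA : MeasurableSet A) {b : ℝ}
    (h : ∀ z, |∫ ω in A ∩ {ω | Z ω = z}, N ω ∂P| ≤ b * P.real (A ∩ {ω | Z ω = z})) :
    |∫ ω in A, N ω ∂P| ≤ b * P.real A := by
  have e : A = ⋃ j, A ∩ {ω | Z ω = j} := by ext ω; simp
  have hm : ∀ j, MeasurableSet (A ∩ {ω | Z ω = j}) := fun j =>
    hA.inter (hZ (measurableSet_singleton j))
  have hd : Pairwise (Function.onFun Disjoint fun j => A ∩ {ω | Z ω = j}) := fun a b hab =>
    Set.disjoint_left.2 fun ω h1 h2 => hab (h1.2.symm.trans h2.2)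
  have h1 := hasSum_integral_iUnion hm hd (f := N) (μ := P) hN.integrableOn
  have h2 := hasSum_integral_iUnion hm hd (f := fun _ => (1 : ℝ)) (μ := P)
    (integrable_const _).integrableOn
  rw [← e] at h1 h2
  simp only [integral_const, measureReal_restrict_apply_univ, smul_eq_mul, mul_one] at h2
  rw [abs_le]
  constructor
  · have := hasSum_le (fun z => (abs_le.1 (h z)).1) (h2.mul_left b).neg h1
    simpa using this
  · exact hasSum_le (fun z => (abs_le.1 (h z)).2) h1 (h2.mul_left b)

variable {c : ℕ → ℝ} {p : ℝ≥0 → ℤ → ℤ → ℝ}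

theorem HasTransition.one_step (hX : IsProc X) (hT : HasTransition P X p)
    (hp : IsTransitionFunction (walkRates c) p) (hc : IsCenteredSkipFree c) {s δ : ℝ} (hs : 0 ≤ s)
    (hδ : 0 ≤ δ) {F : ℤ → ℝ} {K : ℝ} (hF : ∀ k, |F k| ≤ K) {A : Set Ω}
    (hA : MeasurableSet[past X s] A) {i : ℤ} (hAi : ∀ ω ∈ A, X s ω = i) :
    |∫ ω in A, (F (X (s + δ) ω) - F i - δ * walkGen c F i) ∂P| ≤
      2 * (-2 * c 1) ^ 2 * K * δ ^ 2 * P.real A := by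
  have hA' := past_le hX.meas s A hA
  lift δ to ℝ≥0 using hδ
  have h1 : ∫ ω in A, (F (X (s + δ) ω) - F i - δ * walkGen c F i) ∂P =
      P.real A * (∑' j, p δ i j * F j - F i - δ * ∑' j, walkRates c i j * F j) := by
    have i1 : Integrable (fun ω => F (X (s + δ) ω)) (P.restrict A) :=
      (integrable_comp hX hF measurable_const).integrableOn
    have i2 : Integrable (fun ω => F (X (s + δ) ω) - F i) (P.restrict A) :=
      i1.sub (integrable_const _)
    rw [integral_sub i2 (integrable_const _), integral_sub i1 (integrable_const _),
      setIntegral_eq_tsum_fiber (hX.meas _) hF hA', tsum_walkRates_mul]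
    simp only [hT s δ hs i _ A hA hAi, integral_const, measureReal_restrict_apply_univ, smul_eq_mul,
      mul_assoc, tsum_mul_left]
    ring
  have h2 := hp.abs_tsum_sub_le (fun i => (hc.hasSum_abs_walkRates i).summable)
    (fun i => (hc.hasSum_abs_walkRates i).tsum_eq.le) (by linarith [hc.one_neg]) hF
    ((abs_nonneg _).trans (hF 0)) δ i
  rw [h1, abs_mul, abs_of_nonneg measureReal_nonneg, mul_comm]
  exact mul_le_mul_of_nonneg_right h2 measureReal_nonneg

/-- The bound `1 - p δ i i ≤ C δ` is uniform in the state `i`, so it survives summation over the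
present state. -/
theorem HasTransition.prob_ne_le (hX : IsProc X) (hT : HasTransition P X p)
    (hp : IsTransitionFunction (walkRates c) p) (hc : IsCenteredSkipFree c) {s δ : ℝ} (hs : 0 ≤ s)
    (hδ : 0 ≤ δ) {A : Set Ω} (hA : MeasurableSet[past X s] A) :
    P.real (A ∩ {ω | X (s + δ) ω ≠ X s ω}) ≤ (-2 * c 1) * δ * P.real A := by
  have hA' := past_le hX.meas s A hA
  have hne : MeasurableSet {ω | X (s + δ) ω ≠ X s ω} :=
    (measurableSet_eq_fun (hX.meas _) (hX.meas _)).compl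
  have h1 : P.real (A ∩ {ω | X (s + δ) ω ≠ X s ω}) =
      ∫ ω in A, {ω | X (s + δ) ω ≠ X s ω}.indicator (1 : Ω → ℝ) ω ∂P := by
    rw [setIntegral_indicator hne]; simp
  rw [h1]
  refine (le_abs_self _).trans (abs_setIntegral_le_of_partition (hX.meas s)
    ((integrable_const 1).indicator hne) hA' fun i => ?_)
  have hAi : MeasurableSet[past X s] (A ∩ {ω | X s ω = i}) :=
    hA.inter (measurable_past X hs le_rfl (measurableSet_singleton i))
  have hAi' := past_le hX.meas s _ hAi
  lift δ to ℝ≥0 using hδ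
  have h2 := hT s δ hs i i _ hAi fun ω hω => hω.2
  rw [setIntegral_indicator hne]
  simp only [Pi.one_apply, integral_const, measureReal_restrict_apply_univ, smul_eq_mul, mul_one]
  rw [abs_of_nonneg measureReal_nonneg]
  have h3 := measureReal_inter_add_sdiff (μ := P) (s := A ∩ {ω | X s ω = i})
    (hX.meas (s + δ) (measurableSet_singleton i))
  have h4 : A ∩ {ω | X s ω = i} ∩ {ω | X (s + δ) ω ≠ X s ω} =
      (A ∩ {ω | X s ω = i}) \ (X (s + δ) ⁻¹' {i}) := by
    ext ω
    simp only [Set.mem_inter_iff, Set.mem_ofPred_eq, Set.mem_sdiff, Set.mem_preimage,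
      Set.mem_singleton_iff]
    constructor
    · rintro ⟨⟨h1, h2⟩, h3⟩; exact ⟨⟨h1, h2⟩, fun h => h3 (h.trans h2.symm)⟩
    · rintro ⟨⟨h1, h2⟩, h3⟩; exact ⟨⟨h1, h2⟩, fun h => h3 (h.trans h2)⟩
  have h5 := hp.one_sub_diag_le (fun i => (hc.hasSum_abs_walkRates i).summable)
    (fun i => (hc.hasSum_abs_walkRates i).tsum_eq.le) δ i
  have h6 : X (s + δ) ⁻¹' {i} = {ω | X (s + δ) ω = i} := rfl
  rw [h4]
  rw [h6] at h3 ⊢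
  rw [h2] at h3
  have h7 := mul_le_mul_of_nonneg_right h5 (measureReal_nonneg (μ := P) (s := A ∩ {ω | X s ω = i}))
  linarith

/-- The martingale pairs of a skip free random walk. -/
theorem HasTransition.martPair (hX : IsProc X) (hT : HasTransition P X p)
    (hp : IsTransitionFunction (walkRates c) p) (hc : IsCenteredSkipFree c) {F : ℤ → ℝ}
    (hF : ∃ K, ∀ k, |F k| ≤ K) : MartPair P X F (walkGen c F) := by
  obtain ⟨K, hK⟩ := hF
  have hG : ∃ K, ∀ k, |walkGen c F k| ≤ K := ⟨_, fun k => hc.abs_tsum_mul_le fun j => hK _⟩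
  refine MartPair.of_cylinder hX ⟨K, hK⟩ hG fun s t hs hst I v hI => ?_
  refine setIntegral_increment_eq_zero hX ⟨K, hK⟩ hG hst
    (C := 2 * (-2 * c 1) ^ 2 * K * P.real (cylinderSet X I v)) fun u hu δ hδ _ => ?_
  have hA : MeasurableSet[past X u] (cylinderSet X I v) :=
    measurableSet_past_cylinderSet X fun r hr => ⟨(hI r hr).1, (hI r hr).2.trans hu⟩
  obtain ⟨K', hK'⟩ := hG
  have hi : Integrable (fun ω => F (X (u + δ) ω) - F (X u ω) - δ * walkGen c F (X u ω)) P :=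
    ((integrable_comp hX hK measurable_const).sub (integrable_comp hX hK measurable_const)).sub
      ((integrable_comp hX hK' measurable_const).const_mul δ)
  refine (abs_setIntegral_le_of_partition (hX.meas u) hi (past_le hX.meas u _ hA)
    (b := 2 * (-2 * c 1) ^ 2 * K * δ ^ 2) fun i => ?_).trans (le_of_eq (by ring))
  have hAi : MeasurableSet[past X u] (cylinderSet X I v ∩ {ω | X u ω = i}) :=
    hA.inter (measurable_past X (hs.trans hu) le_rfl (measurableSet_singleton i))
  have := hT.one_step hX hp hc (hs.trans hu) hδ.le hK hAi fun ω hω => hω.2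
  rwa [setIntegral_congr_fun (past_le hX.meas u _ hAi)
    (g := fun ω => F (X (u + δ) ω) - F i - δ * walkGen c F i) fun ω hω => by
      have : X u ω = i := hω.2
      simp only [this]]

end

end

section

/-! ### Reflection of integer-valued paths -/

section Path

variable {x : ℝ → ℤ}

/-- One-sided limits bound the path near each point, and `[0, t]` is compact. -/
theorem RegPath.exists_lower_bound (hx : RegPath x) (t : ℝ) :
    ∃ m : ℤ, ∀ s ∈ Set.Icc 0 t, m ≤ x s := by
  refine IsCompact.induction_on (p := fun S => ∃ m : ℤ, ∀ s ∈ S, m ≤ x s) isCompact_Icc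
    ⟨0, by simp⟩ (fun S T hST ⟨m, hm⟩ => ⟨m, fun s hs => hm s (hST hs)⟩)
    (fun S T ⟨m, hm⟩ ⟨m', hm'⟩ => ⟨min m m', ?_⟩) fun u _ => ?_
  · rintro s (hs | hs)
    exacts [(min_le_left _ _).trans (hm s hs), (min_le_right _ _).trans (hm' s hs)]
  · obtain ⟨l, hl⟩ := hx.ll u
    have hr := hx.rc_Ici u
    have : ∀ᶠ s in 𝓝 u, min l (x u) ≤ x s := by
      rw [← nhdsLT_sup_nhdsGE, eventually_sup]
      exact ⟨hl.mono fun s hs => hs ▸ min_le_left _ _, hr.mono fun s hs => hs ▸ min_le_right _ _⟩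
    exact ⟨_, mem_nhdsWithin_of_mem_nhds this, min l (x u), fun s hs => hs⟩

/-- The running minimum of `min (x - 1) 0`. -/
def runMin (x : ℝ → ℤ) (t : ℝ) : ℤ := sInf ((fun s => min (x s - 1) 0) '' Set.Icc 0 t)

/-- The path `x` reflected at `1`. -/
def reflPath (x : ℝ → ℤ) (t : ℝ) : ℤ := x (max t 0) - runMin x (max t 0)

theorem RegPath.bddBelow_runMin (hx : RegPath x) (t : ℝ) :
    BddBelow ((fun s => min (x s - 1) 0) '' Set.Icc 0 t) := by
  obtain ⟨m, hm⟩ := hx.exists_lower_bound t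
  refine ⟨min (m - 1) 0, ?_⟩
  rintro _ ⟨s, hs, rfl⟩
  have := hm s hs
  simp only
  omega

theorem RegPath.runMin_le (hx : RegPath x) {s t : ℝ} (hs : s ∈ Set.Icc 0 t) :
    runMin x t ≤ min (x s - 1) 0 := csInf_le (hx.bddBelow_runMin t) ⟨s, hs, rfl⟩

theorem RegPath.exists_runMin_eq (hx : RegPath x) {t : ℝ} (ht : 0 ≤ t) :
    ∃ s ∈ Set.Icc 0 t, min (x s - 1) 0 = runMin x t :=
  Int.csInf_mem (s := (fun s => min (x s - 1) 0) '' Set.Icc 0 t) ⟨_, 0, ⟨le_rfl, ht⟩, rfl⟩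
    (hx.bddBelow_runMin t)

theorem RegPath.runMin_eq_min (hx : RegPath x) {s t : ℝ} (hs : 0 ≤ s) (hst : s ≤ t) {a : ℤ}
    (h : ∀ u, s ≤ u → u ≤ t → x u = x s ∨ x u = a) (ha : ∃ u, s ≤ u ∧ u ≤ t ∧ x u = a) :
    runMin x t = min (runMin x s) (min (a - 1) 0) := by
  apply le_antisymm
  · obtain ⟨u, h1, h2, h3⟩ := ha
    refine le_min ?_ (h3 ▸ hx.runMin_le ⟨hs.trans h1, h2⟩)
    obtain ⟨v, hv, hve⟩ := hx.exists_runMin_eq hs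
    rw [← hve]
    exact hx.runMin_le ⟨hv.1, hv.2.trans hst⟩
  · obtain ⟨v, hv, hve⟩ := hx.exists_runMin_eq (hs.trans hst)
    rw [← hve]
    rcases le_total v s with h1 | h1
    · exact (min_le_left _ _).trans (hx.runMin_le ⟨hv.1, h1⟩)
    · rcases h v h1 hv.2 with h2 | h2
      · rw [h2]; exact (min_le_left _ _).trans (hx.runMin_le ⟨hs, le_rfl⟩)
      · rw [h2]; exact min_le_right _ _

theorem RegPath.reflPath_pos (hx : RegPath x) (t : ℝ) : 1 ≤ reflPath x t := by
  have := hx.runMin_le (s := max t 0) (t := max t 0) ⟨le_max_right _ _, le_rfl⟩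
  rw [reflPath]
  omega

/-- If the path changes only from its first to its last value, the running minimum is updated at the
end point alone, and reflection becomes a single step of Lindley's recursion. -/
theorem RegPath.reflPath_eq_max (hx : RegPath x) {s t : ℝ} (hs : 0 ≤ s) (hst : s ≤ t)
    (h : ∀ u, s ≤ u → u ≤ t → x u = x s ∨ x u = x t) :
    reflPath x t = max (reflPath x s + x t - x s) 1 := by
  have h1 := hx.runMin_eq_min hs hst h ⟨t, hst, le_rfl, rfl⟩
  have h2 := hx.runMin_le (s := s) (t := s) ⟨hs, le_rfl⟩
  rw [reflPath, reflPath, max_eq_left hs, max_eq_left (hs.trans hst), h1]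
  omega

theorem RegPath.reflPath_zero (hx : RegPath x) (h : 1 ≤ x 0) : reflPath x 0 = x 0 := by
  obtain ⟨s, hs, hse⟩ := hx.exists_runMin_eq (le_refl (0 : ℝ))
  have : s = 0 := le_antisymm hs.2 hs.1
  subst this
  rw [reflPath, max_self]
  omega

theorem RegPath.reflPath (hx : RegPath x) : RegPath (reflPath x) := by
  refine RegPath.of_max (y := fun t => x t - runMin x t) (fun t ht => ?_) fun t ht => ?_
  · obtain ⟨b, hb, hb'⟩ := mem_nhdsGT_iff_exists_Ioo_subset.1 (hx.rc t)
    filter_upwards [Ioo_mem_nhdsGT hb] with u hu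
    have hu' : x u = x t := hb' hu
    have h1 := hx.runMin_eq_min ht hu.1.le (a := x t) (fun v h1 h2 => by
      rcases h1.eq_or_lt with rfl | h1
      · exact Or.inl rfl
      · exact Or.inl (hb' ⟨h1, h2.trans_lt hu.2⟩)) ⟨t, le_rfl, hu.1.le, rfl⟩
    have h2 := hx.runMin_le (s := t) (t := t) ⟨ht, le_rfl⟩
    rw [hu', h1, min_eq_left h2]
  · obtain ⟨l, hl⟩ := hx.ll t
    obtain ⟨b, hb, hb'⟩ := mem_nhdsLT_iff_exists_Ioo_subset.1 hl
    have hb : b < t := hb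
    obtain ⟨u₀, h1, h2⟩ := exists_between (max_lt hb ht)
    have hu0 : 0 < u₀ := (le_max_right _ _).trans_lt h1
    have hub : b < u₀ := (le_max_left _ _).trans_lt h1
    refine ⟨l - runMin x u₀, ?_⟩
    filter_upwards [Ioo_mem_nhdsLT h2] with u hu
    have hxl : ∀ v, u₀ ≤ v → v < t → x v = l := fun v h3 h4 => hb' ⟨hub.trans_le h3, h4⟩
    have h3 := hx.runMin_eq_min hu0.le hu.1.le (a := x u₀) (fun v h3 h4 => by
      rw [hxl v h3 (h4.trans_lt hu.2), hxl u₀ le_rfl h2]; exact Or.inl rfl)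
      ⟨u₀, le_rfl, hu.1.le, rfl⟩
    have h4 := hx.runMin_le (s := u₀) (t := u₀) ⟨hu0.le, le_rfl⟩
    rw [hxl u hu.1.le hu.2, h3, min_eq_left h4]

end Path

/-! ### The reflected walk as a process and its generator -/

section

variable {Ω : Type*} [MeasurableSpace Ω] {X : ℝ → Ω → ℤ}

theorem IsProc.measurable_past_reflPath (hX : IsProc X) {t s : ℝ} (ht : 0 ≤ t) (hts : t ≤ s) :
    Measurable[past X s] (fun ω => reflPath (fun t => X t ω) t) := by
  have h1 : Measurable[past X s] (fun ω => runMin (fun t => X t ω) t) := by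
    refine @measurable_of_Iic ℤ Ω _ _ _ (past X s) _ _ _ _ fun v => ?_
    -- The running minimum never exceeds `0`, which settles `0 ≤ v`. The end point `t` is listed
    -- separately because the event of leaving a set concerns times strictly before `t`.
    have e : (fun ω => runMin (fun t => X t ω) t) ⁻¹' Set.Iic v =
        {ω | 0 ≤ v} ∪ ({ω | ∃ u, 0 ≤ u ∧ u < t ∧ X u ω ∉ Set.Ioi (v + 1)} ∪
          X t ⁻¹' Set.Iic (v + 1)) := by
      ext ω
      simp only [Set.mem_preimage, Set.mem_Iic, Set.mem_union, Set.mem_ofPred_eq, Set.mem_Ioi,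
        not_lt]
      constructor
      · intro h
        obtain ⟨u, hu, hue⟩ := (hX.reg ω).exists_runMin_eq ht
        by_cases hv : 0 ≤ v
        · exact Or.inl hv
        · right
          have h3 : X u ω ≤ v + 1 := by omega
          rcases hu.2.eq_or_lt with rfl | h2
          · exact Or.inr h3
          · exact Or.inl ⟨u, hu.1, h2, h3⟩
      · rintro (h | ⟨u, h1, h2, h3⟩ | h)
        · have := (hX.reg ω).runMin_le (s := t) (t := t) ⟨ht, le_rfl⟩
          omega
        · have := (hX.reg ω).runMin_le (s := u) (t := t) ⟨h1, h2.le⟩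
          omega
        · have := (hX.reg ω).runMin_le (s := t) (t := t) ⟨ht, le_rfl⟩
          omega
    rw [e]
    exact (MeasurableSet.const _).union
      ((past_mono X hts _ (hX.measurableSet_exists_notMem _ t)).union
        (measurable_past X ht hts (MeasurableSet.of_discrete)))
  have h2 := (measurable_of_countable fun q : ℤ × ℤ => q.1 - q.2).comp
    ((measurable_past X ht hts).prodMk h1)
  convert! h2 using 1
  ext ω
  simp [reflPath, max_eq_left ht]

theorem IsProc.reflPath (hX : IsProc X) :
    IsProc fun t ω => GrunwaldChain.reflPath (fun t => X t ω) t := by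
  refine ⟨fun t => ?_, fun ω => (hX.reg ω).reflPath⟩
  have := (hX.measurable_past_reflPath (le_max_right t 0) le_rfl).mono
    (past_le hX.meas _) le_rfl
  convert! this using 1
  ext ω
  simp [GrunwaldChain.reflPath]

theorem IsProc.past_reflPath_le (hX : IsProc X) (s : ℝ) :
    past (fun t ω => GrunwaldChain.reflPath (fun t => X t ω) t) s ≤ past X s := by
  refine MeasurableSpace.generateFrom_le ?_
  rintro A ⟨I, v, hI, rfl⟩
  have : cylinderSet (fun t ω => GrunwaldChain.reflPath (fun t => X t ω) t) I v =
      ⋂ u ∈ I, (fun ω => GrunwaldChain.reflPath (fun t => X t ω) u) ⁻¹' {v u} := by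
    ext; simp [cylinderSet]
  rw [this]
  exact Finset.measurableSet_biInter I fun u hu =>
    hX.measurable_past_reflPath (hI u hu).1 (hI u hu).2 (measurableSet_singleton _)

variable {P : Measure Ω} [IsProbabilityMeasure P] {c : ℕ → ℝ} {p : ℝ≥0 → ℤ → ℤ → ℝ}

/-- The paths which in the interval `[u, u + δ]` take a value different from both end values. -/
def doubleChange {Ω : Type*} (X : ℝ → Ω → ℤ) (u δ : ℝ) : Set Ω :=
  {ω | ∃ r, u ≤ r ∧ r ≤ u + δ ∧ X r ω ≠ X u ω ∧ X r ω ≠ X (u + δ) ω}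

/-- At the first grid time where the value differs from both end values, the walk has changed in the
preceding cell and has to change again before `u + δ`. For each of the `m` cells this has
probability at most `C (δ/m) · C δ`, where `C = -2 * c 1`. -/
theorem HasTransition.prob_doubleChange_grid_le (hX : IsProc X) (hT : HasTransition P X p)
    (hp : IsTransitionFunction (walkRates c) p) (hc : IsCenteredSkipFree c) {u δ : ℝ} (hu : 0 ≤ u)
    (hδ : 0 ≤ δ) (m : ℕ) (hm : 0 < m) :
    P.real {ω | ∃ k < m, X (u + k * (δ / m)) ω ≠ X u ω ∧ X (u + k * (δ / m)) ω ≠ X (u + δ) ω} ≤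
      (-2 * c 1) ^ 2 * δ ^ 2 := by
  have hC : 0 ≤ -2 * c 1 := by linarith [hc.one_neg]
  have hm' : (0 : ℝ) < m := by exact_mod_cast hm
  let t : ℕ → ℝ := fun k => u + k * (δ / m)
  have ht0 : ∀ k, 0 ≤ t k := fun k => by positivity
  have htm : t m = u + δ := by simp only [t]; field_simp
  have hts : ∀ k, t (k + 1) = t k + δ / m := fun k => by simp only [t]; push_cast; ring
  let D : ℕ → Set Ω := fun k =>
    {ω | X (t k + δ / m) ω ≠ X (t k) ω} ∩ {ω | X (u + δ) ω ≠ X (t (k + 1)) ω}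
  have hsub : {ω | ∃ k < m, X (t k) ω ≠ X u ω ∧ X (t k) ω ≠ X (u + δ) ω} ⊆
      ⋃ k ∈ Finset.range m, D k := by
    rintro ω ⟨k, hk, h1, h2⟩
    classical
    have hex : ∃ k, X (t k) ω ≠ X u ω ∧ k < m ∧ X (t k) ω ≠ X (u + δ) ω := ⟨k, h1, hk, h2⟩
    let q := Nat.find hex
    obtain ⟨q1, q2, q3⟩ := Nat.find_spec hex
    have hq0 : Nat.find hex ≠ 0 := by
      intro h
      rw [h] at q1
      exact q1 (by simp [t])
    obtain ⟨r, hr⟩ := Nat.exists_eq_succ_of_ne_zero hq0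
    rw [hr] at q1 q2 q3
    have hmin := Nat.find_min hex (m := r) (by omega)
    simp only [Set.mem_iUnion, Finset.mem_range]
    by_cases hrr : X (t r) ω = X (t (r + 1)) ω
    · exact absurd ⟨by rw [hrr]; exact q1, by omega, by rw [hrr]; exact q3⟩ hmin
    · exact ⟨r, by omega, by rw [Set.mem_ofPred_eq, ← hts]; exact fun h => hrr h.symm,
        fun h => q3 h.symm⟩
  have hD : ∀ k ∈ Finset.range m, P.real (D k) ≤ (-2 * c 1) * δ * ((-2 * c 1) * (δ / m)) := by
    intro k hk
    have hk1 : t (k + 1) ≤ u + δ := by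
      rw [← htm]; simp only [t]
      have : ((k + 1 : ℕ) : ℝ) ≤ m := by exact_mod_cast Finset.mem_range.1 hk
      gcongr
    have hut : u ≤ t (k + 1) := by
      simp only [t]
      have : 0 ≤ ((k + 1 : ℕ) : ℝ) * (δ / m) := by positivity
      linarith
    have hB : MeasurableSet[past X (t (k + 1))] {ω | X (t k + δ / m) ω ≠ X (t k) ω} := by
      rw [← hts]
      exact ((measurable_past X (ht0 _) le_rfl).prodMk (measurable_past X (ht0 _)
        (by rw [hts]; linarith [show 0 ≤ δ / m by positivity])))
        (MeasurableSet.of_discrete (s := {q : ℤ × ℤ | q.1 ≠ q.2}))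
    have h1 := hT.prob_ne_le hX hp hc (ht0 (k + 1)) (sub_nonneg.2 hk1) hB
    rw [add_sub_cancel] at h1
    have h2 := hT.prob_ne_le hX hp hc (ht0 k) (show 0 ≤ δ / m by positivity)
      (A := Set.univ) MeasurableSet.univ
    rw [Set.univ_inter, probReal_univ, mul_one] at h2
    calc P.real (D k) ≤ _ := h1
      _ ≤ (-2 * c 1) * δ * ((-2 * c 1) * (δ / m)) := by gcongr; linarith
  calc P.real {ω | ∃ k < m, X (t k) ω ≠ X u ω ∧ X (t k) ω ≠ X (u + δ) ω}
      ≤ P.real (⋃ k ∈ Finset.range m, D k) :=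
        measureReal_mono hsub (measure_ne_top P _)
    _ ≤ ∑ k ∈ Finset.range m, P.real (D k) := measureReal_biUnion_finset_le _ _
    _ ≤ ∑ k ∈ Finset.range m, (-2 * c 1) * δ * ((-2 * c 1) * (δ / m)) := Finset.sum_le_sum hD
    _ = (-2 * c 1) ^ 2 * δ ^ 2 := by
      rw [Finset.sum_const, Finset.card_range, nsmul_eq_mul]; field_simp

/-- A value taken at `r` persists to the right of `r`, so all sufficiently fine grids see it. The
lower limit of the grid events is measurable and inherits their bound. -/
theorem HasTransition.exists_doubleChange_cover (hX : IsProc X) (hT : HasTransition P X p)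
    (hp : IsTransitionFunction (walkRates c) p) (hc : IsCenteredSkipFree c) {u δ : ℝ} (hu : 0 ≤ u)
    (hδ : 0 < δ) :
    ∃ S, MeasurableSet S ∧ doubleChange X u δ ⊆ S ∧ P.real S ≤ (-2 * c 1) ^ 2 * δ ^ 2 := by
  let E : ℕ → Set Ω := fun m => {ω | ∃ k < m + 1,
    X (u + k * (δ / (m + 1 : ℕ))) ω ≠ X u ω ∧ X (u + k * (δ / (m + 1 : ℕ))) ω ≠ X (u + δ) ω}
  have hE : ∀ m, MeasurableSet (E m) := by
    intro m
    have : E m = ⋃ k ∈ Finset.range (m + 1), ({ω | X (u + k * (δ / (m + 1 : ℕ))) ω = X u ω}ᶜ ∩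
        {ω | X (u + k * (δ / (m + 1 : ℕ))) ω = X (u + δ) ω}ᶜ) := by
      ext ω; simp only [E, Set.mem_ofPred_eq, Set.mem_iUnion, Finset.mem_range, exists_prop,
        Set.mem_inter_iff, Set.mem_compl_iff, ne_eq]
    rw [this]
    exact Finset.measurableSet_biUnion _ fun k _ =>
      (measurableSet_eq_fun (hX.meas _) (hX.meas _)).compl.inter
        (measurableSet_eq_fun (hX.meas _) (hX.meas _)).compl
  let T : ℕ → Set Ω := fun M => ⋂ m ≥ M, E m
  have hTm : ∀ M, MeasurableSet (T M) := fun M =>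
    MeasurableSet.iInter fun m => MeasurableSet.iInter fun _ => hE m
  refine ⟨⋃ M, T M, MeasurableSet.iUnion hTm, ?_, ?_⟩
  · rintro ω ⟨r, h1, h2, h3, h4⟩
    have hr : r < u + δ := lt_of_le_of_ne h2 fun h => h4 (by rw [h])
    obtain ⟨b, hb, hb'⟩ := mem_nhdsGT_iff_exists_Ioo_subset.1 ((hX.reg ω).rc r)
    have hlt : r < min b (u + δ) := lt_min hb hr
    obtain ⟨M, hM⟩ := exists_nat_gt (δ / (min b (u + δ) - r))
    refine Set.mem_iUnion.2 ⟨M, Set.mem_iInter.2 fun m => Set.mem_iInter.2 fun hm => ?_⟩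
    have hstep : δ / (m + 1 : ℕ) < min b (u + δ) - r := by
      rw [div_lt_iff₀ (by positivity)]
      rw [div_lt_iff₀ (by linarith)] at hM
      have : (M : ℝ) ≤ (m + 1 : ℕ) := by exact_mod_cast Nat.le_succ_of_le hm
      nlinarith
    have hs0 : 0 < δ / (m + 1 : ℕ) := by positivity
    let k := ⌊(r - u) / (δ / (m + 1 : ℕ))⌋₊ + 1
    have hk0 : 0 ≤ (r - u) / (δ / (m + 1 : ℕ)) := div_nonneg (by linarith) hs0.le
    have hk1 : r < u + k * (δ / (m + 1 : ℕ)) := by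
      have := Nat.lt_floor_add_one ((r - u) / (δ / (m + 1 : ℕ)))
      rw [div_lt_iff₀ hs0] at this
      simp only [k]; push_cast at this ⊢; linarith
    have hk2 : u + k * (δ / (m + 1 : ℕ)) ≤ r + δ / (m + 1 : ℕ) := by
      have := Nat.floor_le hk0
      rw [le_div_iff₀ hs0] at this
      simp only [k]; push_cast at this ⊢; linarith
    have hkx : X (u + k * (δ / (m + 1 : ℕ))) ω = X r ω :=
      hb' ⟨hk1, by linarith [min_le_left b (u + δ)]⟩
    refine ⟨k, ?_, by rw [hkx]; exact h3, by rw [hkx]; exact h4⟩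
    have h5 : u + k * (δ / (m + 1 : ℕ)) < u + δ := by linarith [min_le_right b (u + δ)]
    have h6 : (k : ℝ) * (δ / (m + 1 : ℕ)) < (m + 1 : ℕ) * (δ / (m + 1 : ℕ)) := by
      have : ((m + 1 : ℕ) : ℝ) * (δ / (m + 1 : ℕ)) = δ := by field_simp
      linarith
    exact_mod_cast lt_of_mul_lt_mul_right h6 hs0.le
  · have hmono : Monotone T := fun M M' hMM =>
      Set.biInter_mono (fun m hm => le_trans hMM hm) fun _ _ => le_rfl
    have h1 := tendsto_measure_iUnion_atTop (μ := P) hmono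
    have h2 : Tendsto (fun M => P.real (T M)) atTop (𝓝 (P.real (⋃ M, T M))) :=
      (ENNReal.tendsto_toReal (measure_ne_top P _)).comp h1
    refine le_of_tendsto h2 (Eventually.of_forall fun M => ?_)
    refine (measureReal_mono (fun ω hω => ?_)).trans
      (hT.prob_doubleChange_grid_le hX hp hc hu hδ.le (M + 1) M.succ_pos)
    exact Set.mem_iInter₂.1 hω M le_rfl

/-- The martingale pairs of the reflected random walk. -/
theorem HasTransition.martPair_reflPath (hX : IsProc X) (hT : HasTransition P X p)
    (hp : IsTransitionFunction (walkRates c) p) (hc : IsCenteredSkipFree c) {g : ℤ → ℝ}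
    (hg : ∃ K, ∀ k, |g k| ≤ K) :
    MartPair P (fun t ω => GrunwaldChain.reflPath (fun t => X t ω) t) g
      (fun z => ∑' j : ℕ, c j * g (max (z + j - 1) 1)) := by
  obtain ⟨K, hK⟩ := hg
  set Z : ℝ → Ω → ℤ := fun t ω => GrunwaldChain.reflPath (fun t => X t ω) t with hZdef
  set h : ℤ → ℝ := fun z => ∑' j : ℕ, c j * g (max (z + j - 1) 1) with hhdef
  have hZ : IsProc Z := hX.reflPath
  have hh : ∃ K, ∀ k, |h k| ≤ K := ⟨_, fun k => hc.abs_tsum_mul_le fun j => hK _⟩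
  refine MartPair.of_cylinder hZ ⟨K, hK⟩ hh fun s t hs hst I v hI => ?_
  set A := cylinderSet Z I v with hAdef
  have hK0 : 0 ≤ K := (abs_nonneg _).trans (hK 0)
  refine setIntegral_increment_eq_zero hZ ⟨K, hK⟩ hh hst
    (C := 2 * (-2 * c 1) ^ 2 * K * P.real A + 2 * K * (-2 * c 1) ^ 2) fun u hu δ hδ _ => ?_
  obtain ⟨K', hK'⟩ := hh
  have hu0 : 0 ≤ u := hs.trans hu
  have hA : MeasurableSet[past X u] A := hX.past_reflPath_le u _
    (measurableSet_past_cylinderSet Z fun r hr => ⟨(hI r hr).1, (hI r hr).2.trans hu⟩)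
  have hA' := past_le hX.meas u _ hA
  -- the reflected path after one step without double change
  let W : Ω → ℝ := fun ω => g (max (Z u ω + X (u + δ) ω - X u ω) 1)
  have hWm : Measurable W :=
    (measurable_of_countable fun q : ℤ × ℤ × ℤ => g (max (q.1 + q.2.1 - q.2.2) 1)).comp
      ((hZ.meas u).prodMk ((hX.meas (u + δ)).prodMk (hX.meas u)))
  have iW : Integrable W P := integrable_of_bdd hWm fun _ => hK _
  have iZ : ∀ r, Integrable (fun ω => g (Z r ω)) P := fun r =>
    integrable_comp hZ hK measurable_const
  have ih : Integrable (fun ω => δ * h (Z u ω)) P :=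
    (integrable_comp hZ hK' measurable_const).const_mul δ
  have iN : Integrable (fun ω => W ω - g (Z u ω) - δ * h (Z u ω)) P := (iW.sub (iZ u)).sub ih
  have iD : Integrable (fun ω => g (Z (u + δ) ω) - W ω) P := (iZ _).sub iW
  have h1 : |∫ ω in A, (W ω - g (Z u ω) - δ * h (Z u ω)) ∂P| ≤
      2 * (-2 * c 1) ^ 2 * K * δ ^ 2 * P.real A := by
    -- Both present values are fixed: that of `X` for the Markov property, that of `Z` because it
    -- determines the function applied to the increment.
    refine abs_setIntegral_le_of_partition ((hZ.meas u).prodMk (hX.meas u)) iN hA' fun q => ?_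
    obtain ⟨z, y⟩ := q
    have hAi : MeasurableSet[past X u] (A ∩ {ω | (Z u ω, X u ω) = (z, y)}) := by
      have e : {ω | (Z u ω, X u ω) = (z, y)} = Z u ⁻¹' {z} ∩ X u ⁻¹' {y} := by
        ext; simp
      rw [e]
      exact hA.inter (((hX.measurable_past_reflPath hu0 le_rfl) (measurableSet_singleton z)).inter
        (measurable_past X hu0 le_rfl (measurableSet_singleton y)))
    have hAi' := past_le hX.meas u _ hAi
    by_cases hz : 1 ≤ z
    · have := hT.one_step hX hp hc hu0 hδ.le (F := fun k => g (max (z + k - y) 1))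
        (fun k => hK _) hAi (i := y) fun ω hω => (Prod.ext_iff.1 hω.2).2
      have e1 : walkGen c (fun k => g (max (z + k - y) 1)) y = h z := by
        simp only [walkGen, hhdef]
        refine tsum_congr fun j => ?_
        congr 3
        ring
      have e2 : max (z + y - y) 1 = z := by omega
      simp only [e1, e2] at this
      rwa [setIntegral_congr_fun hAi'
        (g := fun ω => g (max (z + X (u + δ) ω - y) 1) - g z - δ * h z) fun ω hω => by
          have h1 : Z u ω = z := (Prod.ext_iff.1 hω.2).1
          have h2 : X u ω = y := (Prod.ext_iff.1 hω.2).2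
          simp only [W, h1, h2]]
    · have : A ∩ {ω | (Z u ω, X u ω) = (z, y)} = ∅ := by
        ext ω
        simp only [Set.mem_inter_iff, Set.mem_ofPred_eq, Set.mem_empty_iff_false, iff_false,
          Prod.mk.injEq]
        rintro ⟨_, h1, _⟩
        exact hz (h1 ▸ (hX.reg ω).reflPath_pos u)
      rw [this]
      simp
  obtain ⟨S, hS, hDS, hPS⟩ := hT.exists_doubleChange_cover hX hp hc hu0 hδ
  -- Off the cover the step with `max` is exact, so the error lives on an event of probability of
  -- order `δ²`.
  have h2 : |∫ ω in A, (g (Z (u + δ) ω) - W ω) ∂P| ≤ 2 * K * P.real S := by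
    have hb : ∀ ω, ‖g (Z (u + δ) ω) - W ω‖ ≤ S.indicator (fun _ => 2 * K) ω := by
      intro ω
      by_cases hω : ω ∈ S
      · rw [Set.indicator_of_mem hω, Real.norm_eq_abs]
        exact (abs_sub _ _).trans (by linarith [hK (Z (u + δ) ω), hK (max (Z u ω + X (u + δ) ω - X u ω) 1)])
      · rw [Set.indicator_of_notMem hω]
        have hnd : ω ∉ doubleChange X u δ := fun h => hω (hDS h)
        have := (hX.reg ω).reflPath_eq_max hu0 (show u ≤ u + δ by linarith) fun r hr1 hr2 => by
          by_contra! hne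
          exact hnd ⟨r, hr1, hr2, hne.1, hne.2⟩
        simp only [W, hZdef]
        rw [this]
        simp
    have h3 := norm_integral_le_of_norm_le (μ := P.restrict A)
      (((integrable_const (2 * K)).indicator hS).integrableOn) (Eventually.of_forall hb)
    rw [Real.norm_eq_abs] at h3
    refine h3.trans ?_
    rw [setIntegral_indicator hS]
    simp only [integral_const, measureReal_restrict_apply_univ, smul_eq_mul]
    rw [mul_comm]
    exact mul_le_mul_of_nonneg_left (measureReal_mono Set.inter_subset_right (measure_ne_top P _))
      (by positivity)
  have h4 : ∫ ω in A, (g (Z (u + δ) ω) - g (Z u ω) - δ * h (Z u ω)) ∂P =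
      ∫ ω in A, (g (Z (u + δ) ω) - W ω) ∂P +
        ∫ ω in A, (W ω - g (Z u ω) - δ * h (Z u ω)) ∂P := by
    rw [← integral_add iD.integrableOn iN.integrableOn]
    congr 1; ext ω; ring
  rw [h4]
  refine (abs_add_le _ _).trans ?_
  have h5 : 2 * K * P.real S ≤ 2 * K * ((-2 * c 1) ^ 2 * δ ^ 2) := by gcongr
  linarith

end

end

section

/-! ### The ascending ladder heights of a skip free random walk -/

section Ladder

variable {c : ℕ → ℝ}

/-- The law of the ascending ladder height minus one. -/
def ladderWeight (c : ℕ → ℝ) (j : ℕ) : ℝ := -(∑ k ∈ Finset.range (j + 2), c k) / c 0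

theorem IsCenteredSkipFree.sum_range_nonpos (hc : IsCenteredSkipFree c) {j : ℕ} (hj : 2 ≤ j) :
    ∑ k ∈ Finset.range j, c k ≤ 0 :=
  sum_le_hasSum _ (fun k hk => hc.nonneg k (by simp at hk; omega)) hc.hasSum

theorem IsCenteredSkipFree.ladderWeight_nonneg (hc : IsCenteredSkipFree c) (j : ℕ) :
    0 ≤ ladderWeight c j :=
  div_nonneg (neg_nonneg.2 (hc.sum_range_nonpos (by omega))) hc.zero_pos.le

theorem sum_range_sum_range (c : ℕ → ℝ) (J : ℕ) :
    ∑ j ∈ Finset.range J, ∑ k ∈ Finset.range (j + 1), c k =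
      (J : ℝ) * ∑ k ∈ Finset.range J, c k - ∑ k ∈ Finset.range J, (k : ℝ) * c k := by
  induction J with
  | zero => simp
  | succ J ih =>
    rw [Finset.sum_range_succ, ih, Finset.sum_range_succ, Finset.sum_range_succ (fun k => (k:ℝ) * c k)]
    push_cast
    ring

/-- As the total sum is zero, the partial sum is minus a tail, and `J ∑_{k ≥ J} c k ≤ ∑_{k ≥ J} k c
k`, a tail of a convergent series. -/
theorem IsCenteredSkipFree.tendsto_mul_sum_range (hc : IsCenteredSkipFree c) :
    Tendsto (fun J : ℕ => (J : ℝ) * ∑ k ∈ Finset.range J, c k) atTop (𝓝 0) := by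
  have h1 : Tendsto (fun J : ℕ => ∑ k ∈ Finset.range J, (k : ℝ) * c k) atTop (𝓝 0) :=
    hc.hasSum_mul.tendsto_sum_nat
  refine tendsto_of_tendsto_of_tendsto_of_le_of_le' h1 tendsto_const_nhds ?_ ?_
  · filter_upwards [eventually_ge_atTop 2] with J hJ
    have h2 := (hasSum_nat_add_iff' J).2 hc.hasSum
    have h3 := (hasSum_nat_add_iff' J).2 hc.hasSum_mul
    have := hasSum_le (fun k => ?_) (h2.mul_left (J : ℝ)) h3
    · linarith
    · have : 0 ≤ c (k + J) := hc.nonneg _ (by omega)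
      push_cast
      nlinarith [(Nat.cast_nonneg k : (0:ℝ) ≤ k)]
  · filter_upwards [eventually_ge_atTop 2] with J hJ
    exact mul_nonpos_of_nonneg_of_nonpos (by positivity) (hc.sum_range_nonpos hJ)

/-- This is where zero mean enters: the sums of the partial sums are `J ∑_{k < J} c k - ∑_{k < J} k
c k`, which tends to zero; removing the first one, `c 0`, and dividing by `-c 0` leaves `1`. -/
theorem IsCenteredSkipFree.hasSum_ladderWeight (hc : IsCenteredSkipFree c) :
    HasSum (ladderWeight c) 1 := by
  rw [hasSum_iff_tendsto_nat_of_nonneg hc.ladderWeight_nonneg]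
  have h1 : Tendsto (fun J : ℕ => ∑ j ∈ Finset.range J, ∑ k ∈ Finset.range (j + 1), c k) atTop
      (𝓝 (0 - 0)) := by
    simp only [sum_range_sum_range]
    exact hc.tendsto_mul_sum_range.sub hc.hasSum_mul.tendsto_sum_nat
  have h2 := ((h1.comp (tendsto_add_atTop_nat 1)).sub_const (c 0)).neg.div_const (c 0)
  have e : -(0 - 0 - c 0) / c 0 = 1 := by
    have := hc.zero_pos.ne'
    field_simp
    ring
  rw [e] at h2
  refine h2.congr fun J => ?_
  simp only [Function.comp_apply, Finset.sum_range_succ' _ J, ladderWeight, ← Finset.sum_div,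
    Finset.sum_neg_distrib]
  simp

/-- The solution of `F x = r x + ∑ j, ladderWeight c j * F (x + j + 1)`, `x ≤ 0`, with prescribed
values `g` on the positive integers. -/
def ladderExt (c : ℕ → ℝ) (r g : ℤ → ℝ) (x : ℤ) : ℝ :=
  if 1 ≤ x then g x else r x + ∑' j : ℕ, ladderWeight c j * ladderExt c r g (x + j + 1)
termination_by (1 - x).toNat

theorem ladderExt_of_pos (c : ℕ → ℝ) (r g : ℤ → ℝ) {x : ℤ} (hx : 1 ≤ x) :
    ladderExt c r g x = g x := by
  rw [ladderExt, if_pos hx]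

theorem ladderExt_of_nonpos (c : ℕ → ℝ) (r g : ℤ → ℝ) {x : ℤ} (hx : x ≤ 0) :
    ladderExt c r g x = r x + ∑' j : ℕ, ladderWeight c j * ladderExt c r g (x + j + 1) := by
  rw [ladderExt, if_neg (by omega)]

theorem int_induction_down {p : ℤ → Prop} (h1 : ∀ x, 1 ≤ x → p x)
    (h2 : ∀ x, x ≤ 0 → (∀ y, x < y → p y) → p x) (x : ℤ) : p x := by
  have key : ∀ m : ℕ, ∀ x : ℤ, (1 - x).toNat ≤ m → p x := by
    intro m
    induction m with
    | zero => intro x hx; exact h1 x (by omega)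
    | succ m ih =>
      intro x hx
      by_cases h : 1 ≤ x
      · exact h1 x h
      · exact h2 x (by omega) fun y hy => ih y (by omega)
  exact key _ x le_rfl

/-- Maximum principle: with `r = 0` each new value is an average of values further to the right. -/
theorem IsCenteredSkipFree.ladderExt_mem_Icc (hc : IsCenteredSkipFree c) {g : ℤ → ℝ} {a b : ℝ}
    (hg : ∀ x, 1 ≤ x → g x ∈ Set.Icc a b) (x : ℤ) : ladderExt c 0 g x ∈ Set.Icc a b := by
  refine int_induction_down (p := fun x => ladderExt c 0 g x ∈ Set.Icc a b)
    (fun x hx => ?_) (fun x hx ih => ?_) x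
  · rw [ladderExt_of_pos c 0 g hx]; exact hg x hx
  · have hF : ∀ j : ℕ, ladderExt c 0 g (x + j + 1) ∈ Set.Icc a b := fun j => ih _ (by omega)
    have hs : Summable fun j : ℕ => ladderWeight c j * ladderExt c 0 g (x + j + 1) :=
      summable_mul_of_abs_le (B := max |a| |b|)
        (by simpa only [abs_of_nonneg (hc.ladderWeight_nonneg _)] using hc.hasSum_ladderWeight.summable)
        fun j => abs_le_max_abs_abs (hF j).1 (hF j).2
    rw [ladderExt_of_nonpos c 0 g hx, Pi.zero_apply, zero_add]
    constructor
    · have := hasSum_le (fun j => mul_le_mul_of_nonneg_left (hF j).1 (hc.ladderWeight_nonneg j))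
        (hc.hasSum_ladderWeight.mul_right a) hs.hasSum
      simpa using this
    · have := hasSum_le (fun j => mul_le_mul_of_nonneg_left (hF j).2 (hc.ladderWeight_nonneg j))
        hs.hasSum (hc.hasSum_ladderWeight.mul_right b)
      simpa using this

/-- Summation by parts for the generator. -/
theorem hasSum_walkGen_of_summable (c : ℕ → ℝ) {F : ℤ → ℝ} (x : ℤ)
    (h1 : Summable fun j : ℕ => (∑ k ∈ Finset.range (j + 1), c k) * F (x - 1 + j))
    (h2 : Summable fun j : ℕ => (∑ k ∈ Finset.range (j + 1), c k) * F (x + j)) :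
    HasSum (fun j : ℕ => c j * F (x + j - 1))
      (∑' j : ℕ, (∑ k ∈ Finset.range (j + 1), c k) * F (x - 1 + j) -
        ∑' j : ℕ, (∑ k ∈ Finset.range (j + 1), c k) * F (x + j)) := by
  have h3 : HasSum (fun j : ℕ => (∑ k ∈ Finset.range j, c k) * F (x + j - 1))
      (∑' j : ℕ, (∑ k ∈ Finset.range (j + 1), c k) * F (x + j)) := by
    rw [← hasSum_nat_add_iff' 1]
    simp only [Finset.range_one, Finset.sum_singleton, Finset.range_zero, Finset.sum_empty, zero_mul,
      sub_zero]
    convert! h2.hasSum using 1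
    ext j
    congr 2
    push_cast; ring
  convert! h1.hasSum.sub h3 using 1
  ext j
  rw [Finset.sum_range_succ, show x - 1 + j = x + j - 1 by ring]
  ring

theorem IsCenteredSkipFree.summable_partial (hc : IsCenteredSkipFree c) :
    Summable fun j : ℕ => |∑ k ∈ Finset.range (j + 1), c k| := by
  rw [← summable_nat_add_iff 1]
  refine (hc.hasSum_ladderWeight.summable.mul_left (c 0)).congr fun j => ?_
  rw [ladderWeight, abs_of_nonpos (hc.sum_range_nonpos (by omega))]
  have := hc.zero_pos.ne'
  field_simp

/-- The ladder equation in the form needed for summation by parts. With `D x` for this sum, the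
generator is `D (x - 1) - D x`, which for `x ≤ 0` is `c 0 * (r (x - 1) - r x)`; thus `r = 0` gives
harmonic functions and increasing `r` superharmonic ones. -/
theorem tsum_partial_ladderExt (hc : IsCenteredSkipFree c) {r g : ℤ → ℝ} {x : ℤ} (hx : x ≤ 0)
    (h : Summable fun j : ℕ => (∑ k ∈ Finset.range (j + 1), c k) * ladderExt c r g (x + j)) :
    ∑' j : ℕ, (∑ k ∈ Finset.range (j + 1), c k) * ladderExt c r g (x + j) = c 0 * r x := by
  rw [h.tsum_eq_zero_add]
  have e : ∀ j : ℕ, (∑ k ∈ Finset.range (j + 1 + 1), c k) * ladderExt c r g (x + (j + 1 : ℕ)) =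
      (-c 0) * (ladderWeight c j * ladderExt c r g (x + j + 1)) := by
    intro j
    have := hc.zero_pos.ne'
    rw [ladderWeight, show x + ((j + 1 : ℕ) : ℤ) = x + j + 1 by push_cast; ring]
    field_simp
  simp only [e, tsum_mul_left]
  have := ladderExt_of_nonpos c r g hx
  simp only [zero_add, Finset.sum_range_one, Nat.cast_zero, add_zero]
  rw [this]
  ring

/-- The bounded harmonic extension. -/
theorem IsCenteredSkipFree.walkGen_ladderExt_nonpos (hc : IsCenteredSkipFree c) {g : ℤ → ℝ} {K : ℝ}
    (hg : ∀ x, |g x| ≤ K) {x : ℤ} (hx : x ≤ 0) : walkGen c (ladderExt c 0 g) x = 0 := by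
  have hb : ∀ x, |ladderExt c 0 g x| ≤ K := fun x =>
    abs_le.2 (hc.ladderExt_mem_Icc (fun x _ => abs_le.1 (hg x)) x)
  have hs : ∀ x : ℤ, Summable fun j : ℕ => (∑ k ∈ Finset.range (j + 1), c k) * ladderExt c 0 g (x + j) :=
    fun x => summable_mul_of_abs_le hc.summable_partial fun j => hb _
  rw [walkGen, (hasSum_walkGen_of_summable c x (hs _) (hs _)).tsum_eq,
    tsum_partial_ladderExt hc (by omega) (hs _), tsum_partial_ladderExt hc hx (hs _)]
  simp

/-- At `1` only the first of the two sums in the summation by parts is governed by the ladder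
equation. The remaining one has minus the partial sums of `c` as weights, which is the first
interior row of the case `N`. -/
theorem IsCenteredSkipFree.walkGen_ladderExt_one (hc : IsCenteredSkipFree c) {g : ℤ → ℝ} {K : ℝ}
    (hg : ∀ x, |g x| ≤ K) : walkGen c (ladderExt c 0 g) 1 =
      -∑' j : ℕ, (∑ k ∈ Finset.range (j + 1), c k) * g (1 + j) := by
  have hb : ∀ x, |ladderExt c 0 g x| ≤ K := fun x =>
    abs_le.2 (hc.ladderExt_mem_Icc (fun x _ => abs_le.1 (hg x)) x)
  have hs : ∀ x : ℤ, Summable fun j : ℕ => (∑ k ∈ Finset.range (j + 1), c k) * ladderExt c 0 g (x + j) :=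
    fun x => summable_mul_of_abs_le hc.summable_partial fun j => hb _
  rw [walkGen, (hasSum_walkGen_of_summable c 1 (hs _) (hs _)).tsum_eq,
    tsum_partial_ladderExt hc (by omega) (hs _)]
  simp only [Pi.zero_apply, mul_zero, zero_sub]
  congr 1
  refine tsum_congr fun j => ?_
  rw [ladderExt_of_pos c 0 g (by omega)]

theorem walkGen_ladderExt_of_two_le (c : ℕ → ℝ) (r g : ℤ → ℝ) {x : ℤ} (hx : 2 ≤ x) :
    walkGen c (ladderExt c r g) x = walkGen c g x :=
  tsum_congr fun j => by rw [ladderExt_of_pos c r g (by omega)]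

/-! ### A superharmonic function on the nonpositive integers -/

/-- An unbounded function that vanishes on the positive integers and is strictly superharmonic
on their complement. -/
def leftLyap (c : ℕ → ℝ) : ℤ → ℝ := ladderExt c (fun x => 1 + 2 ^ x) 0

theorem leftLyap_of_pos {x : ℤ} (hx : 1 ≤ x) : leftLyap c x = 0 := by
  rw [leftLyap, ladderExt_of_pos _ _ _ hx, Pi.zero_apply]

theorem summable_mul_leftLyap (a : ℕ → ℝ) (x : ℤ) : Summable fun j : ℕ => a j * leftLyap c (x + j) := by
  refine summable_of_ne_finset_zero (s := Finset.range (1 - x).toNat) fun j hj => ?_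
  simp only [Finset.mem_range, not_lt] at hj
  rw [leftLyap_of_pos (by omega), mul_zero]

theorem leftLyap_of_nonpos {x : ℤ} (hx : x ≤ 0) :
    leftLyap c x = 1 + 2 ^ x + ∑' j : ℕ, ladderWeight c j * leftLyap c (x + j + 1) :=
  ladderExt_of_nonpos _ _ _ hx

theorem IsCenteredSkipFree.leftLyap_nonneg (hc : IsCenteredSkipFree c) (x : ℤ) :
    0 ≤ leftLyap c x := by
  refine int_induction_down (fun x hx => (leftLyap_of_pos hx).ge) (fun x hx ih => ?_) x
  rw [leftLyap_of_nonpos hx]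
  have : 0 ≤ ∑' j : ℕ, ladderWeight c j * leftLyap c (x + j + 1) :=
    tsum_nonneg fun j => mul_nonneg (hc.ladderWeight_nonneg j) (ih _ (by omega))
  positivity

/-- The summand `1` in `1 + 2 ^ x` forces growth: if the function is at least `N/2` far to the left,
then still further left the average loses at most `1/2` while `1` is added. -/
theorem IsCenteredSkipFree.exists_le_leftLyap (hc : IsCenteredSkipFree c) (N : ℕ) :
    ∃ M : ℕ, ∀ x : ℤ, x ≤ -M → (N : ℝ) / 2 ≤ leftLyap c x := by
  induction N with
  | zero => exact ⟨0, fun x _ => by simpa using hc.leftLyap_nonneg x⟩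
  | succ N ih =>
    obtain ⟨M, hM⟩ := ih
    have h1 : Tendsto (fun J => (N : ℝ) / 2 * ∑ j ∈ Finset.range J, ladderWeight c j) atTop
        (𝓝 ((N : ℝ) / 2 * 1)) := hc.hasSum_ladderWeight.tendsto_sum_nat.const_mul _
    obtain ⟨J, hJ⟩ := (h1.eventually (lt_mem_nhds (show (N : ℝ) / 2 * 1 - 1 / 2 < (N : ℝ) / 2 * 1
      by linarith))).exists
    refine ⟨M + J, fun x hx => ?_⟩
    push_cast at hx
    rw [leftLyap_of_nonpos (by omega)]
    have h2 : (N : ℝ) / 2 * ∑ j ∈ Finset.range J, ladderWeight c j ≤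
        ∑' j : ℕ, ladderWeight c j * leftLyap c (x + j + 1) := by
      have hs : Summable fun j : ℕ => ladderWeight c j * leftLyap c (x + j + 1) := by
        simpa only [add_right_comm] using summable_mul_leftLyap (c := c) (ladderWeight c) (x + 1)
      refine le_trans ?_ (hs.sum_le_tsum (Finset.range J) fun j _ =>
        mul_nonneg (hc.ladderWeight_nonneg j) (hc.leftLyap_nonneg _))
      rw [Finset.mul_sum]
      refine Finset.sum_le_sum fun j hj => ?_
      rw [mul_comm]
      have := Finset.mem_range.1 hj
      exact mul_le_mul_of_nonneg_left (hM _ (by omega)) (hc.ladderWeight_nonneg j)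
    have h3 : (0 : ℝ) < 2 ^ x := by positivity
    push_cast
    linarith

/-- The value is `c 0` times the decrement of `1 + 2 ^ x` from `x` to `x - 1`. The function is
unbounded, but the sums are finite because it vanishes to the right. -/
theorem IsCenteredSkipFree.hasSum_walkGen_leftLyap (hc : IsCenteredSkipFree c) {x : ℤ}
    (hx : x ≤ 0) : HasSum (fun j : ℕ => c j * leftLyap c (x + j - 1)) (-(c 0 * 2 ^ (x - 1))) := by
  have hs := fun x => summable_mul_leftLyap (c := c) (fun j => ∑ k ∈ Finset.range (j + 1), c k) x
  convert! hasSum_walkGen_of_summable c x (hs _) (hs _) using 1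
  have e1 := tsum_partial_ladderExt hc (by omega : x - 1 ≤ 0) (hs (x - 1))
  have e2 := tsum_partial_ladderExt hc hx (hs x)
  rw [leftLyap, e1, e2]
  have : (2 : ℝ) ^ x = 2 ^ (x - 1) * 2 := by
    rw [← zpow_add_one₀ (by norm_num)]; simp
  rw [this]
  ring

end Ladder

/-! ### A superharmonic function on the integers above `n` -/

section Right

variable {c : ℕ → ℝ}

/-- The generator annihilates affine functions, so a line of slope `s` through `F x` may be
subtracted. Upward jumps then contribute nothing positive, and the step down contributes at most `-c
0 * d`. -/
theorem IsCenteredSkipFree.walkGen_le_of_slope (hc : IsCenteredSkipFree c) {F : ℤ → ℝ} {K : ℝ}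
    (hF : ∀ k, |F k| ≤ K) {x : ℤ} {s d : ℝ}
    (h1 : ∀ j : ℕ, 2 ≤ j → F (x + j - 1) ≤ F x + s * (j - 1)) (h0 : F (x - 1) ≤ F x - s - d) :
    walkGen c F x ≤ -(c 0 * d) := by
  have e1 : HasSum (fun j : ℕ => c j * F (x + j - 1)) (walkGen c F x) :=
    (hc.summable_mul fun j => hF _).hasSum
  have e2 := (e1.sub (hc.hasSum.mul_right (F x - s))).sub (hc.hasSum_mul.mul_left s)
  have e3 : HasSum (fun j : ℕ => if j = 0 then -(c 0 * d) else 0) (-(c 0 * d)) := by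
    convert! hasSum_ite_eq 0 (-(c 0 * d)) using 1
  simp only [zero_mul, mul_zero, sub_zero] at e2
  refine hasSum_le (fun j => ?_) e2 e3
  rcases j with _ | _ | j
  · simp only [if_true, Nat.cast_zero, add_zero, zero_mul, mul_zero, sub_zero]
    have := mul_le_mul_of_nonneg_left h0 hc.zero_pos.le
    linarith
  · have : x + ((0 + 1 : ℕ) : ℤ) - 1 = x := by push_cast; ring
    rw [this]
    simp
    linarith
  · have := mul_le_mul_of_nonneg_left (h1 (j + 1 + 1) (by omega)) (hc.nonneg (j + 1 + 1) (by omega))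
    rw [if_neg (by omega)]
    push_cast at this ⊢
    linarith

/-- By centredness `∑_{j ≥ 2} (j - 1) c j = c 0`. -/
theorem IsCenteredSkipFree.tsum_mul_le_of_linear (hc : IsCenteredSkipFree c) {f : ℕ → ℝ} {K b : ℝ}
    (hf : ∀ j, |f j| ≤ K) (h0 : f 0 = 0) (h1 : f 1 = 0) (h2 : ∀ j, 2 ≤ j → f j ≤ b * (j - 1)) :
    ∑' j, c j * f j ≤ b * c 0 := by
  have e1 : HasSum (fun j : ℕ => c j * f j) _ := (hc.summable_mul hf).hasSum
  have e2 := ((hc.hasSum_mul.mul_left b).sub (hc.hasSum.mul_left b)).add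
    (hasSum_ite_eq (0 : ℕ) (b * c 0))
  simp only [mul_zero, sub_zero, zero_add] at e2
  refine hasSum_le (fun j => ?_) e1 e2
  rcases j with _ | _ | j
  · simp [h0]
  · simp [h1]
  · have := mul_le_mul_of_nonneg_left (h2 (j + 2) (by omega)) (hc.nonneg (j + 2) (by omega))
    rw [if_neg (by omega)]
    push_cast at this ⊢
    linarith

/-- A concave function on `[n, ∞)`, vanishing up to `n` and equal to `1` from `n + N + 1` on. -/
def rightLyap (n : ℤ) (N : ℕ) (x : ℤ) : ℝ :=
  if x ≤ n then 0 else if n + (N + 1) ≤ x then 1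
    else 1 - (((N : ℝ) + 1 - ((x - n : ℤ) : ℝ)) / ((N : ℝ) + 1)) ^ 2

theorem rightLyap_of_le {n : ℤ} (N : ℕ) {x : ℤ} (h : x ≤ n) : rightLyap n N x = 0 := by
  rw [rightLyap, if_pos h]

theorem rightLyap_of_ge {n : ℤ} {N : ℕ} {x : ℤ} (h : n + (N + 1) ≤ x) : rightLyap n N x = 1 := by
  rw [rightLyap, if_neg (by omega), if_pos h]

theorem rightLyap_of_mem {n : ℤ} {N : ℕ} {x : ℤ} (h1 : n ≤ x) (h2 : x ≤ n + (N + 1)) :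
    rightLyap n N x = 1 - (((N : ℝ) + 1 - ((x - n : ℤ) : ℝ)) / ((N : ℝ) + 1)) ^ 2 := by
  have hN : (N : ℝ) + 1 ≠ 0 := by positivity
  rw [rightLyap]
  split_ifs with h3 h4
  · have : x - n = 0 := by omega
    rw [this]
    simp [hN]
  · have : x - n = N + 1 := by omega
    rw [this]
    simp
  · rfl

theorem rightLyap_mem_Icc (n : ℤ) (N : ℕ) (x : ℤ) : rightLyap n N x ∈ Set.Icc (0 : ℝ) 1 := by
  rcases le_or_gt x n with h | h
  · simp [rightLyap_of_le N h]
  · rcases le_or_gt (n + (N + 1)) x with h' | h'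
    · simp [rightLyap_of_ge h']
    · rw [rightLyap_of_mem h.le h'.le]
      have h1 : (0 : ℝ) ≤ ((x - n : ℤ) : ℝ) := by exact_mod_cast (by omega : 0 ≤ x - n)
      have h2 : ((x - n : ℤ) : ℝ) ≤ (N : ℝ) + 1 := by exact_mod_cast (by omega : x - n ≤ N + 1)
      have hN : (0 : ℝ) < (N : ℝ) + 1 := by positivity
      have h3 : ((N : ℝ) + 1 - ((x - n : ℤ) : ℝ)) / ((N : ℝ) + 1) ≤ 1 := by
        rw [div_le_one hN]; linarith
      have h4 : 0 ≤ ((N : ℝ) + 1 - ((x - n : ℤ) : ℝ)) / ((N : ℝ) + 1) := by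
        apply div_nonneg <;> linarith
      constructor
      · nlinarith
      · nlinarith

theorem abs_rightLyap_le (n : ℤ) (N : ℕ) (x : ℤ) : |rightLyap n N x| ≤ 1 := by
  have := rightLyap_mem_Icc n N x
  rw [abs_of_nonneg this.1]; exact this.2

theorem rightLyap_le_linear {n : ℤ} (N : ℕ) {x : ℤ} (h : n ≤ x) :
    rightLyap n N x ≤ 2 / ((N : ℝ) + 1) * ((x - n : ℤ) : ℝ) := by
  have hN : (0 : ℝ) < (N : ℝ) + 1 := by positivity
  rcases le_or_gt x (n + (N + 1)) with h' | h'
  · rw [rightLyap_of_mem h h']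
    set m : ℝ := ((x - n : ℤ) : ℝ)
    have : ((N : ℝ) + 1 - m) / ((N : ℝ) + 1) = 1 - m / ((N : ℝ) + 1) := by field_simp
    rw [this, div_mul_eq_mul_div]
    have : 2 * m / ((N : ℝ) + 1) = 2 * (m / ((N : ℝ) + 1)) := by ring
    nlinarith [sq_nonneg (m / ((N : ℝ) + 1))]
  · refine (rightLyap_mem_Icc n N x).2.trans ?_
    have : (N : ℝ) + 1 ≤ ((x - n : ℤ) : ℝ) := by exact_mod_cast (by omega : (N : ℤ) + 1 ≤ x - n)
    rw [div_mul_eq_mul_div, le_div_iff₀ hN]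
    linarith

theorem tendsto_rightLyap (n x : ℤ) : Tendsto (fun N => rightLyap n N x) atTop (𝓝 0) := by
  rcases le_or_gt x n with h | h
  · simp [rightLyap_of_le _ h]
  · have h1 : Tendsto (fun N : ℕ => 2 * (1 / ((N : ℝ) + 1)) * ((x - n : ℤ) : ℝ)) atTop
        (𝓝 (2 * 0 * ((x - n : ℤ) : ℝ))) :=
      (tendsto_one_div_add_atTop_nhds_zero_nat.const_mul 2).mul_const _
    rw [mul_zero, zero_mul] at h1
    refine squeeze_zero (fun N => (rightLyap_mem_Icc n N x).1) (fun N => ?_) h1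
    refine (rightLyap_le_linear N h.le).trans (le_of_eq (by ring))

theorem IsCenteredSkipFree.walkGen_rightLyap_gt (hc : IsCenteredSkipFree c) {n : ℤ} {N : ℕ} {x : ℤ}
    (hx : n < x) : walkGen c (rightLyap n N) x ≤ 0 ∧
      (rightLyap n N x = 1 ∨
        walkGen c (rightLyap n N) x ≤ -(c 0 * (2 / ((N : ℝ) + 1) ^ 2))) := by
  have hN : (0 : ℝ) < (N : ℝ) + 1 := by positivity
  rcases le_or_gt (n + (N + 1)) x with h' | h'
  · refine ⟨?_, Or.inl (rightLyap_of_ge h')⟩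
    have := hc.walkGen_le_of_slope (abs_rightLyap_le n N) (x := x) (s := 0) (d := 0)
      (fun j _ => by rw [rightLyap_of_ge h']; simpa using (rightLyap_mem_Icc n N _).2)
      (by rw [rightLyap_of_ge h']; simpa using (rightLyap_mem_Icc n N _).2)
    simpa using this
  · have hle : walkGen c (rightLyap n N) x ≤ -(c 0 * (2 / ((N : ℝ) + 1) ^ 2)) := by
      set a : ℝ := (N : ℝ) + 1 - ((x - n : ℤ) : ℝ) with ha
      have ha1 : 1 ≤ a := by
        have : ((x - n : ℤ) : ℝ) + 1 ≤ (N : ℝ) + 1 := by exact_mod_cast (by omega : x - n + 1 ≤ N + 1)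
        linarith
      have ex : rightLyap n N x = 1 - a ^ 2 / ((N : ℝ) + 1) ^ 2 := by
        rw [rightLyap_of_mem hx.le h'.le, div_pow]
      -- Here `a` is the distance to the top `n + N + 1`. The slope is the forward difference, `a² -
      -- (a-1)²` over `(N+1)²`; the backward difference exceeds it by `2 / (N+1)²`, and this is the
      -- gain `d`.
      refine hc.walkGen_le_of_slope (abs_rightLyap_le n N) (s := (2 * a - 1) / ((N : ℝ) + 1) ^ 2)
        (fun j hj => ?_) ?_
      · have hj' : (2 : ℝ) ≤ j := by exact_mod_cast hj
        rw [ex]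
        rcases le_or_gt (x + j - 1) (n + (N + 1)) with h3 | h3
        · have e : (N : ℝ) + 1 - ((x + j - 1 - n : ℤ) : ℝ) = a - (j - 1) := by
            rw [ha]; push_cast; ring
          rw [rightLyap_of_mem (by omega) h3, e, div_pow]
          have : (1 - a ^ 2 / ((N : ℝ) + 1) ^ 2 + (2 * a - 1) / ((N : ℝ) + 1) ^ 2 * (j - 1)) -
              (1 - (a - (j - 1)) ^ 2 / ((N : ℝ) + 1) ^ 2) =
              ((j - 1) ^ 2 - (j - 1)) / ((N : ℝ) + 1) ^ 2 := by
            field_simp; ring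
          have h4 : 0 ≤ (((j : ℝ) - 1) ^ 2 - (j - 1)) / ((N : ℝ) + 1) ^ 2 := by
            apply div_nonneg _ (by positivity); nlinarith
          linarith
        · rw [rightLyap_of_ge h3.le]
          have h5 : a ≤ (j : ℝ) - 1 := by
            have : (n : ℝ) + (N + 1) ≤ x + j - 1 := by exact_mod_cast h3.le
            rw [ha]; push_cast; linarith
          have : (1 - a ^ 2 / ((N : ℝ) + 1) ^ 2 + (2 * a - 1) / ((N : ℝ) + 1) ^ 2 * (j - 1)) - 1 =
              ((2 * a - 1) * (j - 1) - a ^ 2) / ((N : ℝ) + 1) ^ 2 := by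
            field_simp; ring
          have h4 : 0 ≤ ((2 * a - 1) * ((j : ℝ) - 1) - a ^ 2) / ((N : ℝ) + 1) ^ 2 := by
            apply div_nonneg _ (by positivity); nlinarith
          linarith
      · have e : (N : ℝ) + 1 - ((x - 1 - n : ℤ) : ℝ) = a + 1 := by
          rw [ha]; push_cast; ring
        rw [ex, rightLyap_of_mem (by omega) (by omega), e, div_pow]
        apply le_of_eq
        field_simp
        ring
    refine ⟨hle.trans ?_, Or.inr hle⟩
    have := hc.zero_pos
    have : 0 ≤ c 0 * (2 / ((N : ℝ) + 1) ^ 2) := by positivity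
    linarith

theorem IsCenteredSkipFree.walkGen_rightLyap_le (hc : IsCenteredSkipFree c) {n : ℤ} (N : ℕ) {x : ℤ}
    (hx : x ≤ n) : walkGen c (rightLyap n N) x ≤ 2 / ((N : ℝ) + 1) * c 0 := by
  have hN : (0 : ℝ) < (N : ℝ) + 1 := by positivity
  refine hc.tsum_mul_le_of_linear (fun j => abs_rightLyap_le n N _)
    (rightLyap_of_le N (by push_cast; omega)) (rightLyap_of_le N (by push_cast; omega))
    fun j hj => ?_
  rcases le_or_gt n (x + j - 1) with h | h
  · refine (rightLyap_le_linear N h).trans ?_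
    gcongr
    have : x + j - 1 - n ≤ (j : ℤ) - 1 := by omega
    have h2 : ((x + j - 1 - n : ℤ) : ℝ) ≤ ((j - 1 : ℤ) : ℝ) := by exact_mod_cast this
    push_cast at h2 ⊢
    exact h2
  · rw [rightLyap_of_le N h.le]
    have : (2 : ℝ) ≤ j := by exact_mod_cast hj
    have : (0 : ℝ) ≤ j - 1 := by linarith
    positivity

end Right

end

section

/-! ### A Lyapunov criterion for infinite occupation times -/

variable {x : ℝ → ℤ} {B : Set ℤ}

/-- The last time up to `r` at which the occupation time of `B` does not exceed `T`. -/
def occMin (B : Set ℤ) (x : ℝ → ℤ) (T r : ℝ) : ℝ := sSup {s | s ∈ Set.Icc 0 r ∧ occTime B x s ≤ T}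

theorem RegPath.occMin_mem (hx : RegPath x) (B : Set ℤ) {T r : ℝ} (hT : 0 ≤ T) (hr : 0 ≤ r) :
    occMin B x T r ∈ {s | s ∈ Set.Icc 0 r ∧ occTime B x s ≤ T} := by
  refine IsClosed.csSup_mem ?_ ⟨0, ⟨le_rfl, hr⟩, by simpa using hT⟩ ⟨r, fun s hs => hs.1.2⟩
  exact isClosed_Icc.inter (isClosed_le (hx.continuous_occTime B) continuous_const)

theorem RegPath.occMin_lt_iff (hx : RegPath x) (B : Set ℤ) {T r s : ℝ} (hT : 0 ≤ T) (hr : 0 ≤ r) :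
    occMin B x T r < s ↔ r < s ∨ T < occTime B x s := by
  have hm := hx.occMin_mem B hT hr
  constructor
  · intro h
    by_contra! hc
    exact absurd (le_csSup (⟨r, fun s hs => hs.1.2⟩ : BddAbove {s | s ∈ Set.Icc 0 r ∧ occTime B x s ≤ T})
      ⟨⟨hm.1.1.trans h.le, hc.1⟩, hc.2⟩) (not_le.2 h)
  · rintro (h | h)
    · exact hm.1.2.trans_lt h
    · by_contra! hc
      exact absurd ((hx.occTime_mono B hc).trans hm.2) (not_le.2 h)

theorem RegPath.occMin_eq (hx : RegPath x) (B : Set ℤ) {T r : ℝ} (hT : 0 ≤ T) (hr : 0 ≤ r)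
    (h : occTime B x r ≤ T) : occMin B x T r = r := by
  refine le_antisymm (hx.occMin_mem B hT hr).1.2 (not_lt.1 fun hlt => ?_)
  rcases (hx.occMin_lt_iff B hT hr).1 hlt with h1 | h1
  exacts [lt_irrefl _ h1, absurd h (not_le.2 h1)]

variable {Ω : Type*} [MeasurableSpace Ω] {P : Measure Ω} [IsProbabilityMeasure P]
  {X : ℝ → Ω → ℤ}

theorem IsProc.isOptional_occMin (hX : IsProc X) (B : Set ℤ) {T r : ℝ} (hT : 0 ≤ T) (hr : 0 ≤ r) :
    IsOptional X fun ω => occMin B (fun t => X t ω) T r := by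
  intro s
  simp only [fun ω => (hX.reg ω).occMin_lt_iff B (s := s) hT hr]
  rcases le_or_gt 0 s with hs | hs
  · exact (MeasurableSet.const _).union (hX.measurable_occTime B hs measurableSet_Ioi)
  · have : {ω | r < s ∨ T < occTime B (fun t => X t ω) s} = ∅ := by
      ext ω
      simp only [Set.mem_ofPred_eq, Set.mem_empty_iff_false, iff_false, not_or, not_lt]
      refine ⟨by linarith, ?_⟩
      have := (hX.reg ω).occTime_mono B hs.le
      rw [occTime_zero] at this
      exact this.trans hT
    rw [this]
    exact @MeasurableSet.empty Ω (past X s)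

/-- The estimate behind the Lyapunov criterion, up to a fixed time. -/
theorem MartPair.lyapunov_le (hX : IsProc X) {F H : ℤ → ℝ} (hM : MartPair P X F H) {ε η : ℝ}
    {W : Set ℤ}
    (hH : ∀ k, H k ≤ ε * B.indicator 1 k - η * W.indicator 1 k) (hε : 0 ≤ ε) {T r : ℝ} (hT : 0 ≤ T)
    (hr : 0 ≤ r) :
    ∫ ω, (F (X (occMin B (fun t => X t ω) T r) ω) +
      η * occTime W (fun t => X t ω) (occMin B (fun t => X t ω) T r)) ∂P ≤
      ∫ ω, F (X 0 ω) ∂P + ε * T := by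
  obtain ⟨K, hK⟩ := hM.bdd_left
  obtain ⟨K', hK'⟩ := hM.bdd_right
  have hK'0 : 0 ≤ K' := (abs_nonneg _).trans (hK' 0)
  set σ : Ω → ℝ := fun ω => occMin B (fun t => X t ω) T r with hσ
  have hmem := fun ω => (hX.reg ω).occMin_mem B hT hr
  have ho : IsOptional X σ := hX.isOptional_occMin B hT hr
  have hσm : Measurable σ := ho.measurable hX
  have key := hM.optional_sampling hX (τ₁ := fun _ => 0) (τ₂ := σ) (fun _ => le_rfl)
    (fun ω => (hmem ω).1.1) (isOptional_const X 0) ho (A := Set.univ)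
    (fun s => by rw [Set.univ_inter]; exact isOptional_const X 0 s) (C := K' * (r + 1))
    (fun ω a b h0 hab hb => by
      refine (abs_timeIntegral_le hK' a b).trans (mul_le_mul_of_nonneg_left ?_ hK'0)
      rw [abs_of_nonneg (sub_nonneg.2 hab)]
      have := (hmem ω).1.2
      have : σ ω ≤ r := this
      linarith)
  rw [Measure.restrict_univ] at key
  have i1 : Integrable (fun ω => F (X (σ ω) ω)) P := integrable_comp hX hK hσm
  have i0 : Integrable (fun ω => F (X 0 ω)) P := integrable_comp hX hK measurable_const
  have ib : ∀ {g : ℤ → ℝ} {C : ℝ}, (∀ k, |g k| ≤ C) →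
      Integrable (fun ω => ∫ u in (0 : ℝ)..σ ω, g (X u ω)) P := by
    intro g C hg
    refine integrable_of_bdd (measurable_timeIntegral hX hg measurable_const hσm) (K := C * r)
      fun ω => (abs_timeIntegral_le hg _ _).trans ?_
    have h1 : 0 ≤ σ ω := (hmem ω).1.1
    have h2 : σ ω ≤ r := (hmem ω).1.2
    rw [sub_zero, abs_of_nonneg h1]
    exact mul_le_mul_of_nonneg_left h2 ((abs_nonneg _).trans (hg 0))
  have iw : Integrable (fun ω => occTime W (fun t => X t ω) (σ ω)) P :=
    ib (abs_indicator_one_le W)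
  have e : ∫ ω, F (X (σ ω) ω) ∂P = ∫ ω, (F (X 0 ω) + ∫ u in (0 : ℝ)..σ ω, H (X u ω)) ∂P := by
    have i2 : Integrable (fun ω => F (X 0 ω) + ∫ u in (0 : ℝ)..σ ω, H (X u ω)) P := i0.add (ib hK')
    rw [← sub_eq_zero, ← integral_sub i1 i2]
    refine Eq.trans ?_ key
    exact integral_congr_ae (Eventually.of_forall fun ω => by simp only; ring)
  rw [integral_add i1 (iw.const_mul η), e, integral_add i0 (ib hK'), add_assoc,
    ← integral_add (ib hK') (iw.const_mul η)]
  refine add_le_add le_rfl ?_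
  have : ∫ ω, ((∫ u in (0 : ℝ)..σ ω, H (X u ω)) + η * occTime W (fun t => X t ω) (σ ω)) ∂P ≤
      ∫ _ω, ε * T ∂P := by
    refine integral_mono ((ib hK').add (iw.const_mul η)) (integrable_const _) fun ω => ?_
    simp only
    have hi := (hX.reg ω).integrable_indicator
    have h1 : ∫ u in (0 : ℝ)..σ ω, H (X u ω) ≤
        ∫ u in (0 : ℝ)..σ ω, (ε * B.indicator 1 (X u ω) - η * W.indicator 1 (X u ω)) :=
      intervalIntegral.integral_mono_on (hmem ω).1.1
        (intervalIntegrable_comp (hX.reg ω).measurable hK' _ _)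
        (((hi B _ _).const_mul ε).sub ((hi W _ _).const_mul η)) fun u _ => hH _
    rw [intervalIntegral.integral_sub ((hi B _ _).const_mul ε) ((hi W _ _).const_mul η),
      intervalIntegral.integral_const_mul, intervalIntegral.integral_const_mul] at h1
    have h2 : occTime B (fun t => X t ω) (σ ω) ≤ T := (hmem ω).2
    have h3 := mul_le_mul_of_nonneg_left h2 hε
    simp only [occTime] at h3 ⊢
    linarith
  simpa using this

theorem IsProc.measurableSet_occTime_le (hX : IsProc X) (B : Set ℤ) (T r : ℝ) :
    MeasurableSet {ω | occTime B (fun t => X t ω) r ≤ T} :=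
  measurable_timeIntegral hX (abs_indicator_one_le B) measurable_const measurable_const
    measurableSet_Iic

/-- Suppose that on `G` the set `B` is occupied for a time at most `T`. The expected value of `F`
stays below `e = E F(X_0) + ε T`, which bounds the time with `F = 1` by `r e`; the drift `-η` bounds
the time spent off `B` with `F ≠ 1` by `e/η`. Together with `T` these times cover `[0, r]`. -/
theorem MartPair.mul_measureReal_occTime_le (hX : IsProc X) {F H : ℤ → ℝ} (hM : MartPair P X F H)
    {ε η : ℝ} (hF : ∀ k, F k ∈ Set.Icc (0 : ℝ) 1) (hε : 0 ≤ ε) (hη : 0 < η)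
    (hB : ∀ k ∈ B, H k ≤ ε) (hBc : ∀ k, k ∉ B → H k ≤ 0 ∧ (F k = 1 ∨ H k ≤ -η))
    {T r : ℝ} (hT : 0 ≤ T) (hr : 0 ≤ r) {G : Set Ω} (hG : MeasurableSet G)
    (hGT : ∀ ω ∈ G, ∀ s, occTime B (fun t => X t ω) s ≤ T) :
    r * P.real G ≤ T + (∫ ω, F (X 0 ω) ∂P + ε * T) / η + r * (∫ ω, F (X 0 ω) ∂P + ε * T) := by
  obtain ⟨K, hK⟩ := hM.bdd_left
  set e := ∫ ω, F (X 0 ω) ∂P + ε * T with he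
  set W : Set ℤ := {k | k ∉ B ∧ F k ≠ 1} with hW
  have hH : ∀ k, H k ≤ ε * B.indicator 1 k - η * W.indicator 1 k := by
    intro k
    by_cases hk : k ∈ B
    · have : k ∉ W := fun h => h.1 hk
      simpa [hk, this] using hB k hk
    · by_cases hk' : k ∈ W
      · simpa [hk, hk'] using (hBc k hk).2.resolve_left hk'.2
      · simpa [hk, hk'] using (hBc k hk).1
  have hL := fun (u : ℝ) (hu : 0 ≤ u) =>
    hM.lyapunov_le (B := B) hX hH hε hT hu
  have hσ := fun (u : ℝ) (hu : 0 ≤ u) =>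
    (hX.isOptional_occMin B (T := T) hT hu).measurable hX
  have iF : ∀ u, 0 ≤ u → Integrable (fun ω => F (X (occMin B (fun t => X t ω) T u) ω)) P :=
    fun u hu => integrable_comp hX hK (hσ u hu)
  have hwn : ∀ ω s, 0 ≤ s → 0 ≤ occTime W (fun t => X t ω) s := fun ω s hs => by
    have := (hX.reg ω).occTime_mono W hs
    rwa [occTime_zero] at this
  have iw : ∀ u, 0 ≤ u →
      Integrable (fun ω => occTime W (fun t => X t ω) (occMin B (fun t => X t ω) T u)) P := by
    intro u hu
    refine integrable_of_bdd (measurable_timeIntegral hX (abs_indicator_one_le W) measurable_const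
      (hσ u hu)) (K := u) fun ω => (abs_timeIntegral_le (abs_indicator_one_le W) _ _).trans ?_
    have := (hX.reg ω).occMin_mem B hT hu
    rw [sub_zero, abs_of_nonneg this.1.1, one_mul]
    exact this.1.2
  have hs0 : ∀ ω u, 0 ≤ u → 0 ≤ occMin B (fun t => X t ω) T u := fun ω u hu =>
    ((hX.reg ω).occMin_mem B hT hu).1.1
  have hnnw : ∀ u, 0 ≤ u →
      0 ≤ ∫ ω, occTime W (fun t => X t ω) (occMin B (fun t => X t ω) T u) ∂P :=
    fun u hu => integral_nonneg fun ω => hwn ω _ (hs0 ω u hu)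
  have hnnF : ∀ u, 0 ≤ ∫ ω, F (X (occMin B (fun t => X t ω) T u) ω) ∂P :=
    fun u => integral_nonneg fun ω => (hF _).1
  have hL' : ∀ u, 0 ≤ u → ∫ ω, F (X (occMin B (fun t => X t ω) T u) ω) ∂P +
      η * ∫ ω, occTime W (fun t => X t ω) (occMin B (fun t => X t ω) T u) ∂P ≤ e := by
    intro u hu
    have := hL u hu
    rwa [integral_add (iF u hu) ((iw u hu).const_mul η), integral_const_mul] at this
  have h1 : ∀ u, 0 ≤ u → ∫ ω in G, F (X u ω) ∂P ≤ e := by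
    intro u hu
    -- On `G` the occupation time never exceeds `T`, so stopping at `occMin` has no effect there.
    have e1 : ∫ ω in G, F (X u ω) ∂P =
        ∫ ω in G, F (X (occMin B (fun t => X t ω) T u) ω) ∂P :=
      setIntegral_congr_fun hG fun ω hω => by
        simp only [(hX.reg ω).occMin_eq B hT hu (hGT ω hω u)]
    rw [e1]
    refine (setIntegral_le_integral (iF u hu) (Eventually.of_forall fun ω => (hF _).1)).trans ?_
    have := mul_nonneg hη.le (hnnw u hu)
    linarith [hL' u hu]
  have h2 : ∫ ω in G, occTime W (fun t => X t ω) r ∂P ≤ e / η := by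
    have e1 : ∫ ω in G, occTime W (fun t => X t ω) r ∂P =
        ∫ ω in G, occTime W (fun t => X t ω) (occMin B (fun t => X t ω) T r) ∂P :=
      setIntegral_congr_fun hG fun ω hω => by
        simp only [(hX.reg ω).occMin_eq B hT hr (hGT ω hω r)]
    rw [e1]
    refine (setIntegral_le_integral (iw r hr)
      (Eventually.of_forall fun ω => hwn ω _ (hs0 ω r hr))).trans ?_
    rw [le_div_iff₀ hη]
    linarith [hL' r hr, hnnF r]
  have h3 : ∫ ω in G, (∫ u in (0 : ℝ)..r, F (X u ω)) ∂P ≤ r * e := by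
    simp only [intervalIntegral.integral_of_le hr]
    rw [integral_integral_swap]
    · have : ∫ u in Set.Ioc 0 r, ∫ ω in G, F (X u ω) ∂P ≤ ∫ _u in Set.Ioc 0 r, e := by
        refine integral_mono_of_nonneg (Eventually.of_forall fun u =>
          integral_nonneg fun ω => (hF _).1) (integrable_const _) ?_
        filter_upwards [ae_restrict_mem measurableSet_Ioc] with u hu
        exact h1 u hu.1.le
      refine this.trans_eq ?_
      simp [hr]
    · refine Integrable.of_bound (C := K) ?_ (Eventually.of_forall fun q => hK _)
      exact ((measurable_of_countable F).comp
        (hX.measurable_uncurry.comp measurable_swap)).aestronglyMeasurable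
  have iW : Integrable (fun ω => occTime W (fun t => X t ω) r) (P.restrict G) :=
    (integrable_timeIntegral (P := P) hX (abs_indicator_one_le W) 0 r).restrict
  have iI : Integrable (fun ω => ∫ u in (0 : ℝ)..r, F (X u ω)) (P.restrict G) :=
    (integrable_timeIntegral (P := P) hX hK 0 r).restrict
  -- Pointwise `1 ≤ 1_B + 1_W + F`: a state off `B` and off `W` has `F = 1`.
  have h4 : ∫ _ω in G, r ∂P ≤
      ∫ ω in G, (T + occTime W (fun t => X t ω) r + ∫ u in (0 : ℝ)..r, F (X u ω)) ∂P := by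
    refine setIntegral_mono_on (integrable_const _).integrableOn
      (((integrable_const T).add iW).add iI) hG fun ω hω => ?_
    have hi := (hX.reg ω).integrable_indicator
    have hiF := intervalIntegrable_comp (hX.reg ω).measurable hK 0 r
    have a1 := hGT ω hω r
    have a2 : ∫ _u in (0 : ℝ)..r, (1 : ℝ) ≤ ∫ u in (0 : ℝ)..r,
        (B.indicator 1 (X u ω) + W.indicator 1 (X u ω) + F (X u ω)) := by
      refine intervalIntegral.integral_mono_on hr intervalIntegrable_const
        (((hi B _ _).add (hi W _ _)).add hiF) fun u _ => ?_
      have hn : ∀ C : Set ℤ, 0 ≤ C.indicator (1 : ℤ → ℝ) (X u ω) := fun C =>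
        Set.indicator_nonneg (fun _ _ => zero_le_one) _
      by_cases hk : X u ω ∈ B
      · have := hn W
        have := (hF (X u ω)).1
        rw [Set.indicator_of_mem hk, Pi.one_apply]
        linarith
      · by_cases hk' : F (X u ω) = 1
        · linarith [hn B, hn W]
        · have : X u ω ∈ W := ⟨hk, hk'⟩
          rw [Set.indicator_of_mem this, Pi.one_apply]
          linarith [hn B, (hF (X u ω)).1]
    rw [intervalIntegral.integral_add ((hi B _ _).add (hi W _ _)) hiF,
      intervalIntegral.integral_add (hi B _ _) (hi W _ _)] at a2
    simp only [intervalIntegral.integral_const, sub_zero, smul_eq_mul, mul_one] at a2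
    simp only [occTime] at a1 ⊢
    linarith
  have iTW : Integrable (fun ω => T + occTime W (fun t => X t ω) r) (P.restrict G) :=
    (integrable_const T).add iW
  rw [integral_add iTW iI, integral_add (integrable_const T) iW] at h4
  simp only [integral_const, measureReal_restrict_apply_univ, smul_eq_mul] at h4
  have h5 : P.real G * T ≤ T := mul_le_of_le_one_left hT measureReal_le_one
  linarith [mul_comm r (P.real G)]

theorem le_of_forall_mul_le {p a e : ℝ} (h : ∀ r : ℝ, 0 ≤ r → r * p ≤ a + r * e) : p ≤ e := by
  by_contra! hc
  have h1 := h ((|a| + 1) / (p - e)) (div_nonneg (by positivity) (sub_nonneg.2 hc.le))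
  have h2 : (|a| + 1) / (p - e) * (p - e) = |a| + 1 := div_mul_cancel₀ _ (sub_pos.2 hc).ne'
  have h3 := le_abs_self a
  nlinarith

/-- A sequence of bounded Lyapunov functions that vanishes in the limit at the starting point
shows that `B` is visited during an infinite amount of time. -/
theorem ae_occInfinite (hX : IsProc X) {F H : ℕ → ℤ → ℝ} {ε η : ℕ → ℝ}
    (hM : ∀ N, MartPair P X (F N) (H N)) (hF : ∀ N k, F N k ∈ Set.Icc (0 : ℝ) 1)
    (h0 : ∀ ω, Tendsto (fun N => F N (X 0 ω)) atTop (𝓝 0)) (hε : Tendsto ε atTop (𝓝 0))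
    (hε0 : ∀ N, 0 ≤ ε N) (hη : ∀ N, 0 < η N) (hB : ∀ N, ∀ k ∈ B, H N k ≤ ε N)
    (hBc : ∀ N k, k ∉ B → H N k ≤ 0 ∧ (F N k = 1 ∨ H N k ≤ -η N)) :
    ∀ᵐ ω ∂P, OccInfinite B fun t => X t ω := by
  have key : ∀ T : ℕ, P {ω | ∀ r : ℕ, occTime B (fun t => X t ω) r ≤ T} = 0 := by
    intro T
    set G := {ω | ∀ r : ℕ, occTime B (fun t => X t ω) r ≤ T} with hGdef
    have hG : MeasurableSet G := by
      have : G = ⋂ r : ℕ, {ω | occTime B (fun t => X t ω) r ≤ T} := by ext; simp [hGdef]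
      rw [this]
      exact MeasurableSet.iInter fun r => hX.measurableSet_occTime_le B T r
    have hGT : ∀ ω ∈ G, ∀ s, occTime B (fun t => X t ω) s ≤ T := fun ω hω s => by
      obtain ⟨r, hr⟩ := exists_nat_ge s
      exact ((hX.reg ω).occTime_mono B hr).trans (hω r)
    have h1 : ∀ N, P.real G ≤ ∫ ω, F N (X 0 ω) ∂P + ε N * T := fun N =>
      le_of_forall_mul_le fun r hr =>
        (hM N).mul_measureReal_occTime_le hX (hF N) (hε0 N) (hη N) (hB N) (hBc N) T.cast_nonneg hr
          hG hGT
    have h2 : Tendsto (fun N => ∫ ω, F N (X 0 ω) ∂P) atTop (𝓝 (∫ _ω, 0 ∂P)) := by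
      refine tendsto_integral_of_dominated_convergence (fun _ => 1) (fun N => ?_)
        (integrable_const _) (fun N => Eventually.of_forall fun ω => ?_) (Eventually.of_forall h0)
      · exact ((measurable_of_countable (F N)).comp (hX.meas 0)).aestronglyMeasurable
      · rw [Real.norm_eq_abs, abs_of_nonneg (hF N _).1]; exact (hF N _).2
    have h3 : P.real G ≤ 0 := by
      refine ge_of_tendsto' (x := atTop) ?_ h1
      simpa using h2.add (hε.mul_const (T : ℝ))
    exact (measureReal_eq_zero_iff).1 (le_antisymm h3 measureReal_nonneg)
  have : ∀ᵐ ω ∂P, ∀ T : ℕ, ¬ ∀ r : ℕ, occTime B (fun t => X t ω) r ≤ T :=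
    ae_all_iff.2 fun T => by rw [ae_iff]; simpa using key T
  filter_upwards [this] with ω hω T
  obtain ⟨m, hm⟩ := exists_nat_ge T
  have := hω m
  push Not at this
  obtain ⟨r, hr⟩ := this
  exact ⟨r, hm.trans_lt hr⟩

end

section

/-! ### Recurrence of the free walk, the fast-forwarded walk and the reflected walk -/

variable {c : ℕ → ℝ} {Ω : Type*} [MeasurableSpace Ω] {P : Measure Ω} [IsProbabilityMeasure P]
  {X : ℝ → Ω → ℤ}

theorem tendsto_two_div_mul (a : ℝ) : Tendsto (fun N : ℕ => 2 / ((N : ℝ) + 1) * a) atTop (𝓝 0) := by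
  have := (tendsto_one_div_add_atTop_nhds_zero_nat (𝕜 := ℝ)).mul_const (2 * a)
  rw [zero_mul] at this
  exact this.congr fun N => by ring

theorem IsCenteredSkipFree.ae_occInfinite_Iic (hc : IsCenteredSkipFree c) (hX : IsProc X) {n : ℤ}
    (hM : ∀ N, MartPair P X (rightLyap n N) (walkGen c (rightLyap n N))) :
    ∀ᵐ ω ∂P, OccInfinite (Set.Iic n) fun t => X t ω := by
  have h0 := hc.zero_pos
  refine ae_occInfinite hX hM (rightLyap_mem_Icc n) (fun ω => tendsto_rightLyap n _)
    (ε := fun N => 2 / ((N : ℝ) + 1) * c 0) (η := fun N => c 0 * (2 / ((N : ℝ) + 1) ^ 2))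
    (tendsto_two_div_mul _) (fun N => by positivity) (fun N => by positivity)
    (fun N k hk => hc.walkGen_rightLyap_le N hk)
    fun N k hk => hc.walkGen_rightLyap_gt (not_le.1 hk)

/-- The truncated and normalised function `leftLyap`. -/
def leftLyapTrunc (c : ℕ → ℝ) (N : ℕ) (x : ℤ) : ℝ := min (leftLyap c x) (N + 1) / (N + 1)

theorem leftLyapTrunc_le (c : ℕ → ℝ) (N : ℕ) (x : ℤ) :
    leftLyapTrunc c N x ≤ leftLyap c x / (N + 1) :=
  div_le_div_of_nonneg_right (min_le_left _ _) (by positivity)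

theorem IsCenteredSkipFree.leftLyapTrunc_mem_Icc (hc : IsCenteredSkipFree c) (N : ℕ) (x : ℤ) :
    leftLyapTrunc c N x ∈ Set.Icc (0 : ℝ) 1 :=
  ⟨div_nonneg (le_min (hc.leftLyap_nonneg x) (by positivity)) (by positivity),
    div_le_one_of_le₀ (min_le_right _ _) (by positivity)⟩

theorem IsCenteredSkipFree.abs_leftLyapTrunc_le (hc : IsCenteredSkipFree c) (N : ℕ) (x : ℤ) :
    |leftLyapTrunc c N x| ≤ 1 := by
  have := hc.leftLyapTrunc_mem_Icc N x
  rw [abs_of_nonneg this.1]; exact this.2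

/-- Skip freeness: from the positive integers, where the function vanishes, the only jump to a
nonzero value is the step from `1` to `0`. -/
theorem IsCenteredSkipFree.walkGen_leftLyapTrunc_pos (hc : IsCenteredSkipFree c) (N : ℕ) {x : ℤ}
    (hx : 1 ≤ x) :
    walkGen c (leftLyapTrunc c N) x ≤ c 0 * (leftLyap c 0 / (N + 1)) := by
  have h0 : ∀ y : ℤ, 1 ≤ y → leftLyapTrunc c N y = 0 := fun y hy => by
    rw [leftLyapTrunc, leftLyap_of_pos hy, min_eq_left (by positivity), zero_div]
  rw [walkGen, tsum_eq_single 0 fun j hj => by rw [h0 _ (by omega), mul_zero]]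
  refine mul_le_mul_of_nonneg_left ?_ hc.zero_pos.le
  rcases hx.eq_or_lt with rfl | hx
  · exact leftLyapTrunc_le c N _
  · rw [h0 _ (by push_cast; omega)]
    exact div_nonneg (hc.leftLyap_nonneg 0) (by positivity)

/-- Where the truncation is active the function is maximal. Elsewhere the drift of `leftLyap`
survives; it decays like `2 ^ x`, but these `x` are bounded below because `leftLyap` exceeds `N + 1`
far to the left. -/
theorem IsCenteredSkipFree.exists_walkGen_leftLyapTrunc_le (hc : IsCenteredSkipFree c) (N : ℕ) :
    ∃ η : ℝ, 0 < η ∧ ∀ x : ℤ, x ≤ 0 → walkGen c (leftLyapTrunc c N) x ≤ 0 ∧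
      (leftLyapTrunc c N x = 1 ∨ walkGen c (leftLyapTrunc c N) x ≤ -η) := by
  have hN : (0 : ℝ) < N + 1 := by positivity
  have h0 := hc.zero_pos
  obtain ⟨M, hM⟩ := hc.exists_le_leftLyap (2 * (N + 1))
  refine ⟨c 0 * 2 ^ (-(M : ℤ) - 1) / (N + 1), by positivity, fun x hx => ?_⟩
  rcases le_or_gt ((N : ℝ) + 1) (leftLyap c x) with h | h
  · have h1 : leftLyapTrunc c N x = 1 := by
      rw [leftLyapTrunc, min_eq_right h, div_self hN.ne']
    refine ⟨?_, Or.inl h1⟩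
    have := hc.walkGen_le_of_slope (hc.abs_leftLyapTrunc_le N) (x := x) (s := 0) (d := 0)
      (fun j _ => by rw [h1, zero_mul, add_zero]; exact (hc.leftLyapTrunc_mem_Icc N _).2)
      (by rw [h1, sub_zero, sub_zero]; exact (hc.leftLyapTrunc_mem_Icc N _).2)
    simpa using this
  · have hxM : -(M : ℤ) ≤ x := by
      by_contra! hc'
      have := hM x hc'.le
      push_cast at this
      linarith
    have h1 : walkGen c (leftLyapTrunc c N) x ≤ -(c 0 * 2 ^ (x - 1)) / (N + 1) := by
      have e1 : HasSum (fun j : ℕ => c j * leftLyapTrunc c N (x + j - 1))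
        (walkGen c (leftLyapTrunc c N) x) := (hc.summable_mul fun j => hc.abs_leftLyapTrunc_le N _).hasSum
      refine hasSum_le (fun j => ?_) e1 ((hc.hasSum_walkGen_leftLyap hx).div_const _)
      rw [mul_div_assoc]
      have hnn : ∀ j, j ≠ 1 → 0 ≤ c j := fun j hj => by
        rcases j with _ | _ | j
        exacts [h0.le, absurd rfl hj, hc.nonneg _ (by omega)]
      by_cases hj : j = 1
      · subst hj
        have : x + ((1 : ℕ) : ℤ) - 1 = x := by push_cast; ring
        rw [this, leftLyapTrunc, min_eq_left h.le]
      · exact mul_le_mul_of_nonneg_left (leftLyapTrunc_le c N _) (hnn j hj)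
    have h2 : -(c 0 * 2 ^ (x - 1)) / (N + 1) ≤ -(c 0 * 2 ^ (-(M : ℤ) - 1) / ((N : ℝ) + 1)) := by
      rw [neg_div, neg_le_neg_iff]
      gcongr
      norm_num
    refine ⟨h1.trans (h2.trans ?_), Or.inr (h1.trans h2)⟩
    rw [neg_nonpos]
    positivity

theorem IsCenteredSkipFree.ae_occInfinite_Ici (hc : IsCenteredSkipFree c) (hX : IsProc X)
    (hM : ∀ N, MartPair P X (leftLyapTrunc c N) (walkGen c (leftLyapTrunc c N))) :
    ∀ᵐ ω ∂P, OccInfinite (Set.Ici 1) fun t => X t ω := by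
  choose η hη hη' using hc.exists_walkGen_leftLyapTrunc_le
  have hlim : ∀ a : ℝ, Tendsto (fun N : ℕ => a / ((N : ℝ) + 1)) atTop (𝓝 0) := fun a => by
    refine (tendsto_two_div_mul (a / 2)).congr fun N => by ring
  refine ae_occInfinite hX hM hc.leftLyapTrunc_mem_Icc (fun ω => ?_)
    (ε := fun N => c 0 * (leftLyap c 0 / ((N : ℝ) + 1))) (η := η) ?_
    (fun N => mul_nonneg hc.zero_pos.le (div_nonneg (hc.leftLyap_nonneg 0) (by positivity))) hη
    (fun N k hk => hc.walkGen_leftLyapTrunc_pos N hk)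
    fun N k hk => hη' N k (by simp only [Set.mem_Ici, not_le] at hk; omega)
  · exact tendsto_of_tendsto_of_tendsto_of_le_of_le tendsto_const_nhds (hlim (leftLyap c (X 0 ω)))
      (fun N => (hc.leftLyapTrunc_mem_Icc N _).1) fun N => leftLyapTrunc_le c N _
  · simpa using (hlim (leftLyap c 0)).const_mul (c 0)

/-- For the walk fast-forwarded at the left, whose pairs are those of ladder extensions. The
generator differs from that of the parabola at `1`, where it is `-a N`; this tends to zero by
dominated convergence and is absorbed into `ε`. -/
theorem IsCenteredSkipFree.ae_occInfinite_ladder (hc : IsCenteredSkipFree c) (hX : IsProc X) {n : ℤ}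
    (hn : 1 ≤ n) (hX0 : ∀ ω, 1 ≤ X 0 ω)
    (hM : ∀ N, MartPair P X (ladderExt c 0 (rightLyap n N))
      (walkGen c (ladderExt c 0 (rightLyap n N)))) :
    ∀ᵐ ω ∂P, OccInfinite (Set.Iic n) fun t => X t ω := by
  have h0 := hc.zero_pos
  set a : ℕ → ℝ := fun N =>
    ∑' j : ℕ, (∑ k ∈ Finset.range (j + 1), c k) * rightLyap n N (1 + j) with ha
  have hlim : Tendsto a atTop (𝓝 (∑' j : ℕ, (∑ k ∈ Finset.range (j + 1), c k) * 0)) := by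
    refine tendsto_tsum_of_dominated_convergence hc.summable_partial
      (fun j => (tendsto_rightLyap n _).const_mul _) (Eventually.of_forall fun N j => ?_)
    rw [Real.norm_eq_abs, abs_mul]
    exact mul_le_of_le_one_right (abs_nonneg _) (abs_rightLyap_le n N _)
  simp only [mul_zero, tsum_zero] at hlim
  refine ae_occInfinite hX hM
    (fun N => hc.ladderExt_mem_Icc fun x _ => rightLyap_mem_Icc n N x) (fun ω => ?_)
    (ε := fun N => 2 / ((N : ℝ) + 1) * c 0 + |a N|) (η := fun N => c 0 * (2 / ((N : ℝ) + 1) ^ 2))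
    ?_ (fun N => by positivity) (fun N => by positivity) (fun N k hk => ?_) fun N k hk => ?_
  · simp only [ladderExt_of_pos c 0 _ (hX0 ω)]
    exact tendsto_rightLyap n _
  · simpa using (tendsto_two_div_mul (c 0)).add hlim.abs
  · have hp : 0 ≤ 2 / ((N : ℝ) + 1) * c 0 := by positivity
    have := abs_nonneg (a N)
    rcases le_or_gt k 0 with h | h
    · rw [hc.walkGen_ladderExt_nonpos (abs_rightLyap_le n N) h]
      positivity
    · rcases (by omega : k = 1 ∨ 2 ≤ k) with rfl | h2
      · rw [hc.walkGen_ladderExt_one (abs_rightLyap_le n N)]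
        have := neg_abs_le (a N)
        linarith
      · rw [walkGen_ladderExt_of_two_le _ _ _ h2]
        linarith [hc.walkGen_rightLyap_le N (Set.mem_Iic.1 hk)]
  · have hk' : n < k := not_le.1 hk
    rw [walkGen_ladderExt_of_two_le _ _ _ (by omega), ladderExt_of_pos _ _ _ (by omega)]
    exact hc.walkGen_rightLyap_gt hk'

theorem IsCenteredSkipFree.ae_occInfinite_reflected (hc : IsCenteredSkipFree c) (hX : IsProc X)
    {n : ℤ} (hn : 1 ≤ n)
    (hM : ∀ N, MartPair P X (rightLyap n N)
      (fun z => ∑' j : ℕ, c j * rightLyap n N (max (z + j - 1) 1))) :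
    ∀ᵐ ω ∂P, OccInfinite (Set.Iic n) fun t => X t ω := by
  have h0 := hc.zero_pos
  refine ae_occInfinite hX hM (rightLyap_mem_Icc n) (fun ω => tendsto_rightLyap n _)
    (ε := fun N => 2 / ((N : ℝ) + 1) * c 0) (η := fun N => c 0 * (2 / ((N : ℝ) + 1) ^ 2))
    (tendsto_two_div_mul _) (fun N => by positivity) (fun N => by positivity)
    (fun N k hk => ?_) fun N k hk => ?_
  -- Since `n ≥ 1`, the reflecting floor `1` lies where the function vanishes and does not spoil the
  -- linear bound.
  · have hk : k ≤ n := hk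
    refine hc.tsum_mul_le_of_linear (fun j => abs_rightLyap_le n N _)
      (rightLyap_of_le N (by push_cast; omega)) (rightLyap_of_le N (by push_cast; omega))
      fun j hj => ?_
    rcases le_or_gt n (max (k + j - 1) 1) with h | h
    · refine (rightLyap_le_linear N h).trans (mul_le_mul_of_nonneg_left ?_ (by positivity))
      have : max (k + j - 1) 1 - n ≤ (j : ℤ) - 1 := by omega
      exact_mod_cast this
    · rw [rightLyap_of_le N h.le]
      have : (2 : ℝ) ≤ j := by exact_mod_cast hj
      exact mul_nonneg (by positivity) (by linarith)
  · have hk' : n < k := not_le.1 hk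
    have : ∀ j : ℕ, max (k + j - 1) 1 = k + j - 1 := fun j => by omega
    simp only [this]
    exact hc.walkGen_rightLyap_gt hk'

end

section

/-! ### Chains on a finite set -/

/-! ### The transition function of a finite rate matrix -/

section MatrixExp

attribute [local instance] Matrix.linftyOpNormedRing Matrix.linftyOpNormedAlgebra

variable {S : Type*} [Fintype S] [DecidableEq S]

/-- The transition matrices `e^{tQ}`. -/
def expMatrix (Q : Matrix S S ℝ) (t : ℝ) : Matrix S S ℝ := NormedSpace.exp (t • Q)

theorem hasDerivAt_expMatrix (Q : Matrix S S ℝ) (t : ℝ) (i j : S) :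
    HasDerivAt (fun t => expMatrix Q t i j) ((Q * expMatrix Q t) i j) t := by
  have h := hasDerivAt_exp_smul_const' (𝕂 := ℝ) Q t
  let l : Matrix S S ℝ →ₗ[ℝ] ℝ := Matrix.entryLinearMap ℝ ℝ i j
  exact (LinearMap.toContinuousLinearMap l).hasFDerivAt.comp_hasDerivAt t h

theorem hasDerivAt_expMatrix' (Q : Matrix S S ℝ) (t : ℝ) (i j : S) :
    HasDerivAt (fun t => expMatrix Q t i j) ((expMatrix Q t * Q) i j) t := by
  have h := hasDerivAt_exp_smul_const (𝕂 := ℝ) Q t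
  let l : Matrix S S ℝ →ₗ[ℝ] ℝ := Matrix.entryLinearMap ℝ ℝ i j
  exact (LinearMap.toContinuousLinearMap l).hasFDerivAt.comp_hasDerivAt t h

theorem expMatrix_zero (Q : Matrix S S ℝ) : expMatrix Q 0 = 1 := by
  rw [expMatrix, zero_smul, NormedSpace.exp_zero]

theorem exp_matrix_nonneg {A : Matrix S S ℝ} (hA : ∀ i j, 0 ≤ A i j) (i j : S) :
    0 ≤ (NormedSpace.exp A) i j := by
  have h := NormedSpace.exp_series_hasSum_exp' (𝕂 := ℝ) A
  let l : Matrix S S ℝ →ₗ[ℝ] ℝ := Matrix.entryLinearMap ℝ ℝ i j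
  have h' := (LinearMap.toContinuousLinearMap l).hasSum h
  have hpow : ∀ (n : ℕ) i j, 0 ≤ (A ^ n) i j := by
    intro n
    induction n with
    | zero => intro i j; rw [pow_zero, Matrix.one_apply]; split_ifs <;> norm_num
    | succ n ih =>
      intro i j
      rw [pow_succ, Matrix.mul_apply]
      exact Finset.sum_nonneg fun k _ => mul_nonneg (ih i k) (hA k j)
  refine h'.nonneg fun n => ?_
  change 0 ≤ ((n.factorial : ℝ)⁻¹) * (A ^ n) i j
  exact mul_nonneg (by positivity) (hpow n i j)

/-- Adding a multiple of the identity makes the matrix entrywise nonnegative, and only changes the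
exponential by a positive scalar factor. -/
theorem expMatrix_nonneg {Q : Matrix S S ℝ} (hQ : ∀ i j, i ≠ j → 0 ≤ Q i j) {t : ℝ} (ht : 0 ≤ t)
    (i j : S) : 0 ≤ expMatrix Q t i j := by
  set a : ℝ := ∑ k, |Q k k| with ha
  have haQ : ∀ k, 0 ≤ a + Q k k := fun k => by
    have h1 : |Q k k| ≤ a := Finset.single_le_sum (f := fun k => |Q k k|)
      (fun k _ => abs_nonneg _) (Finset.mem_univ k)
    linarith [neg_abs_le (Q k k)]
  set A : Matrix S S ℝ := t • (a • (1 : Matrix S S ℝ) + Q) with hA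
  have hA0 : ∀ i j, 0 ≤ A i j := by
    intro i j
    rw [hA, Matrix.smul_apply, Matrix.add_apply, Matrix.smul_apply, Matrix.one_apply]
    refine mul_nonneg ht ?_
    split_ifs with h
    · subst h; simpa using haQ i
    · simpa using hQ i j h
  have e : t • Q = A + algebraMap ℝ (Matrix S S ℝ) (-(t * a)) := by
    rw [hA, Algebra.algebraMap_eq_smul_one, smul_add, smul_smul, neg_smul]
    abel
  have hcomm : Commute A (algebraMap ℝ (Matrix S S ℝ) (-(t * a))) :=
    (Algebra.commutes _ _).symm
  have e' : NormedSpace.exp (t • Q) = Real.exp (-(t * a)) • NormedSpace.exp A := by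
    have h1 := Matrix.exp_add_of_commute A _ hcomm
    have h2 : algebraMap ℝ (Matrix S S ℝ) (NormedSpace.exp (-(t * a))) =
        NormedSpace.exp (algebraMap ℝ (Matrix S S ℝ) (-(t * a))) :=
      NormedSpace.algebraMap_exp_comm _
    rw [e, h1, ← h2, ← Algebra.commutes, ← Algebra.smul_def, ← Real.exp_eq_exp_ℝ]
  have e2 : expMatrix Q t i j = Real.exp (-(t * a)) * NormedSpace.exp A i j :=
    congrFun (congrFun e' i) j
  rw [e2]
  exact mul_nonneg (Real.exp_pos _).le (exp_matrix_nonneg hA0 i j)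

theorem expMatrix_row_sum {Q : Matrix S S ℝ} (hQ : ∀ i, ∑ j, Q i j = 0) (t : ℝ) (i : S) :
    ∑ j, expMatrix Q t i j = 1 := by
  have hd : ∀ t, HasDerivAt (fun t => ∑ j, expMatrix Q t i j) 0 t := by
    intro t
    have h := HasDerivAt.fun_sum (u := Finset.univ) fun j _ => hasDerivAt_expMatrix' Q t i j
    convert! h using 1
    simp only [Matrix.mul_apply]
    rw [Finset.sum_comm]
    simp only [← Finset.mul_sum, hQ, mul_zero, Finset.sum_const_zero]
  have hconst := is_const_of_deriv_eq_zero (fun t => (hd t).differentiableAt)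
    (fun t => (hd t).deriv) t 0
  rw [hconst, expMatrix_zero]
  simp [Matrix.one_apply]

theorem isTransitionFunction_expMatrix {Q : Matrix S S ℝ} (hQ : ∀ i j, i ≠ j → 0 ≤ Q i j)
    (hQ0 : ∀ i, ∑ j, Q i j = 0) :
    IsTransitionFunction Q fun t : ℝ≥0 => expMatrix Q (t : ℝ) where
  nonneg t := expMatrix_nonneg hQ t.2
  hasSum_one t i := by
    rw [← expMatrix_row_sum hQ0 t i]
    exact hasSum_fintype _
  zero_self i := by simp [expMatrix_zero]
  zero_ne i j hij := by simp [expMatrix_zero, hij]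
  backward t i j := by
    rw [tsum_fintype]
    have h := (hasDerivAt_expMatrix Q (t : ℝ) i j).hasDerivWithinAt (s := Set.Ici 0)
    rw [Matrix.mul_apply] at h
    refine h.congr (fun s hs => ?_) ?_
    · simp only [Real.coe_toNNReal s hs]
    · simp

end MatrixExp

/-! ### Uniqueness for the martingale problem on a finite set -/

section Chain

variable {Ω : Type*} [MeasurableSpace Ω] {P : Measure Ω} [IsProbabilityMeasure P]
  {X : ℝ → Ω → ℤ} {S : Type*} [Fintype S] [DecidableEq S]

theorem MartPair.setIntegral_eq (hX : IsProc X) {F h : ℤ → ℝ} (hM : MartPair P X F h) {s t : ℝ}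
    (hs : 0 ≤ s) (hst : s ≤ t) {A : Set Ω} (hA : MeasurableSet[past X s] A) :
    ∫ ω in A, F (X t ω) ∂P = ∫ ω in A, F (X s ω) ∂P +
      ∫ r in s..t, ∫ ω in A, h (X r ω) ∂P := by
  obtain ⟨K, hK⟩ := hM.bdd_left
  obtain ⟨K', hK'⟩ := hM.bdd_right
  have hi : ∀ u, Integrable (fun ω => F (X u ω)) (P.restrict A) := fun u =>
    (integrable_comp (P := P) hX hK (measurable_const (a := u))).restrict
  have h1 := hM.eq s t hs hst A hA
  have i1 : Integrable (fun ω => F (X t ω) - F (X s ω)) (P.restrict A) := (hi t).sub (hi s)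
  rw [integral_sub i1 (integrable_timeIntegral (P := P) hX hK' s t).restrict,
    integral_sub (hi t) (hi s)] at h1
  have h2 : ∫ ω in A, (∫ r in s..t, h (X r ω)) ∂P = ∫ r in s..t, ∫ ω in A, h (X r ω) ∂P := by
    simp only [intervalIntegral.integral_of_le hst]
    rw [integral_integral_swap]
    refine Integrable.of_bound (C := K') ?_ (Eventually.of_forall fun q => hK' _)
    exact ((measurable_of_countable h).comp
      (hX.measurable_uncurry.comp measurable_swap)).aestronglyMeasurable
  linarith

/-- A finite-state process that solves the martingale problem for `Q` has the transition
function `e^{tQ}`. -/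
theorem measureReal_inter_eq_expMatrix (hX : IsProc X) {Q : Matrix S S ℝ} (π : ℤ → S)
    (hM : ∀ g : S → ℝ, MartPair P X (fun k => g (π k)) (fun k => (Q.mulVec g) (π k)))
    {s t : ℝ} (hs : 0 ≤ s) (hst : s ≤ t) {A : Set Ω} (hA : MeasurableSet[past X s] A) (j : S) :
    P.real (A ∩ {ω | π (X t ω) = j}) =
      ∑ i, P.real (A ∩ {ω | π (X s ω) = i}) * expMatrix Q (t - s) i j := by
  set V : ℝ → S → ℝ := fun r i => P.real (A ∩ {ω | π (X r ω) = i}) with hV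
  have hmeas : ∀ r i, MeasurableSet {ω | π (X r ω) = i} := fun r i =>
    hX.meas r (MeasurableSet.of_discrete (s := {k | π k = i}))
  have hVint : ∀ (g : S → ℝ) r, ∫ ω in A, g (π (X r ω)) ∂P = ∑ i, V r i * g i := by
    intro g r
    have e : ∀ ω, g (π (X r ω)) = ∑ i, {ω | π (X r ω) = i}.indicator (fun _ => g i) ω := by
      intro ω
      simp [Set.indicator_apply]
    simp only [e]
    rw [integral_finsetSum _ fun i _ => (integrable_const _).indicator (hmeas r i)]
    refine Finset.sum_congr rfl fun i _ => ?_
    rw [integral_indicator_const _ (hmeas r i), measureReal_restrict_apply (hmeas r i),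
      Set.inter_comm, smul_eq_mul]
  have hV1 : ∀ i r, V r i = ∫ ω in A, (Pi.single i 1 : S → ℝ) (π (X r ω)) ∂P := by
    intro i r
    rw [hVint]
    simp [Pi.single_apply]
  have hVle : ∀ r i, |V r i| ≤ 1 := fun r i => by
    rw [abs_of_nonneg measureReal_nonneg]; exact measureReal_le_one
  -- The indicator of `i` as test function gives the integrated forward equation for the masses `V`.
  have hVeq : ∀ r, s ≤ r → ∀ i, V r i = V s i + ∫ u in s..r, ∑ k, V u k * Q k i := by
    intro r hr i
    rw [hV1, hV1, (hM _).setIntegral_eq hX hs hr hA]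
    congr 1
    refine intervalIntegral.integral_congr fun u _ => ?_
    simp only [hVint]
    simp
  have hVm : ∀ i, Measurable fun r => V r i := by
    intro i
    simp only [hV1]
    refine (StronglyMeasurable.integral_prod_right (f := fun r ω =>
      (Pi.single i 1 : S → ℝ) (π (X r ω))) ?_).measurable
    exact ((measurable_of_countable fun k => (Pi.single i 1 : S → ℝ) (π k)).comp
      hX.measurable_uncurry).stronglyMeasurable
  have hVi : ∀ i a b, IntervalIntegrable (fun u => ∑ k, V u k * Q k i) volume a b := by
    intro i a b
    have h : ∀ k, IntervalIntegrable (fun u => V u k * Q k i) volume a b := fun k => by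
      refine IntervalIntegrable.mul_const ?_ _
      refine (intervalIntegrable_const (c := (1 : ℝ))).mono_fun (hVm k).aestronglyMeasurable ?_
      exact Eventually.of_forall fun u => by simpa using hVle u k
    simpa only [Finset.sum_fn] using IntervalIntegrable.sum Finset.univ fun k _ => h k
  -- the continuous version of `V`
  set U : ℝ → S → ℝ := fun r i => V s i + ∫ u in s..r, ∑ k, V (max u s) k * Q k i with hU
  have hVc : ∀ i, Continuous fun u => V (max u s) i := by
    intro i
    have e : (fun u => V (max u s) i) =
        fun u => V s i + ∫ v in s..max u s, ∑ k, V v k * Q k i :=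
      funext fun u => hVeq _ (le_max_right _ _) i
    rw [e]
    exact continuous_const.add ((intervalIntegral.continuous_primitive (hVi i) s).comp
      (continuous_id.max continuous_const))
  have hUV : ∀ r, s ≤ r → U r = V r := by
    intro r hr
    ext i
    rw [hVeq r hr]
    refine congrArg (V s i + ·) ?_
    refine intervalIntegral.integral_congr fun u hu => ?_
    rw [Set.uIcc_of_le hr] at hu
    simp only [max_eq_left hu.1]
  have hUd : ∀ r i, HasDerivAt (fun r => U r i) (∑ k, V (max r s) k * Q k i) r := by
    intro r i
    have hcont : Continuous fun u => ∑ k, V (max u s) k * Q k i :=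
      continuous_finsetSum _ fun k _ => (hVc k).mul continuous_const
    exact (hcont.integral_hasStrictDerivAt s r).hasDerivAt.const_add _
  let L : (S → ℝ) →ₗ[ℝ] (S → ℝ) := Matrix.vecMulLinear Q
  have hL : ∀ v i, L v i = ∑ k, v k * Q k i := fun v i => by
    simp [L, Matrix.vecMul, dotProduct]
  -- Both `U` and `V s · e^{(r-s)Q}` solve the linear equation `v' = v Q` with the value `V s` at
  -- `s`.
  have hsol := ODE_solution_unique (v := fun _ v => L v) (a := s) (b := t)
    (K := ‖LinearMap.toContinuousLinearMap L‖₊) (f := U)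
    (g := fun r i => ∑ k, V s k * expMatrix Q (r - s) k i)
    (fun _ => (LinearMap.toContinuousLinearMap L).lipschitz)
    (fun r _ => (hasDerivAt_pi.2 (hUd r)).continuousAt.continuousWithinAt)
    (fun r hr => by
      refine (hasDerivAt_pi.2 fun i => ?_).hasDerivWithinAt
      rw [hL, hUV r hr.1]
      simpa only [max_eq_left hr.1] using hUd r i)
    (by
      refine continuousOn_pi.2 fun i r _ => ContinuousAt.continuousWithinAt ?_
      refine tendsto_finsetSum _ fun k _ => Tendsto.const_mul _ ?_
      exact ((hasDerivAt_expMatrix' Q (r - s) k i).comp_sub_const r s).continuousAt)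
    (fun r _ => by
      refine (hasDerivAt_pi.2 fun i => ?_).hasDerivWithinAt
      have h := HasDerivAt.fun_sum (u := Finset.univ) fun k _ =>
        ((hasDerivAt_expMatrix' Q (r - s) k i).comp_sub_const r s).const_mul (V s k)
      convert! h using 1
      rw [hL]
      simp only [Matrix.mul_apply, Finset.mul_sum, Finset.sum_mul]
      rw [Finset.sum_comm]
      exact Finset.sum_congr rfl fun _ _ => Finset.sum_congr rfl fun _ _ => by ring)
    (by
      ext i
      rw [hUV s le_rfl]
      simp [expMatrix_zero, Matrix.one_apply])
  have := congrFun (hsol ⟨hst, le_rfl⟩) j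
  rwa [hUV t hst] at this

theorem fdd_eq_expMatrix (hX : IsProc X) {Q : Matrix S S ℝ} (π : ℤ → S)
    (hM : ∀ g : S → ℝ, MartPair P X (fun k => g (π k)) (fun k => (Q.mulVec g) (π k)))
    (k : ℕ) (t : Fin (k + 1) → ℝ≥0) (ht : Monotone t) (s : Fin (k + 1) → S) :
    P.real {ω | ∀ i, π (X (t i) ω) = s i} = P.real {ω | π (X (t 0) ω) = s 0} *
      ∏ i : Fin k, expMatrix Q ((t i.succ - t i.castSucc : ℝ≥0) : ℝ) (s i.castSucc) (s i.succ) := by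
  induction k with
  | zero => simp [Fin.forall_fin_one]
  | succ k ih =>
    have ih := ih (fun i => t i.castSucc) (fun i j hij => ht hij) (fun i => s i.castSucc)
    set A := {ω | ∀ i : Fin (k + 1), π (X (t i.castSucc) ω) = s i.castSucc} with hA
    have hAm : MeasurableSet[past X (t (Fin.last k).castSucc)] A := by
      have : A = ⋂ i : Fin (k + 1), {ω | π (X (t i.castSucc) ω) = s i.castSucc} := by
        ext; simp [hA]
      rw [this]
      refine MeasurableSet.iInter fun i => ?_
      refine measurable_past X (t i.castSucc).coe_nonneg ?_
        (MeasurableSet.of_discrete (s := {k | π k = s i.castSucc}))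
      exact_mod_cast ht (Fin.castSucc_le_castSucc_iff.2 (Fin.le_last i))
    have hle : t (Fin.last k).castSucc ≤ t (Fin.last (k + 1)) := ht (Fin.le_last _)
    have e1 : {ω | ∀ i, π (X (t i) ω) = s i} =
        A ∩ {ω | π (X (t (Fin.last (k + 1))) ω) = s (Fin.last (k + 1))} := by
      ext ω
      simp only [hA, Set.mem_ofPred_eq, Set.mem_inter_iff]
      exact Fin.forall_fin_succ'
    rw [e1, measureReal_inter_eq_expMatrix hX π hM (t (Fin.last k).castSucc).coe_nonneg
      (by exact_mod_cast hle) hAm, Finset.sum_eq_single (s (Fin.last k).castSucc)]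
    · have e2 : A ∩ {ω | π (X (t (Fin.last k).castSucc) ω) = s (Fin.last k).castSucc} = A :=
        Set.inter_eq_left.2 fun ω hω => hω (Fin.last k)
      rw [e2, ih, Fin.prod_univ_castSucc, mul_assoc]
      simp only [Fin.castSucc_zero, Fin.succ_castSucc, Fin.succ_last, NNReal.coe_sub hle]
    · intro i _ hi
      have : A ∩ {ω | π (X (t (Fin.last k).castSucc) ω) = i} = ∅ := by
        ext ω
        simp only [Set.mem_inter_iff, Set.mem_empty_iff_false, iff_false, not_and]
        intro hω h
        exact hi (h.symm.trans (hω (Fin.last k)))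
      rw [this, measureReal_empty, zero_mul]
    · simp

end Chain

end

section

/-! ### The finite rate matrix as a restricted generator -/

/-- The index of the point of the grid closest to the lattice point with index `k`. -/
def gridIdx (n : ℕ) (k : ℤ) : Fin (n + 2) := ⟨min k.toNat (n + 1), by omega⟩

theorem gridIdx_natCast {n : ℕ} (i : Fin (n + 2)) : gridIdx n ((i : ℕ) : ℤ) = i := by
  ext; simp only [gridIdx, Int.toNat_natCast]; omega

theorem gridIdx_of_nonpos {n : ℕ} {k : ℤ} (hk : k ≤ 0) : gridIdx n k = 0 := by
  ext; simp only [gridIdx, Fin.val_zero]; omega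

/-- The index of the last grid point that is visited by the free walk as seen from the left. -/
def rightTop (R : RightBC) (n : ℕ) : ℕ :=
  match R with
  | .D => n + 1
  | .N => n

/-- The extension to the lattice of a function on the grid. -/
def gridExt (n : ℕ) (R : RightBC) (g : Fin (n + 2) → ℝ) (k : ℤ) : ℝ :=
  g (gridIdx n (min k (rightTop R n)))

theorem gridExt_of_le {n : ℕ} {R : RightBC} {g : Fin (n + 2) → ℝ} {k : ℤ} (hk : k ≤ rightTop R n) :
    gridExt n R g k = g (gridIdx n k) := by
  rw [gridExt, min_eq_left hk]

theorem gridExt_of_ge {n : ℕ} {R : RightBC} {g : Fin (n + 2) → ℝ} {k : ℤ} (hk : rightTop R n ≤ k) :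
    gridExt n R g k = g (gridIdx n (rightTop R n)) := by
  rw [gridExt, min_eq_right hk]

theorem exists_abs_gridExt_le (n : ℕ) (R : RightBC) (g : Fin (n + 2) → ℝ) :
    ∃ K, ∀ k, |gridExt n R g k| ≤ K :=
  ⟨∑ i, |g i|, fun _ => Finset.single_le_sum (f := fun i => |g i|) (fun _ _ => abs_nonneg _)
    (Finset.mem_univ _)⟩

/-- The mass of the weights `w` that is put into the last but one grid point. -/
def lumpedCorner (R : RightBC) (w : ℕ → ℝ) (n : ℕ) : ℝ :=
  match R with
  | .D => w n
  | .N => -∑ k ∈ Finset.range n, w k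

/-- The mass of the weights `w` that is put into the last grid point. -/
def lumpedEnd (R : RightBC) (w : ℕ → ℝ) (n : ℕ) : ℝ :=
  match R with
  | .D => ∑' k, w (n + 1 + k)
  | .N => 0

/-- The extension of `g` is constant from `rightTop` on, so the tail contributes its total weight
times one value; as the weights sum to zero, this total is minus the head. -/
theorem sum_mul_eq_tsum_of_lumped {n : ℕ} (R : RightBC) {w : ℕ → ℝ} (hw : HasSum w 0)
    {q : Fin (n + 2) → ℝ} (h1 : ∀ j : Fin (n + 2), (j : ℕ) < n → q j = w j)
    (h2 : ∀ j : Fin (n + 2), (j : ℕ) = n → q j = lumpedCorner R w n)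
    (h3 : ∀ j : Fin (n + 2), (j : ℕ) = n + 1 → q j = lumpedEnd R w n)
    (g : Fin (n + 2) → ℝ) : HasSum (fun j : ℕ => w j * gridExt n R g j) (∑ j, q j * g j) := by
  have hg : ∀ j : ℕ, gridExt n R g (j + rightTop R n : ℕ) = g (gridIdx n (rightTop R n)) :=
    fun j => gridExt_of_ge (by push_cast; omega)
  rw [← hasSum_nat_add_iff' (rightTop R n)]
  simp only [hg]
  have ht := ((hasSum_nat_add_iff' (rightTop R n)).2 hw).mul_right (g (gridIdx n (rightTop R n)))
  convert! ht using 1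
  have hr : ∀ j ∈ Finset.range (rightTop R n), w j * gridExt n R g (j : ℕ) =
      w j * g (gridIdx n (j : ℕ)) := fun j hj => by
    rw [gridExt_of_le (by simp at hj; omega)]
  rw [Finset.sum_congr rfl hr, Fin.sum_univ_castSucc, Fin.sum_univ_castSucc]
  have e1 : ∑ i : Fin n, q i.castSucc.castSucc * g i.castSucc.castSucc =
      ∑ j ∈ Finset.range n, w j * g (gridIdx n (j : ℕ)) := by
    rw [← Fin.sum_univ_eq_sum_range (fun j => w j * g (gridIdx n (j : ℕ)))]
    refine Finset.sum_congr rfl fun i _ => ?_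
    rw [h1 _ (by simp)]
    congr 2
    exact (gridIdx_natCast i.castSucc.castSucc).symm
  have e2 : gridIdx n (n : ℕ) = (Fin.last n).castSucc :=
    gridIdx_natCast (n := n) (Fin.last n).castSucc
  have e3 : gridIdx n ((n + 1 : ℕ) : ℤ) = Fin.last (n + 1) :=
    gridIdx_natCast (n := n) (Fin.last (n + 1))
  rw [e1, h2 _ (by simp), h3 _ (by simp)]
  cases R with
  | D =>
    simp only [rightTop, Finset.sum_range_succ, e2, e3, lumpedCorner, lumpedEnd]
    have := hw.summable.sum_add_tsum_nat_add (n + 1)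
    rw [hw.tsum_eq] at this
    simp only [add_comm (n + 1)]
    rw [Finset.sum_range_succ] at this
    have e : ∑' k, w (k + (n + 1)) = -(∑ k ∈ Finset.range n, w k + w n) := by linarith
    rw [e]
    ring
  | N =>
    simp only [rightTop, e2, lumpedCorner, lumpedEnd]
    ring

variable {φ : Measure ℝ} {c : ℕ → ℝ}

theorem coeffInt_natCast (φ : Measure ℝ) (h : ℝ) (m : ℕ) : coeffInt φ h m = coeff φ h m := by
  rw [coeffInt, if_pos (by omega), Int.toNat_natCast]

/-- The weights of the row with index `i`, `1 ≤ i ≤ n`, before lumping. -/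
def rowWeight (φ : Measure ℝ) (h : ℝ) (L : LeftBC) (i j : ℕ) : ℝ :=
  if i = 1 then bLeft φ h L j else coeffInt φ h ((j : ℤ) - i + 1)

theorem dLeft_eq_bLeft_zero (φ : Measure ℝ) (h : ℝ) (L : LeftBC) : dLeft φ h L = bLeft φ h L 0 := by
  cases L <;> simp [dLeft, bLeft]

theorem bLeft_N_succ (φ : Measure ℝ) (h : ℝ) (j : ℕ) :
    bLeft φ h .N (j + 1) = -∑ k ∈ Finset.range (j + 1), coeff φ h k := by
  simp [bLeft]

/-- In the case `N` the weights are minus the partial sums of the coefficients, and these sum to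
zero by centredness. In the case `Nstar` only mass is moved from index `0` to index `1`. -/
theorem hasSum_bLeft {h : ℝ} (hc : IsCenteredSkipFree (coeff φ h)) (L : LeftBC) :
    HasSum (bLeft φ h L) 0 := by
  cases L with
  | D => exact hc.hasSum
  | N =>
    rw [← hasSum_nat_add_iff' 1]
    simp only [bLeft_N_succ]
    have h1 : HasSum (fun j : ℕ => ∑ k ∈ Finset.range (j + 1), coeff φ h k) 0 := by
      refine hc.summable_partial.of_abs.hasSum_iff_tendsto_nat.2 ?_
      simp only [sum_range_sum_range]
      simpa using hc.tendsto_mul_sum_range.sub hc.hasSum_mul.tendsto_sum_nat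
    simpa [bLeft] using h1.neg
  | Nstar =>
    rw [← hasSum_nat_add_iff' 2]
    have := (hasSum_nat_add_iff' 2).2 hc.hasSum
    simpa [bLeft, Finset.sum_range_succ] using this

theorem bLeft_nonneg {h : ℝ} (hc : IsCenteredSkipFree (coeff φ h)) (L : LeftBC) {j : ℕ} (hj : j ≠ 1) :
    0 ≤ bLeft φ h L j := by
  rcases j with _ | _ | j
  · have := hc.zero_pos.le
    cases L <;> simp [bLeft, this]
  · exact absurd rfl hj
  · have h1 := hc.nonneg (j + 2) (by omega)
    have h2 := hc.sum_range_nonpos (j := j + 2) (by omega)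
    cases L
    · exact h1
    · rw [bLeft_N_succ]; linarith
    · simpa [bLeft] using h1

/-- Passes from the column index to the jump index; the columns left of `i - 1` carry no weight by
skip freeness. -/
theorem hasSum_coeffInt_mul {h : ℝ} {i : ℕ} (hi : 1 ≤ i) {F : ℤ → ℝ} {a : ℝ} :
    HasSum (fun j : ℕ => coeffInt φ h ((j : ℤ) - i + 1) * F j) a ↔
      HasSum (fun j : ℕ => coeff φ h j * F (i + j - 1)) a := by
  have hinj : Function.Injective fun j : ℕ => j + (i - 1) := fun a b h => by simpa using h
  rw [← hinj.hasSum_iff]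
  · refine iff_of_eq (congrArg (HasSum · a) (funext fun j => ?_))
    have e1 : (((j + (i - 1) : ℕ) : ℤ) - i + 1) = j := by omega
    have e2 : ((j + (i - 1) : ℕ) : ℤ) = i + j - 1 := by omega
    simp only [Function.comp_apply]
    rw [e1, e2, coeffInt_natCast]
  · intro j hj
    have : ¬ (0 : ℤ) ≤ (j : ℤ) - i + 1 := fun h' => hj ⟨j - (i - 1), by simp only; omega⟩
    rw [coeffInt, if_neg this, zero_mul]

theorem hasSum_rowWeight {h : ℝ} (hc : IsCenteredSkipFree (coeff φ h)) (L : LeftBC) {i : ℕ}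
    (hi : 1 ≤ i) : HasSum (rowWeight φ h L i) 0 := by
  by_cases h1 : i = 1
  · have : rowWeight φ h L i = bLeft φ h L := by ext j; rw [rowWeight, if_pos h1]
    rw [this]; exact hasSum_bLeft hc L
  · have : rowWeight φ h L i =
        fun j : ℕ => coeffInt φ h ((j : ℤ) - i + 1) * (fun _ => (1 : ℝ)) (j : ℤ) := by
      ext j; rw [rowWeight, if_neg h1, mul_one]
    rw [this]
    refine (hasSum_coeffInt_mul (F := fun _ => 1) hi).2 ?_
    simpa using hc.hasSum

theorem rowWeight_nonneg {h : ℝ} (hc : IsCenteredSkipFree (coeff φ h)) (L : LeftBC) {i j : ℕ}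
    (hij : j ≠ i) : 0 ≤ rowWeight φ h L i j := by
  rw [rowWeight]
  split_ifs with h1
  · exact bLeft_nonneg hc L (h1 ▸ hij)
  · rw [coeffInt]
    split_ifs with h2
    · rcases (by omega : ((j : ℤ) - i + 1).toNat = 0 ∨ 2 ≤ ((j : ℤ) - i + 1).toNat) with h3 | h3
      · rw [h3]; exact hc.zero_pos.le
      · exact hc.nonneg _ h3
    · exact le_rfl

theorem gridRates_row_lt (L : LeftBC) (R : RightBC) {n : ℕ} {i : Fin (n + 2)} (h0 : (i : ℕ) ≠ 0)
    (hi : (i : ℕ) ≠ n + 1) {j : Fin (n + 2)} (hj : (j : ℕ) < n) :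
    gridRates φ L R n i j = rowWeight φ (mesh n) L i j := by
  have h1 : (j : ℕ) ≠ n + 1 := by omega
  have h2 : (j : ℕ) ≠ n := by omega
  simp only [gridRates, rowWeight, h0, hi, h1, h2, false_or, if_false]
  split_ifs with h3 h4 h4
  · rw [h4, dLeft_eq_bLeft_zero]
  · rfl
  · rw [coeffInt, if_neg (by omega)]
  · rfl

theorem gridRates_row_eq (L : LeftBC) (R : RightBC) {n : ℕ} (hn : 1 ≤ n) {i : Fin (n + 2)}
    (h0 : (i : ℕ) ≠ 0) (hi : (i : ℕ) ≠ n + 1) {j : Fin (n + 2)} (hj : (j : ℕ) = n) :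
    gridRates φ L R n i j = lumpedCorner R (rowWeight φ (mesh n) L i) n := by
  have h1 : (j : ℕ) ≠ n + 1 := by omega
  have h2 : (j : ℕ) ≠ 0 := by omega
  have hlt := i.2
  simp only [gridRates, h0, hi, h1, h2, false_or, if_false, if_pos hj]
  split_ifs with h3
  · cases R <;> simp [bCorner, lumpedCorner, rowWeight, h3]
  · cases R with
    | D =>
      simp only [bRight, lumpedCorner, rowWeight, if_neg h3]
      rw [← coeffInt_natCast]
      congr 1
      omega
    | N =>
      simp only [bRight, lumpedCorner, rowWeight, if_neg h3]
      -- The first `i - 1` weights of the row vanish, because `coeffInt` is zero at negative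
      -- indices.
      have en : Finset.range n = Finset.range (((i : ℕ) - 1) + (n + 1 - i)) := by
        congr 1; omega
      rw [en, Finset.sum_range_add, Finset.sum_eq_zero (s := Finset.range ((i : ℕ) - 1)), zero_add]
      · congr 1
        refine Finset.sum_congr rfl fun k _ => ?_
        rw [← coeffInt_natCast]
        congr 1
        omega
      · intro k hk
        rw [Finset.mem_range] at hk
        rw [coeffInt, if_neg (by omega)]

theorem gridRates_row_last (L : LeftBC) (R : RightBC) {n : ℕ} (hn : 1 ≤ n) {i : Fin (n + 2)}
    (h0 : (i : ℕ) ≠ 0) (hi : (i : ℕ) ≠ n + 1) {j : Fin (n + 2)} (hj : (j : ℕ) = n + 1) :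
    gridRates φ L R n i j = lumpedEnd R (rowWeight φ (mesh n) L i) n := by
  have h2 : (j : ℕ) ≠ 0 := by omega
  have hlt := i.2
  simp only [gridRates, h0, hi, h2, false_or, if_false, if_pos hj]
  cases R with
  | N => simp [dRight, lumpedEnd]
  | D =>
    simp only [dRight, lumpedEnd, rowWeight]
    by_cases h3 : (i : ℕ) = 1
    · simp only [if_pos h3]
      cases L with
      | N => simp
      | D => simp [bLeft]
      | Nstar =>
        simp only [reduceCtorEq, false_and, if_false]
        refine tsum_congr fun k => ?_
        rw [bLeft, if_neg (by omega), if_neg (by omega)]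
    · rw [if_neg h3, if_neg (by omega)]
      refine tsum_congr fun k => ?_
      rw [if_neg h3, ← coeffInt_natCast]
      congr 1
      omega

/-- The generator of the walk with the left boundary condition. -/
def leftGen (c : ℕ → ℝ) (L : LeftBC) (F : ℤ → ℝ) : ℤ → ℝ :=
  match L with
  | .D => walkGen c F
  | .N => walkGen c (ladderExt c 0 F)
  | .Nstar => fun z => ∑' j : ℕ, c j * F (max (z + j - 1) 1)

theorem leftGen_of_two_le (c : ℕ → ℝ) (L : LeftBC) (F : ℤ → ℝ) {x : ℤ} (hx : 2 ≤ x) :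
    leftGen c L F x = walkGen c F x := by
  cases L
  · rfl
  · exact walkGen_ladderExt_of_two_le _ _ _ hx
  · refine tsum_congr fun j => ?_
    rw [max_eq_left (by omega)]

/-- From `x > n` the walk reaches only points at or above `n`, where the extension is constant. This
is the condition for fast-forwarding at the right. -/
theorem leftGen_gridExt_of_gt (hc : IsCenteredSkipFree c) (L : LeftBC) {n : ℕ} (hn : 1 ≤ n)
    (g : Fin (n + 2) → ℝ) {x : ℤ} (hx : n < x) : leftGen c L (gridExt n .N g) x = 0 := by
  rw [leftGen_of_two_le _ _ _ (by omega), walkGen]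
  have : ∀ j : ℕ, gridExt n .N g (x + j - 1) = g (gridIdx n n) := fun j =>
    gridExt_of_ge (by simp only [rightTop]; omega)
  simp only [this, tsum_mul_right, hc.hasSum.tsum_eq, zero_mul]

/-- Every interior row of the matrix is a lumped row of weights; unlumping it turns the product with
`g` into the generator of the left boundary condition, applied to the extension that encodes the
right one. -/
theorem mulVec_gridRates_eq {n : ℕ} (hn : 1 ≤ n) (hc : IsCenteredSkipFree (coeff φ (mesh n)))
    (L : LeftBC) (R : RightBC) (g : Fin (n + 2) → ℝ) {i : Fin (n + 2)} (h0 : (i : ℕ) ≠ 0)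
    (hi : (i : ℕ) ≠ n + 1) :
    (gridRates φ L R n).mulVec g i = leftGen (coeff φ (mesh n)) L (gridExt n R g) ((i : ℕ) : ℤ) := by
  have hs := sum_mul_eq_tsum_of_lumped R (hasSum_rowWeight hc L (by omega))
    (fun j hj => gridRates_row_lt L R h0 hi hj) (fun j hj => gridRates_row_eq L R hn h0 hi hj)
    (fun j hj => gridRates_row_last L R hn h0 hi hj) g
  obtain ⟨K, hK⟩ := exists_abs_gridExt_le n R g
  have hmv : (gridRates φ L R n).mulVec g i = ∑ j, gridRates φ L R n i j * g j := rfl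
  rw [hmv]
  by_cases h1 : (i : ℕ) = 1
  · have hs' : HasSum (fun j : ℕ => bLeft φ (mesh n) L j * gridExt n R g j)
        (∑ j, gridRates φ L R n i j * g j) := by
      simpa only [rowWeight, h1, if_true] using hs
    rw [← hs'.tsum_eq, h1]
    cases L with
    | D =>
      refine tsum_congr fun j => ?_
      simp [bLeft]
    | N =>
      simp only [leftGen, Nat.cast_one]
      rw [hc.walkGen_ladderExt_one hK, hs'.summable.tsum_eq_zero_add]
      simp only [bLeft_N_succ, neg_mul, tsum_neg]
      simp [bLeft, add_comm]
    | Nstar =>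
      have hs2 : Summable fun j : ℕ =>
          coeff φ (mesh n) j * gridExt n R g (max (((1 : ℕ) : ℤ) + j - 1) 1) :=
        hc.summable_mul fun j => hK _
      simp only [leftGen]
      rw [← hs2.sum_add_tsum_nat_add 2, ← hs'.summable.sum_add_tsum_nat_add 2]
      congr 1
      · simp [Finset.sum_range_succ, bLeft]
        ring
      · refine tsum_congr fun j => ?_
        have : max (((1 : ℕ) : ℤ) + ((j + 2 : ℕ) : ℤ) - 1) 1 = ((j + 2 : ℕ) : ℤ) := by omega
        rw [this]
        simp [bLeft]
  · have hs' : HasSum (fun j : ℕ => coeffInt φ (mesh n) ((j : ℤ) - (i : ℕ) + 1) * gridExt n R g j)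
        (∑ j, gridRates φ L R n i j * g j) := by
      simpa only [rowWeight, h1, if_false] using hs
    rw [leftGen_of_two_le _ _ _ (by omega)]
    exact (((hasSum_coeffInt_mul (by omega)).1 hs').tsum_eq).symm

theorem gridRates_row_sum {n : ℕ} (hn : 1 ≤ n) (hc : IsCenteredSkipFree (coeff φ (mesh n)))
    (L : LeftBC) (R : RightBC) (i : Fin (n + 2)) : ∑ j, gridRates φ L R n i j = 0 := by
  by_cases h : (i : ℕ) = 0 ∨ (i : ℕ) = n + 1
  · simp only [gridRates, if_pos h, Finset.sum_const_zero]
  · push Not at h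
    have hs := sum_mul_eq_tsum_of_lumped R (hasSum_rowWeight hc L (by omega))
      (fun j hj => gridRates_row_lt L R h.1 h.2 hj)
      (fun j hj => gridRates_row_eq L R hn h.1 h.2 hj)
      (fun j hj => gridRates_row_last L R hn h.1 h.2 hj) 1
    simp only [gridExt, Pi.one_apply, mul_one] at hs
    exact hs.unique (hasSum_rowWeight hc L (by omega))

theorem gridRates_nonneg {n : ℕ} (hn : 1 ≤ n) (hc : IsCenteredSkipFree (coeff φ (mesh n)))
    (L : LeftBC) (R : RightBC) (i j : Fin (n + 2)) (hij : i ≠ j) : 0 ≤ gridRates φ L R n i j := by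
  have hij' : (j : ℕ) ≠ i := fun h => hij (Fin.ext h.symm)
  by_cases h : (i : ℕ) = 0 ∨ (i : ℕ) = n + 1
  · simp only [gridRates, if_pos h, le_refl]
  · push Not at h
    have hlt := i.2
    rcases lt_trichotomy (j : ℕ) n with hj | hj | hj
    · rw [gridRates_row_lt L R h.1 h.2 hj]
      exact rowWeight_nonneg hc L hij'
    · rw [gridRates_row_eq L R hn h.1 h.2 hj]
      cases R with
      | D => exact rowWeight_nonneg hc L (by omega)
      | N =>
        -- The corner entry is a tail sum of the row, and all its indices lie to the right of the
        -- diagonal.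
        have h1 := (hasSum_nat_add_iff' n).2 (hasSum_rowWeight hc L (i := i) (by omega))
        rw [zero_sub] at h1
        exact h1.nonneg fun k => rowWeight_nonneg hc L (by omega)
    · rw [gridRates_row_last L R hn h.1 h.2 (by omega)]
      cases R with
      | D => exact tsum_nonneg fun k => rowWeight_nonneg hc L (by omega)
      | N => exact le_rfl

end

section

/-! ### The processes with boundary conditions on the integers -/

/-- The path map of the boundary conditions for paths in the integers. -/
def intModify (L : LeftBC) (R : RightBC) (n : ℕ) (x : ℝ → ℤ) : ℝ → ℤ :=
  match L, R with
  | .D, .D => killPath (Set.Iic n) (n + 1) (killPath (Set.Ici 1) 0 x)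
  | .D, .N => killPath (Set.Ici 1) 0 (ffPath (Set.Iic n) x)
  | .N, .D => killPath (Set.Iic n) (n + 1) (ffPath (Set.Ici 1) x)
  | .N, .N => ffPath (Set.Iic n) (ffPath (Set.Ici 1) x)
  | .Nstar, .D => killPath (Set.Iic n) (n + 1) (reflPath x)
  | .Nstar, .N => ffPath (Set.Iic n) (reflPath x)

/-- The paths that may be fast-forwarded as required by the boundary conditions. -/
def IntDomain (L : LeftBC) (R : RightBC) (n : ℕ) (x : ℝ → ℤ) : Prop :=
  match L, R with
  | .D, .D => True
  | .D, .N => OccInfinite (Set.Iic n) x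
  | .N, .D => OccInfinite (Set.Ici 1) x
  | .N, .N => OccInfinite (Set.Ici 1) x ∧ OccInfinite (Set.Iic n) (ffPath (Set.Ici 1) x)
  | .Nstar, .D => True
  | .Nstar, .N => OccInfinite (Set.Iic n) (reflPath x)

variable {Ω : Type*} [MeasurableSpace Ω] {P : Measure Ω} [IsProbabilityMeasure P]
  {X : ℝ → Ω → ℤ} {c : ℕ → ℝ} {n : ℕ}

theorem regPath_const (k : ℤ) : RegPath fun _ => k :=
  ⟨fun _ => Eventually.of_forall fun _ => rfl, fun _ => ⟨k, Eventually.of_forall fun _ => rfl⟩⟩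

theorem occInfinite_const {B : Set ℤ} {k : ℤ} (hk : k ∈ B) : OccInfinite B fun _ => k := by
  intro T
  refine ⟨max T 0 + 1, ?_⟩
  simp only [occTime, Set.indicator_of_mem hk, Pi.one_apply, intervalIntegral.integral_const,
    sub_zero, smul_eq_mul, mul_one]
  linarith [le_max_left T 0]

/-- The path maps require their domain conditions for every path. On a null set the path is
therefore replaced by a constant one that satisfies `p`; the last clause transfers pointwise bounds
to the new process. -/
theorem IsProc.exists_modification {P : Measure Ω} (hX : IsProc X) (k : ℤ) {p : (ℝ → ℤ) → Prop}
    (hk : p fun _ => k) (h : ∀ᵐ ω ∂P, p fun t => X t ω) :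
    ∃ X' : ℝ → Ω → ℤ, IsProc X' ∧ (∀ ω, p fun t => X' t ω) ∧ (∀ᵐ ω ∂P, ∀ t, X' t ω = X t ω) ∧
      ∀ ω, (∀ t, X' t ω = X t ω) ∨ ∀ t, X' t ω = k := by
  classical
  set N := toMeasurable P {ω | ¬ p fun t => X t ω} with hN
  have hN0 : P N = 0 := by rw [hN, measure_toMeasurable]; exact h
  have hNm : MeasurableSet N := measurableSet_toMeasurable _ _
  have h1 : ∀ ω, ω ∈ N → (fun t => if ω ∈ N then k else X t ω) = fun _ => k := fun ω hω => by
    ext t; rw [if_pos hω]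
  have h2 : ∀ ω, ω ∉ N → (fun t => if ω ∈ N then k else X t ω) = fun t => X t ω := fun ω hω => by
    ext t; rw [if_neg hω]
  refine ⟨fun t ω => if ω ∈ N then k else X t ω, ⟨fun t => ?_, fun ω => ?_⟩, fun ω => ?_, ?_,
    fun ω => ?_⟩
  · exact Measurable.ite hNm measurable_const (hX.meas t)
  · by_cases hω : ω ∈ N
    · rw [h1 ω hω]; exact regPath_const k
    · rw [h2 ω hω]; exact hX.reg ω
  · by_cases hω : ω ∈ N
    · rw [h1 ω hω]; exact hk
    · rw [h2 ω hω]
      by_contra hp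
      exact hω (subset_toMeasurable _ _ hp)
  · have : ∀ᵐ ω ∂P, ω ∉ N := measure_eq_zero_iff_ae_notMem.1 hN0
    filter_upwards [this] with ω hω t
    exact congrFun (h2 ω hω) t
  · by_cases hω : ω ∈ N
    · exact Or.inr (congrFun (h1 ω hω))
    · exact Or.inl (congrFun (h2 ω hω))

theorem gridIdx_val {k : ℤ} (h0 : 0 ≤ k) (h1 : k ≤ n + 1) : (((gridIdx n k : Fin (n + 2)) : ℕ) : ℤ) = k := by
  simp only [gridIdx]; omega

/-- The martingale problem for the grid rates, from its interior and boundary parts. -/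
theorem MartPair.to_gridRates {P : Measure Ω} {φ : Measure ℝ} (hn : 1 ≤ n)
    (hc : IsCenteredSkipFree (coeff φ (mesh n))) {L : LeftBC} {R : RightBC} {Z : ℝ → Ω → ℤ}
    (hZ : ∀ t ω, 0 ≤ Z t ω ∧ Z t ω ≤ n + 1) {g : Fin (n + 2) → ℝ} {F h : ℤ → ℝ}
    (hM : MartPair P Z F h) (hF : ∀ t ω, F (Z t ω) = g (gridIdx n (Z t ω)))
    (hh : ∀ t ω, 1 ≤ Z t ω → Z t ω ≤ n →
      h (Z t ω) = leftGen (coeff φ (mesh n)) L (gridExt n R g) (Z t ω))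
    (hh0 : ∀ t ω, Z t ω < 1 ∨ n < Z t ω → h (Z t ω) = 0) :
    MartPair P Z (fun k => g (gridIdx n k))
      (fun k => ((gridRates φ L R n).mulVec g) (gridIdx n k)) := by
  have hb : ∀ f : Fin (n + 2) → ℝ, ∃ K, ∀ k, |f (gridIdx n k)| ≤ K := fun f =>
    ⟨∑ i, |f i|, fun _ => Finset.single_le_sum (f := fun i => |f i|) (fun _ _ => abs_nonneg _)
      (Finset.mem_univ _)⟩
  refine hM.congr_fun (hb g) (hb _) (fun t ω => (hF t ω).symm) fun t ω => ?_
  have hv := gridIdx_val (n := n) (hZ t ω).1 (hZ t ω).2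
  by_cases hk : 1 ≤ Z t ω ∧ Z t ω ≤ n
  · rw [hh t ω hk.1 hk.2, mulVec_gridRates_eq hn hc L R g (by omega) (by omega), hv]
  · rw [hh0 t ω (by omega)]
    have hz := hZ t ω
    have h' : (gridIdx n (Z t ω) : ℕ) = 0 ∨ (gridIdx n (Z t ω) : ℕ) = n + 1 := by omega
    simp only [Matrix.mulVec, dotProduct, gridRates, if_pos h', zero_mul, Finset.sum_const_zero]

theorem killPath_Iic_mem {a : ℤ} (ha : a ≤ n + 1) {x : ℝ → ℤ} (hx : ∀ t, a ≤ x t) (t : ℝ) :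
    a ≤ killPath (Set.Iic (n : ℤ)) (n + 1) x t ∧ killPath (Set.Iic (n : ℤ)) (n + 1) x t ≤ n + 1 := by
  rcases killPath_eq_or (Set.Iic (n : ℤ)) (n + 1) x t with h | ⟨h1, h2⟩
  · rw [h]; exact ⟨ha, le_rfl⟩
  · have h1 : killPath (Set.Iic (n : ℤ)) (n + 1) x t ≤ n := h1
    have := hx (max t 0)
    omega

theorem gridExt_D {g : Fin (n + 2) → ℝ} (k : ℤ) :
    gridExt n .D g k = g (gridIdx n k) := by
  rw [gridExt]
  congr 1
  ext
  simp only [gridIdx, rightTop]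
  omega

/-- For `R = D` the extension is constant from `n + 1` on, which is what killing at the exit from
`(-∞, n]` requires. -/
theorem martPair_killRight {φ : Measure ℝ} (hn : 1 ≤ n)
    (hc : IsCenteredSkipFree (coeff φ (mesh n))) {L : LeftBC} {W : ℝ → Ω → ℤ} (hW : IsProc W)
    (hW1 : ∀ t ω, 1 ≤ W t ω)
    (hM : ∀ F : ℤ → ℝ, (∃ K, ∀ k, |F k| ≤ K) → MartPair P W F (leftGen (coeff φ (mesh n)) L F))
    (g : Fin (n + 2) → ℝ) :
    MartPair P (fun t ω => killPath (Set.Iic (n : ℤ)) (n + 1) (fun t => W t ω) t)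
      (fun k => g (gridIdx n k))
      (fun k => ((gridRates φ L .D n).mulVec g) (gridIdx n k)) := by
  have hr : ∀ t ω, 1 ≤ killPath (Set.Iic (n : ℤ)) (n + 1) (fun t => W t ω) t ∧
      killPath (Set.Iic (n : ℤ)) (n + 1) (fun t => W t ω) t ≤ n + 1 :=
    fun t ω => killPath_Iic_mem (by omega) (fun t => hW1 t ω) t
  refine MartPair.to_gridRates (R := .D) hn hc (fun t ω => ⟨by linarith [(hr t ω).1], (hr t ω).2⟩)
    ((hM _ (exists_abs_gridExt_le n .D g)).killPath hW (Set.Iic (n : ℤ)) (c := n + 1)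
      (by simp) fun k hk => ?_) (fun t ω => gridExt_D _) (fun t ω _ h2 => ?_) fun t ω h => ?_
  · have hk : (n : ℤ) < k := not_le.1 hk
    rw [gridExt_of_ge (by simp only [rightTop]; omega), gridExt_of_ge (by simp [rightTop])]
  · exact Set.indicator_of_mem (by exact h2) _
  · refine Set.indicator_of_notMem ?_ _
    have := (hr t ω).1
    simp only [Set.mem_Iic, not_le]
    omega

/-- For `R = N` the extension is already constant from `n` on, so its compensator vanishes above
`n`, as fast-forwarding requires. -/
theorem martPair_ffRight {φ : Measure ℝ} (hn : 1 ≤ n)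
    (hc : IsCenteredSkipFree (coeff φ (mesh n))) {L : LeftBC} {W : ℝ → Ω → ℤ} (hW : IsProc W)
    (hW1 : ∀ t ω, 1 ≤ W t ω) (hW2 : ∀ ω, OccInfinite (Set.Iic (n : ℤ)) fun t => W t ω)
    (hM : ∀ F : ℤ → ℝ, (∃ K, ∀ k, |F k| ≤ K) → MartPair P W F (leftGen (coeff φ (mesh n)) L F))
    (g : Fin (n + 2) → ℝ) :
    MartPair P (fun t ω => ffPath (Set.Iic (n : ℤ)) (fun t => W t ω) t)
      (fun k => g (gridIdx n k))
      (fun k => ((gridRates φ L .N n).mulVec g) (gridIdx n k)) := by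
  have h1 : ∀ t ω, 1 ≤ ffPath (Set.Iic (n : ℤ)) (fun t => W t ω) t := fun t ω => hW1 _ ω
  have h2 : ∀ t ω, ffPath (Set.Iic (n : ℤ)) (fun t => W t ω) t ≤ n := fun t ω =>
    (hW.reg ω).ffPath_mem (hW2 ω) t
  refine MartPair.to_gridRates (R := .N) hn hc
    (fun t ω => ⟨by linarith [h1 t ω], by linarith [h2 t ω]⟩)
    ((hM _ (exists_abs_gridExt_le n .N g)).ffPath hW hW2 fun k hk =>
      leftGen_gridExt_of_gt hc L hn g (not_le.1 hk)) (fun t ω => gridExt_of_le (h2 t ω))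
    (fun t ω _ _ => rfl) fun t ω h => ?_
  have := h1 t ω
  have := h2 t ω
  omega

/-- The free process with one of the two left boundary conditions that are not killing. -/
theorem exists_leftProcess (hn : 1 ≤ n) (hc : IsCenteredSkipFree c) (hX : IsProc X)
    {p : ℝ≥0 → ℤ → ℤ → ℝ} (hT : HasTransition P X p) (hp : IsTransitionFunction (walkRates c) p)
    {L : LeftBC} (hL : L ≠ .D) :
    ∃ W : ℝ → Ω → ℤ, IsProc W ∧ (∀ t ω, 1 ≤ W t ω) ∧
      (∀ F : ℤ → ℝ, (∃ K, ∀ k, |F k| ≤ K) → MartPair P W F (leftGen c L F)) ∧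
      (∀ᵐ ω ∂P, OccInfinite (Set.Iic (n : ℤ)) fun t => W t ω) ∧
      ∀ᵐ ω ∂P, (L = .N → OccInfinite (Set.Ici 1) fun t => X t ω) ∧
        (fun t => W t ω) = match L with
          | .D => fun t => X t ω
          | .N => ffPath (Set.Ici 1) fun t => X t ω
          | .Nstar => reflPath fun t => X t ω := by
  have hXM := fun F hF => hT.martPair (F := F) hX hp hc hF
  have hn' : (1 : ℤ) ≤ n := by exact_mod_cast hn
  cases L with
  | D => exact absurd rfl hL
  | N =>
    have hrec := hc.ae_occInfinite_Ici hX fun N => hXM _ ⟨1, hc.abs_leftLyapTrunc_le N⟩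
    obtain ⟨X', hX', hocc, hae, -⟩ := hX.exists_modification (P := P) 1
      (p := OccInfinite (Set.Ici 1)) (occInfinite_const (by simp)) hrec
    have hlad : ∀ {F : ℤ → ℝ} {K : ℝ}, (∀ k, |F k| ≤ K) → ∀ k, |ladderExt c 0 F k| ≤ K :=
      fun hF k => abs_le.2 (hc.ladderExt_mem_Icc (fun x _ => abs_le.1 (hF x)) k)
    have hM : ∀ F : ℤ → ℝ, (∃ K, ∀ k, |F k| ≤ K) →
        MartPair P (fun t ω => ffPath (Set.Ici 1) (fun t => X' t ω) t) (ladderExt c 0 F)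
          (walkGen c (ladderExt c 0 F)) := by
      rintro F ⟨K, hK⟩
      -- Harmonicity on the nonpositive integers makes the compensator vanish off the set where the
      -- path is run.
      refine ((hXM (ladderExt c 0 F) ⟨K, hlad hK⟩).congr_proc hX' hae).ffPath hX' hocc fun k hk =>
        hc.walkGen_ladderExt_nonpos hK (by simp at hk; omega)
    have h1 : ∀ t ω, 1 ≤ ffPath (Set.Ici 1) (fun t => X' t ω) t := fun t ω =>
      (hX'.reg ω).ffPath_mem (hocc ω) t
    have hW := hX'.ffPath hocc
    refine ⟨fun t ω => ffPath (Set.Ici 1) (fun t => X' t ω) t, hW, h1, fun F hF => ?_,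
      hc.ae_occInfinite_ladder hW hn' (h1 0) fun N => hM _ ⟨1, abs_rightLyap_le n N⟩, ?_⟩
    -- The fast-forwarded walk stays at or above `1`, where `ladderExt c 0 F` coincides with `F`.
    · exact (hM F hF).congr_fun hF (hM F hF).bdd_right
        (fun t ω => (ladderExt_of_pos _ _ _ (h1 t ω)).symm) fun _ _ => rfl
    · filter_upwards [hae, hrec] with ω h1 h2
      refine ⟨fun _ => h2, ?_⟩
      have : (fun t => X' t ω) = fun t => X t ω := funext h1
      simp only [this]
  | Nstar =>
    have hM := fun F hF => hT.martPair_reflPath (g := F) hX hp hc hF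
    refine ⟨_, hX.reflPath, fun t ω => (hX.reg ω).reflPath_pos t, hM,
      hc.ae_occInfinite_reflected hX.reflPath hn' fun N => hM _ ⟨1, abs_rightLyap_le n N⟩,
      Eventually.of_forall fun ω => ⟨fun h => by simp at h, rfl⟩⟩

/-- The process with boundary conditions is, up to a null set, a solution of the martingale problem
for the grid rates. -/
theorem exists_boundaryProcess {φ : Measure ℝ} (hn : 1 ≤ n)
    (hc : IsCenteredSkipFree (coeff φ (mesh n))) (hX : IsProc X) {p : ℝ≥0 → ℤ → ℤ → ℝ}
    (hT : HasTransition P X p) (hp : IsTransitionFunction (walkRates (coeff φ (mesh n))) p)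
    (L : LeftBC) (R : RightBC) :
    ∃ Z : ℝ → Ω → ℤ, IsProc Z ∧ (∀ t ω, 0 ≤ Z t ω ∧ Z t ω ≤ n + 1) ∧
      (∀ g : Fin (n + 2) → ℝ, MartPair P Z (fun k => g (gridIdx n k))
        (fun k => ((gridRates φ L R n).mulVec g) (gridIdx n k))) ∧
      ∀ᵐ ω ∂P, IntDomain L R n (fun t => X t ω) ∧
        (fun t => Z t ω) = intModify L R n fun t => X t ω := by
  have hXM := fun F hF => hT.martPair (F := F) hX hp hc hF
  have hkill0 : ∀ (x : ℝ → ℤ) t, 0 ≤ killPath (Set.Ici 1) 0 x t := fun x t => by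
    rcases killPath_eq_or (Set.Ici 1) 0 x t with h | ⟨h, -⟩
    · exact h.ge
    · have h : 1 ≤ killPath (Set.Ici 1) 0 x t := h
      omega
  have hleft : ∀ (R : RightBC) (g : Fin (n + 2) → ℝ) (k : ℤ), k ∉ Set.Ici (1 : ℤ) →
      gridExt n R g k = gridExt n R g 0 := by
    intro R g k hk
    simp only [Set.mem_Ici, not_le] at hk
    rw [gridExt_of_le (by omega), gridExt_of_le (by omega), gridIdx_of_nonpos (by omega),
      gridIdx_of_nonpos le_rfl]
  by_cases hL : L = .D
  · subst hL
    cases R with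
    | D =>
      have hX1 := hX.killPath (Set.Ici 1) 0
      have hr : ∀ t ω, 0 ≤ killPath (Set.Iic (n : ℤ)) (n + 1)
            (killPath (Set.Ici 1) 0 fun t => X t ω) t ∧
          killPath (Set.Iic (n : ℤ)) (n + 1) (killPath (Set.Ici 1) 0 fun t => X t ω) t ≤ n + 1 :=
        fun t ω => killPath_Iic_mem (by omega) (hkill0 _) t
      refine ⟨_, hX1.killPath (Set.Iic (n : ℤ)) (n + 1), hr, fun g => ?_,
        Eventually.of_forall fun ω => ⟨trivial, rfl⟩⟩
      -- The extension is constant on the nonpositive integers and from `n + 1` on, so it is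
      -- admissible for both killings.
      have hM1 := (hXM _ (exists_abs_gridExt_le n .D g)).killPath hX (Set.Ici 1) (c := 0) (by simp)
        (hleft .D g)
      have hM2 := hM1.killPath hX1 (Set.Iic (n : ℤ)) (c := n + 1) (by simp) fun k hk => by
        have hk : (n : ℤ) < k := not_le.1 hk
        rw [gridExt_of_ge (by simp only [rightTop]; omega), gridExt_of_ge (by simp [rightTop])]
      refine MartPair.to_gridRates (L := .D) (R := .D) hn hc hr hM2
        (fun t ω => gridExt_D _) (fun t ω h1 h2 => ?_) fun t ω h => ?_
      · rw [Set.indicator_of_mem (by exact h2), Set.indicator_of_mem (by exact h1)]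
        rfl
      · rcases h with h | h
        · rw [Set.indicator_apply]
          split_ifs
          · exact Set.indicator_of_notMem (by simpa using h) _
          · rfl
        · exact Set.indicator_of_notMem (by simpa using h) _
    | N =>
      have hrec := hc.ae_occInfinite_Iic (n := n) hX fun N => hXM _ ⟨1, abs_rightLyap_le n N⟩
      obtain ⟨X', hX', hocc, hae, -⟩ := hX.exists_modification (P := P) 1
        (p := OccInfinite (Set.Iic (n : ℤ))) (occInfinite_const (by simpa using hn)) hrec
      have hX1 := hX'.ffPath hocc
      have hr : ∀ t ω, 0 ≤ killPath (Set.Ici 1) 0 (ffPath (Set.Iic (n : ℤ)) fun t => X' t ω) t ∧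
          killPath (Set.Ici 1) 0 (ffPath (Set.Iic (n : ℤ)) fun t => X' t ω) t ≤ n := fun t ω => by
        refine ⟨hkill0 _ t, ?_⟩
        rcases killPath_eq_or (Set.Ici 1) 0 (ffPath (Set.Iic (n : ℤ)) fun t => X' t ω) t
          with h | ⟨-, h⟩
        · rw [h]; omega
        · rw [h]; exact (hX'.reg ω).ffPath_mem (hocc ω) _
      refine ⟨_, hX1.killPath (Set.Ici 1) 0,
        fun t ω => ⟨(hr t ω).1, (hr t ω).2.trans (by omega)⟩, fun g => ?_, ?_⟩
      -- One extension serves both operations: it is constant from `n` on for fast-forwarding, and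
      -- constant on the nonpositive integers for the subsequent killing.
      · have hM1 := ((hXM _ (exists_abs_gridExt_le n .N g)).congr_proc hX' hae).ffPath hX' hocc
          fun k hk => leftGen_gridExt_of_gt hc .D hn g (not_le.1 hk)
        have hM2 := hM1.killPath hX1 (Set.Ici 1) (c := 0) (by simp) (hleft .N g)
        refine MartPair.to_gridRates (L := .D) (R := .N) hn hc
          (fun t ω => ⟨(hr t ω).1, (hr t ω).2.trans (by omega)⟩) hM2
          (fun t ω => gridExt_of_le (hr t ω).2) (fun t ω h1 h2 => ?_) fun t ω h => ?_
        · rw [Set.indicator_of_mem (by exact h1)]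
          rfl
        · rcases h with h | h
          · exact Set.indicator_of_notMem (by simpa using h) _
          · exact absurd (hr t ω).2 (not_le.2 h)
      · filter_upwards [hae, hrec] with ω h1 h2
        refine ⟨h2, ?_⟩
        have : (fun t => X' t ω) = fun t => X t ω := funext h1
        simp only [this]
        rfl
  · obtain ⟨W, hW, hW1, hM, hrec, hae⟩ := exists_leftProcess hn hc hX hT hp hL
    cases R with
    | D =>
      refine ⟨_, hW.killPath (Set.Iic (n : ℤ)) (n + 1), fun t ω => ?_,
        martPair_killRight hn hc hW hW1 hM, ?_⟩
      · exact killPath_Iic_mem (by omega) (fun t => by linarith [hW1 t ω]) t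
      · filter_upwards [hae] with ω h1
        rw [h1.2]
        cases L with
        | D => exact absurd rfl hL
        | N => exact ⟨h1.1 rfl, rfl⟩
        | Nstar => exact ⟨trivial, rfl⟩
    | N =>
      obtain ⟨W', hW', hocc, hae', hor⟩ := hW.exists_modification (P := P) 1
        (p := OccInfinite (Set.Iic (n : ℤ))) (occInfinite_const (by simpa using hn)) hrec
      have hW1' : ∀ t ω, 1 ≤ W' t ω := fun t ω => by
        rcases hor ω with h | h
        · rw [h t]; exact hW1 t ω
        · rw [h t]
      refine ⟨_, hW'.ffPath hocc, fun t ω => ?_,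
        martPair_ffRight hn hc hW' hW1' hocc fun F hF => (hM F hF).congr_proc hW' hae', ?_⟩
      · have h1 : 1 ≤ ffPath (Set.Iic (n : ℤ)) (fun t => W' t ω) t := hW1' _ ω
        have h2 : ffPath (Set.Iic (n : ℤ)) (fun t => W' t ω) t ≤ n :=
          (hW'.reg ω).ffPath_mem (hocc ω) t
        omega
      · filter_upwards [hae, hae', hrec] with ω h1 h2 h3
        have : (fun t => W' t ω) = fun t => W t ω := funext h2
        simp only [this]
        rw [h1.2] at h3 ⊢
        cases L with
        | D => exact absurd rfl hL
        | N => exact ⟨⟨h1.1 rfl, h3⟩, rfl⟩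
        | Nstar => exact ⟨h3, rfl⟩

end

section

/-! ### Paths in the lattice and paths in the integers -/

theorem mesh_pos (n : ℕ) : 0 < mesh n := by rw [mesh]; positivity

theorem mesh_mul (n : ℕ) : mesh n * ((n : ℝ) + 1) = 2 := by
  rw [mesh]; exact div_mul_cancel₀ _ (by positivity)

theorem latticePoint_lt_iff (n : ℕ) (k m : ℤ) : latticePoint n k < latticePoint n m ↔ k < m := by
  rw [latticePoint, latticePoint, add_lt_add_iff_left, mul_lt_mul_iff_right₀ (mesh_pos n)]
  exact Int.cast_lt

theorem latticePoint_injective (n : ℕ) : Function.Injective (latticePoint n) :=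
  StrictMono.injective fun k m h => (latticePoint_lt_iff n k m).2 h

theorem latticePoint_zero (n : ℕ) : latticePoint n 0 = -1 := by simp [latticePoint]

theorem latticePoint_last (n : ℕ) : latticePoint n (n + 1) = 1 := by
  rw [latticePoint]; push_cast; rw [mesh_mul]; norm_num

theorem latticePoint_mem_Ioi (n : ℕ) (k : ℤ) :
    latticePoint n k ∈ Set.Ioi (-1) ↔ k ∈ Set.Ici (1 : ℤ) := by
  rw [Set.mem_Ioi, ← latticePoint_zero n, latticePoint_lt_iff]; exact Iff.rfl

theorem latticePoint_mem_Iio (n : ℕ) (k : ℤ) :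
    latticePoint n k ∈ Set.Iio 1 ↔ k ∈ Set.Iic (n : ℤ) := by
  rw [Set.mem_Iio, ← latticePoint_last n, latticePoint_lt_iff, Set.mem_Iic, Int.lt_add_one_iff]

theorem gridPoint_eq (n : ℕ) (i : Fin (n + 2)) : gridPoint n i = latticePoint n ((i : ℕ) : ℤ) := by
  rw [gridPoint, latticePoint, Int.cast_natCast]

/-- The index of the lattice point closest to `v`. -/
def latticeIdx (n : ℕ) (v : ℝ) : ℤ := ⌊(v + 1) / mesh n + 1 / 2⌋

theorem latticeIdx_latticePoint (n : ℕ) (k : ℤ) : latticeIdx n (latticePoint n k) = k := by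
  have : (latticePoint n k + 1) / mesh n = k := by
    rw [latticePoint, div_eq_iff (mesh_pos n).ne']; ring
  rw [latticeIdx, this, Int.floor_eq_iff]
  constructor <;> linarith

theorem measurable_latticeIdx (n : ℕ) : Measurable (latticeIdx n) := by
  unfold latticeIdx; fun_prop

variable {x : ℝ → ℤ} {B : Set ℝ} {C : Set ℤ} {n : ℕ}

/-- The exit time ranges over `s > 0`, the right side includes `s = 0`. Right continuity makes no
difference between them: a path outside at `s` is still outside shortly afterwards. It also gives
the strict inequality, since a path in `C` at `t` remains there for a while. -/
theorem lt_exitTime_iff (hx : RegPath x) (hBC : ∀ k, latticePoint n k ∈ B ↔ k ∈ C) (t : ℝ≥0) :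
    (t : ℝ≥0∞) < exitTime B (fun s : ℝ≥0 => latticePoint n (x s)) ↔
      ∀ s ∈ Set.Icc (0 : ℝ) t, x s ∈ C := by
  have hle : ∀ u : ℝ≥0, 0 < u → x u ∉ C →
      exitTime B (fun s : ℝ≥0 => latticePoint n (x s)) ≤ u := fun u h0 hu =>
    iInf₂_le (f := fun (s : ℝ≥0) (_ : 0 < s ∧ latticePoint n (x s) ∉ B) => (s : ℝ≥0∞)) u
      ⟨h0, fun h => hu ((hBC _).1 h)⟩
  constructor
  · intro h s hs
    by_contra hsC
    obtain ⟨r, hr1, hr2⟩ := ENNReal.lt_iff_exists_nnreal_btwn.1 h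
    obtain ⟨b, hb, hb'⟩ := mem_nhdsGT_iff_exists_Ioo_subset.1 (hx.rc s)
    have hb : s < b := hb
    have hsr : s < r := hs.2.trans_lt (by exact_mod_cast hr1)
    obtain ⟨u, hu1, hu2⟩ := exists_between (lt_min hb hsr)
    have hu0 : 0 < u := hs.1.trans_lt hu1
    have hxu : x u = x s := hb' ⟨hu1, hu2.trans_le (min_le_left _ _)⟩
    lift u to ℝ≥0 using hu0.le
    have h1 := hle u (by exact_mod_cast hu0) (by rw [hxu]; exact hsC)
    have h2 : u < r := by exact_mod_cast hu2.trans_le (min_le_right _ _)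
    exact absurd ((ENNReal.coe_lt_coe.2 h2).trans hr2) (not_lt.2 h1)
  · intro h
    obtain ⟨b, hb, hb'⟩ := mem_nhdsGT_iff_exists_Ioo_subset.1 (hx.rc t)
    have hb : (t : ℝ) < b := hb
    have hb0 : 0 ≤ b := t.coe_nonneg.trans hb.le
    lift b to ℝ≥0 using hb0
    have h1 : (b : ℝ≥0∞) ≤ exitTime B (fun s : ℝ≥0 => latticePoint n (x s)) := by
      refine le_iInf₂ fun s hs => ?_
      by_contra! hc
      have hc : (s : ℝ) < b := by exact_mod_cast hc
      refine hs.2 ((hBC _).2 ?_)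
      rcases le_or_gt (s : ℝ) t with h' | h'
      · exact h s ⟨s.coe_nonneg, h'⟩
      · have : x s = x t := hb' ⟨h', hc⟩
        rw [this]
        exact h t ⟨t.coe_nonneg, le_rfl⟩
    refine lt_of_lt_of_le (ENNReal.coe_lt_coe.2 ?_) h1
    exact_mod_cast hb

theorem killLeft_latticePoint (hx : RegPath x) :
    killLeft (fun s : ℝ≥0 => latticePoint n (x s)) =
      fun t : ℝ≥0 => latticePoint n (killPath (Set.Ici 1) 0 x t) := by
  classical
  ext t
  rw [killLeft, killPath, max_eq_left t.coe_nonneg]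
  simp only [lt_exitTime_iff hx (latticePoint_mem_Ioi n)]
  by_cases h : ∃ s ∈ Set.Icc (0 : ℝ) t, x s ∉ Set.Ici (1 : ℤ)
  · rw [if_pos h, if_neg (by push Not; exact h), latticePoint_zero]
  · rw [if_neg h, if_pos (by push Not at h; exact h)]

theorem killRight_latticePoint (hx : RegPath x) :
    killRight (fun s : ℝ≥0 => latticePoint n (x s)) =
      fun t : ℝ≥0 => latticePoint n (killPath (Set.Iic (n : ℤ)) (n + 1) x t) := by
  classical
  ext t
  rw [killRight, killPath, max_eq_left t.coe_nonneg]
  simp only [lt_exitTime_iff hx (latticePoint_mem_Iio n)]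
  by_cases h : ∃ s ∈ Set.Icc (0 : ℝ) t, x s ∉ Set.Iic (n : ℤ)
  · rw [if_pos h, if_neg (by push Not; exact h), latticePoint_last]
  · rw [if_neg h, if_pos (by push Not at h; exact h)]

theorem volume_inter_preimage (hx : RegPath x) (C : Set ℤ) {t : ℝ} (ht : 0 ≤ t) :
    volume (Set.Icc 0 t ∩ x ⁻¹' C) = ENNReal.ofReal (occTime C x t) := by
  have hm : MeasurableSet (x ⁻¹' C) := hx.measurable (MeasurableSet.of_discrete)
  have e : occTime C x t = volume.real (Set.Icc 0 t ∩ x ⁻¹' C) := by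
    rw [occTime, intervalIntegral.integral_of_le ht, ← integral_Icc_eq_integral_Ioc]
    have : (fun r => C.indicator (1 : ℤ → ℝ) (x r)) = (x ⁻¹' C).indicator 1 := by
      ext r; by_cases h : x r ∈ C <;> simp [h]
    rw [this, integral_indicator_one hm, measureReal_restrict_apply hm, Set.inter_comm]
  rw [e, ofReal_measureReal ((measure_mono Set.inter_subset_left).trans_lt measure_Icc_lt_top).ne]

theorem occupation_latticePoint (hx : RegPath x) (hBC : ∀ k, latticePoint n k ∈ B ↔ k ∈ C)
    (t : ℝ≥0) : occupation B (fun s : ℝ≥0 => latticePoint n (x s)) t =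
      ENNReal.ofReal (occTime C x t) := by
  rw [← volume_inter_preimage hx C t.coe_nonneg, occupation]
  congr 1
  ext z
  simp only [Set.mem_ofPred_eq, Set.mem_inter_iff, Set.mem_Icc, Set.mem_preimage, hBC, and_assoc]
  refine and_congr_right fun h0 => ?_
  rw [Real.coe_toNNReal z h0]

theorem spendsInfiniteTime_latticePoint (hx : RegPath x)
    (hBC : ∀ k, latticePoint n k ∈ B ↔ k ∈ C) (hC : OccInfinite C x) :
    SpendsInfiniteTime B (fun s : ℝ≥0 => latticePoint n (x s)) := by
  refine ENNReal.eq_top_of_forall_nnreal_le fun r => ?_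
  obtain ⟨s, hs⟩ := hC r
  have hs0 : 0 ≤ s := by
    by_contra! h
    have h1 := hx.occTime_mono C h.le
    rw [occTime_zero] at h1
    linarith [r.coe_nonneg]
  calc (r : ℝ≥0∞) ≤ ENNReal.ofReal (occTime C x s) := by
        rw [← ENNReal.ofReal_coe_nnreal]; exact ENNReal.ofReal_le_ofReal hs.le
    _ = volume (Set.Icc 0 s ∩ x ⁻¹' C) := (volume_inter_preimage hx C hs0).symm
    _ ≤ volume {z : ℝ | 0 ≤ z ∧ latticePoint n (x z.toNNReal) ∈ B} :=
        measure_mono fun z hz => show _ ∧ _ from ⟨hz.1.1, by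
          rw [Real.coe_toNNReal z hz.1.1]; exact (hBC _).2 hz.2⟩

theorem fastForward_latticePoint (hx : RegPath x) (hBC : ∀ k, latticePoint n k ∈ B ↔ k ∈ C) :
    fastForward B (fun s : ℝ≥0 => latticePoint n (x s)) =
      fun t : ℝ≥0 => latticePoint n (ffPath C x t) := by
  ext t
  rw [fastForward, ffPath, max_eq_left t.coe_nonneg, invOcc, NNReal.coe_sInf]
  congr 3
  ext s
  simp only [Set.mem_image, Set.mem_ofPred_eq, occupation_latticePoint hx hBC]
  constructor
  · rintro ⟨u, ⟨h1, h2⟩, rfl⟩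
    refine ⟨h1, ?_⟩
    rw [← ENNReal.ofReal_coe_nnreal] at h2
    exact (ENNReal.ofReal_lt_ofReal_iff_of_nonneg t.coe_nonneg).1 h2
  · rintro ⟨h1, h2⟩
    lift s to ℝ≥0 using h1.le
    refine ⟨s, ⟨by exact_mod_cast h1, ?_⟩, rfl⟩
    rw [← ENNReal.ofReal_coe_nnreal]
    exact (ENNReal.ofReal_lt_ofReal_iff_of_nonneg t.coe_nonneg).2 h2

/-- The level `mesh n - 1` is the lattice point of index `1`. The infimum over reals is attained
because the path takes integer values and is bounded below on compacts. -/
theorem reflectLeft_latticePoint (hx : RegPath x) :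
    reflectLeft (mesh n - 1) (fun s : ℝ≥0 => latticePoint n (x s)) =
      fun t : ℝ≥0 => latticePoint n (reflPath x t) := by
  ext t
  have e : ∀ s : ℝ, min (latticePoint n (x s) - (mesh n - 1)) 0 =
      mesh n * ((min (x s - 1) 0 : ℤ) : ℝ) := fun s => by
    rw [latticePoint, Int.cast_min, mul_min_of_nonneg _ _ (mesh_pos n).le]
    congr 1
    · push_cast; ring
    · simp
  have key : ⨅ s : Set.Iic t, min (latticePoint n (x (s : ℝ≥0)) - (mesh n - 1)) 0 =
      mesh n * (runMin x t : ℝ) := by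
    simp only [e]
    have hlow : ∀ s : Set.Iic t, mesh n * (runMin x t : ℝ) ≤
        mesh n * ((min (x (s : ℝ≥0) - 1) 0 : ℤ) : ℝ) := fun s => by
      refine mul_le_mul_of_nonneg_left (Int.cast_le.2 ?_) (mesh_pos n).le
      exact csInf_le (hx.bddBelow_runMin t)
        ⟨(s : ℝ≥0), ⟨(s : ℝ≥0).coe_nonneg, NNReal.coe_le_coe.2 s.2⟩, rfl⟩
    refine le_antisymm ?_ (le_ciInf hlow)
    obtain ⟨s, hs, hse⟩ := hx.exists_runMin_eq t.coe_nonneg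
    lift s to ℝ≥0 using hs.1
    refine (ciInf_le ⟨_, by rintro _ ⟨s, rfl⟩; exact hlow s⟩
      (⟨s, by exact_mod_cast hs.2⟩ : Set.Iic t)).trans_eq ?_
    rw [hse]
  rw [reflectLeft, key, reflPath, max_eq_left t.coe_nonneg, latticePoint, latticePoint]
  push_cast
  ring

theorem modify_latticePoint (hx : RegPath x) {L : LeftBC} {R : RightBC} (h : IntDomain L R n x) :
    modify L R n (fun s : ℝ≥0 => latticePoint n (x s)) =
      fun t : ℝ≥0 => latticePoint n (intModify L R n x t) := by
  have hl := latticePoint_mem_Ioi n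
  have hr := latticePoint_mem_Iio n
  cases L <;> cases R
  · simp only [modify, intModify, killLeft_latticePoint hx, killRight_latticePoint (hx.killPath _ _)]
  · simp only [modify, intModify, ffRight, fastForward_latticePoint hx hr]
    exact killLeft_latticePoint (hx.ffPath h)
  · simp only [modify, intModify, ffLeft, fastForward_latticePoint hx hl]
    exact killRight_latticePoint (hx.ffPath h)
  · simp only [modify, intModify, ffLeft, ffRight, fastForward_latticePoint hx hl]
    exact fastForward_latticePoint (hx.ffPath h.1) hr
  · simp only [modify, intModify, reflectLeft_latticePoint hx, killRight_latticePoint hx.reflPath]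
  · simp only [modify, intModify, ffRight, reflectLeft_latticePoint hx]
    exact fastForward_latticePoint hx.reflPath hr

theorem inDomain_latticePoint (hx : RegPath x) {L : LeftBC} {R : RightBC}
    (h : IntDomain L R n x) : InDomain L R n (fun s : ℝ≥0 => latticePoint n (x s)) := by
  have hl := latticePoint_mem_Ioi n
  have hr := latticePoint_mem_Iio n
  cases L <;> cases R
  · trivial
  · exact spendsInfiniteTime_latticePoint hx hr h
  · exact spendsInfiniteTime_latticePoint hx hl h
  -- Time in `(-∞, n]` after fast-forwarding at the left is time of the original path in both
  -- half-lines, that is, strictly between the end points.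
  · exact spendsInfiniteTime_latticePoint hx (fun k => and_congr (hl k) (hr k))
      (hx.occInfinite_of_ffPath h.1 h.2)
  · trivial
  · simp only [InDomain, reflectLeft_latticePoint hx]
    exact spendsInfiniteTime_latticePoint hx.reflPath hr h

theorem killPath_zero_of_mem_or (C : Set ℤ) (c : ℤ) (h : x 0 ∈ C ∨ x 0 = c) :
    killPath C c x 0 = x 0 := by
  by_cases h' : x 0 ∈ C
  · exact killPath_zero c h'
  · rw [killPath, if_pos ⟨0, by simp, h'⟩]
    exact (h.resolve_left h').symm

theorem intModify_zero (hx : RegPath x) (h0 : 0 ≤ x 0) (h1 : x 0 ≤ n + 1) {L : LeftBC}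
    {R : RightBC} (h : IntDomain L R n x) (hL : x 0 ≠ 0 ∨ L = .D) (hR : x 0 ≠ n + 1 ∨ R = .D) :
    intModify L R n x 0 = x 0 := by
  have hl : x 0 ≠ 0 → x 0 ∈ Set.Ici (1 : ℤ) := fun h => by simp only [Set.mem_Ici]; omega
  have hr : x 0 ≠ n + 1 → x 0 ∈ Set.Iic (n : ℤ) := fun h => by simp only [Set.mem_Iic]; omega
  have hkl : ∀ y : ℝ → ℤ, y 0 = x 0 → killPath (Set.Ici 1) 0 y 0 = x 0 := fun y hy => by
    rw [killPath_zero_of_mem_or, hy]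
    rw [hy]
    by_cases hx0 : x 0 = 0
    exacts [Or.inr hx0, Or.inl (hl hx0)]
  have hkr : ∀ y : ℝ → ℤ, y 0 = x 0 → killPath (Set.Iic (n : ℤ)) (n + 1) y 0 = x 0 := fun y hy => by
    rw [killPath_zero_of_mem_or, hy]
    rw [hy]
    by_cases hx0 : x 0 = n + 1
    exacts [Or.inr hx0, Or.inl (hr hx0)]
  have hfr : ∀ y : ℝ → ℤ, RegPath y → OccInfinite (Set.Iic (n : ℤ)) y → R = .N → y 0 = x 0 →
      ffPath (Set.Iic (n : ℤ)) y 0 = x 0 := fun y hy ho hRN hy0 => by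
    rw [hy.ffPath_zero ho, hy0]
    rw [hy0]
    exact hr (hR.resolve_right (by simp [hRN]))
  have hl' : L ≠ .D → x 0 ∈ Set.Ici (1 : ℤ) := fun h => hl (hL.resolve_right h)
  cases L <;> cases R
  · exact hkr _ (hkl x rfl)
  · exact hkl _ (hfr x hx h rfl rfl)
  · exact hkr _ (hx.ffPath_zero h (hl' (by simp)))
  · exact hfr _ (hx.ffPath h.1) h.2 rfl (hx.ffPath_zero h.1 (hl' (by simp)))
  · exact hkr _ (hx.reflPath_zero (hl' (by simp)))
  · exact hfr _ hx.reflPath h rfl (hx.reflPath_zero (hl' (by simp)))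

theorem RegPath.isCadlag (hx : RegPath x) : IsCadlag fun t : ℝ≥0 => latticePoint n (x t) := by
  intro t
  constructor
  · have h1 : Tendsto (fun s : ℝ≥0 => (s : ℝ)) (𝓝[≥] t) (𝓝[≥] (t : ℝ)) :=
      tendsto_nhdsWithin_iff.2 ⟨(NNReal.continuous_coe.tendsto t).mono_left nhdsWithin_le_nhds,
        by filter_upwards [self_mem_nhdsWithin] with s hs using NNReal.coe_le_coe.2 hs⟩
    refine tendsto_const_nhds.congr' ?_
    filter_upwards [h1.eventually (hx.rc_Ici t)] with s hs
    rw [hs]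
  · obtain ⟨l, hl⟩ := hx.ll t
    refine ⟨latticePoint n l, ?_⟩
    have h1 : Tendsto (fun s : ℝ≥0 => (s : ℝ)) (𝓝[<] t) (𝓝[<] (t : ℝ)) :=
      tendsto_nhdsWithin_iff.2 ⟨(NNReal.continuous_coe.tendsto t).mono_left nhdsWithin_le_nhds,
        by filter_upwards [self_mem_nhdsWithin] with s hs using NNReal.coe_lt_coe.2 hs⟩
    refine tendsto_const_nhds.congr' ?_
    filter_upwards [h1.eventually hl] with s hs
    rw [hs]

theorem eventually_eq_of_tendsto_latticePoint {α : Type*} {F : Filter α} {y : α → ℤ} {k : ℤ}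
    (h : Tendsto (fun a => latticePoint n (y a)) F (𝓝 (latticePoint n k))) :
    ∀ᶠ a in F, y a = k := by
  filter_upwards [h.eventually (Metric.ball_mem_nhds _ (mesh_pos n))] with a ha
  rw [Real.dist_eq, latticePoint, latticePoint, add_sub_add_left_eq_sub, ← mul_sub,
    abs_mul, abs_of_pos (mesh_pos n)] at ha
  have h1 : |((y a : ℝ) - k)| < 1 := by
    by_contra! hc
    exact absurd (mul_le_mul_of_nonneg_left hc (mesh_pos n).le) (not_le.2 (by simpa using ha))
  have h2 : |y a - k| < 1 := by exact_mod_cast h1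
  exact sub_eq_zero.1 (Int.abs_lt_one_iff.1 h2)

theorem exists_eventually_eq_of_tendsto {α : Type*} {F : Filter α} {y : α → ℤ} {l : ℝ}
    (h : Tendsto (fun a => latticePoint n (y a)) F (𝓝 l)) : ∃ k, ∀ᶠ a in F, y a = k := by
  rcases F.eq_or_neBot with rfl | _
  · exact ⟨0, by simp⟩
  have h1 : Tendsto (fun a => (y a : ℝ)) F (𝓝 ((l + 1) / mesh n)) := by
    refine ((h.add_const 1).div_const (mesh n)).congr fun a => ?_
    rw [latticePoint, div_eq_iff (mesh_pos n).ne']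
    ring
  -- The integers are closed in `ℝ`, so the limit is a lattice point; discreteness then makes the
  -- path eventually constant.
  have h2 : (l + 1) / mesh n ∈ Set.range ((↑) : ℤ → ℝ) :=
    Int.isClosedEmbedding_coe_real.isClosed_range.mem_of_tendsto h1
      (Eventually.of_forall fun a => ⟨y a, rfl⟩)
  obtain ⟨k, hk⟩ := h2
  refine ⟨k, eventually_eq_of_tendsto_latticePoint (n := n) ?_⟩
  have : latticePoint n k = l := by
    rw [latticePoint, hk, mul_div_cancel₀ _ (mesh_pos n).ne']; ring
  rwa [this]

theorem regPath_of_isCadlag {y : ℝ≥0 → ℤ} (hy : IsCadlag fun t => latticePoint n (y t)) :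
    RegPath fun t => y t.toNNReal := by
  have e : (fun t : ℝ => y t.toNNReal) = fun t => (fun t : ℝ => y t.toNNReal) (max t 0) := by
    ext t
    simp only [Real.toNNReal, max_assoc, max_self]
  rw [e]
  refine RegPath.of_max (y := fun t : ℝ => y t.toNNReal) (fun t ht => ?_) fun t ht => ?_
  · refine eventually_eq_of_tendsto_latticePoint (n := n) ?_
    -- The filters on `ℝ≥0` are reached by `Real.toNNReal`, which is monotone on the right of `t`
    -- and, for `0 < t`, strictly so on the left.
    refine Tendsto.comp (y := 𝓝[≥] t.toNNReal) (g := fun s => latticePoint n (y s))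
      (hy t.toNNReal).1 ?_
    refine tendsto_nhdsWithin_iff.2 ⟨(continuous_real_toNNReal.tendsto t).mono_left
      nhdsWithin_le_nhds, ?_⟩
    filter_upwards [self_mem_nhdsWithin] with s hs
    exact Real.toNNReal_le_toNNReal (le_of_lt hs)
  · obtain ⟨l, hl⟩ := (hy t.toNNReal).2
    refine exists_eventually_eq_of_tendsto (n := n) (l := l) ?_
    refine Tendsto.comp (y := 𝓝[<] t.toNNReal) (g := fun s => latticePoint n (y s)) hl ?_
    refine tendsto_nhdsWithin_iff.2 ⟨(continuous_real_toNNReal.tendsto t).mono_left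
      nhdsWithin_le_nhds, ?_⟩
    filter_upwards [self_mem_nhdsWithin] with s hs
    exact (Real.toNNReal_lt_toNNReal_iff ht).2 hs

end

section

/-! ### The lattice-valued process -/

variable {Ω : Type*} [MeasurableSpace Ω] {P : Measure Ω} {n : ℕ}

/-- The free process as a process with values in the integers and regular paths. -/
theorem exists_intProcess {φ : Measure ℝ} {Y : ℝ≥0 → Ω → ℝ} (hmeas : ∀ t, Measurable (Y t))
    (hcadlag : ∀ ω, IsCadlag (fun t => Y t ω))
    (hY : IsMarkovChain P (latticePoint n) (freeRates φ (mesh n)) Y) :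
    ∃ (X : ℝ → Ω → ℤ) (p : ℝ≥0 → ℤ → ℤ → ℝ), IsProc X ∧
      (∀ᵐ ω ∂P, ∀ t : ℝ≥0, Y t ω = latticePoint n (X t ω)) ∧
      IsTransitionFunction (walkRates (coeff φ (mesh n))) p ∧
      ∀ (k : ℕ) (t : Fin (k + 1) → ℝ≥0), Monotone t → ∀ s : Fin (k + 1) → ℤ,
        P.real {ω | ∀ i, X (t i) ω = s i} = P.real {ω | X (t 0) ω = s 0} *
          ∏ i : Fin k, p (t i.succ - t i.castSucc) (s i.castSucc) (s i.succ) := by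
  classical
  obtain ⟨p, hp, hfdd⟩ := hY.markov
  -- The paths that leave the lattice are contained in this measurable null set, on which the
  -- process is set to `0`.
  set N := toMeasurable P {ω | ¬ ∀ t, Y t ω ∈ Set.range (latticePoint n)} with hN
  have hN0 : ∀ᵐ ω ∂P, ω ∉ N := by
    refine measure_eq_zero_iff_ae_notMem.1 ?_
    rw [hN, measure_toMeasurable]
    exact hY.mem_range
  have hNm : MeasurableSet N := measurableSet_toMeasurable _ _
  set X : ℝ → Ω → ℤ := fun t ω => if ω ∈ N then 0 else latticeIdx n (Y t.toNNReal ω) with hX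
  have hXY : ∀ ω, ω ∉ N → ∀ t : ℝ≥0, Y t ω = latticePoint n (X t ω) := by
    intro ω hω t
    have h1 : ∀ t, Y t ω ∈ Set.range (latticePoint n) := by
      by_contra h
      exact hω (subset_toMeasurable _ _ h)
    obtain ⟨k, hk⟩ := h1 t
    rw [hX]
    simp only [if_neg hω, Real.toNNReal_coe]
    rw [← hk, latticeIdx_latticePoint]
  have hae : ∀ᵐ ω ∂P, ∀ t : ℝ≥0, Y t ω = latticePoint n (X t ω) := by
    filter_upwards [hN0] with ω hω using hXY ω hω
  have hreal : ∀ (k : ℕ) (t : Fin k → ℝ≥0) (s : Fin k → ℤ),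
      P.real {ω | ∀ i, X (t i) ω = s i} = P.real {ω | ∀ i, Y (t i) ω = latticePoint n (s i)} := by
    intro k t s
    refine measureReal_congr ?_
    filter_upwards [hae] with ω hω
    refine propext (forall_congr' fun i => ?_)
    rw [hω]
    exact (latticePoint_injective n).eq_iff.symm
  -- `freeRates` unfolds to `walkRates` of the coefficients, so the given transition function is
  -- used as it is.
  refine ⟨X, p, ⟨fun t => ?_, fun ω => ?_⟩, hae, hp, fun k t ht s => ?_⟩
  · exact Measurable.ite hNm measurable_const ((measurable_latticeIdx n).comp (hmeas _))
  · by_cases hω : ω ∈ N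
    · have : (fun t => X t ω) = fun _ => 0 := by ext t; rw [hX]; simp only [if_pos hω]
      rw [this]
      exact regPath_const 0
    · have : (fun t => X t ω) = fun t : ℝ => (fun s : ℝ≥0 => X s ω) t.toNNReal := by
        ext t; simp only [hX, if_neg hω, Real.toNNReal_coe]
      rw [this]
      refine regPath_of_isCadlag (n := n) (y := fun s : ℝ≥0 => X s ω) ?_
      simp only [← hXY ω hω]
      exact hcadlag ω
  · have h0 : P.real {ω | X (t 0) ω = s 0} = P.real {ω | Y (t 0) ω = latticePoint n (s 0)} := by
      simpa [Fin.forall_fin_one] using hreal 1 (fun _ => t 0) fun _ => s 0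
    rw [hreal, hfdd k t ht s, h0]

/-- `V` need only agree with the lattice image of `Z` off a null set, which is why the path maps
have to be identified almost surely only. -/
theorem isMarkovChain_of_martPair [IsProbabilityMeasure P] {Z : ℝ → Ω → ℤ} (hZ : IsProc Z)
    (hZr : ∀ t ω, 0 ≤ Z t ω ∧ Z t ω ≤ n + 1) {Q : Matrix (Fin (n + 2)) (Fin (n + 2)) ℝ}
    (hQ : ∀ i j, i ≠ j → 0 ≤ Q i j) (hQ0 : ∀ i, ∑ j, Q i j = 0)
    (hM : ∀ g : Fin (n + 2) → ℝ,
      MartPair P Z (fun k => g (gridIdx n k)) (fun k => (Q.mulVec g) (gridIdx n k)))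
    {V : ℝ≥0 → Ω → ℝ} (hV : ∀ᵐ ω ∂P, ∀ t : ℝ≥0, V t ω = latticePoint n (Z t ω)) :
    IsMarkovChain P (gridPoint n) Q V where
  aemeasurable t := by
    refine ⟨fun ω => latticePoint n (Z t ω), (measurable_of_countable (latticePoint n)).comp (hZ.meas t), ?_⟩
    filter_upwards [hV] with ω hω using hω t
  mem_range := by
    filter_upwards [hV] with ω hω t
    refine ⟨gridIdx n (Z t ω), ?_⟩
    rw [hω, gridPoint_eq, gridIdx_val (hZr t ω).1 (hZr t ω).2]
  cadlag := by
    filter_upwards [hV] with ω hω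
    simp only [hω]
    exact (hZ.reg ω).isCadlag
  markov := by
    refine ⟨_, isTransitionFunction_expMatrix hQ hQ0, fun k t ht s => ?_⟩
    have key : ∀ (k : ℕ) (t : Fin k → ℝ≥0) (s : Fin k → Fin (n + 2)),
        P.real {ω | ∀ i, V (t i) ω = gridPoint n (s i)} =
          P.real {ω | ∀ i, gridIdx n (Z (t i) ω) = s i} := by
      intro k t s
      refine measureReal_congr ?_
      filter_upwards [hV] with ω hω
      refine propext (forall_congr' fun i => ?_)
      rw [hω, gridPoint_eq, (latticePoint_injective n).eq_iff]
      constructor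
      · intro h
        rw [h, gridIdx_natCast]
      · intro h
        rw [← h, gridIdx_val (hZr _ ω).1 (hZr _ ω).2]
    have h0 : P.real {ω | V (t 0) ω = gridPoint n (s 0)} =
        P.real {ω | gridIdx n (Z (t 0) ω) = s 0} := by
      simpa [Fin.forall_fin_one] using key 1 (fun _ => t 0) fun _ => s 0
    rw [key, h0]
    exact fdd_eq_expMatrix hZ (gridIdx n) hM k t ht s

end

end GrunwaldChain

end

/-! ### Assembly of the theorem -/

open MeasureTheory GrunwaldChain in
theorem proposition3p5
    -- the jump measure and the mesh size
    (φ : Measure ℝ) (hφ : H0 φ) (n : ℕ) (hn : 1 ≤ n)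
    -- the process `Y^h`, started in `Grid_h`
    {Ω : Type*} [MeasurableSpace Ω] (P : Measure Ω) [IsProbabilityMeasure P]
    (Y : NNReal → Ω → ℝ) (hmeas : ∀ t, Measurable (Y t))
    (hcadlag : ∀ ω, IsCadlag (fun t => Y t ω))
    (hY : IsMarkovChain P (latticePoint n) (freeRates φ (mesh n)) Y)
    (hY0 : ∀ᵐ ω ∂P, Y 0 ω ∈ Set.range (gridPoint n))
    -- the boundary conditions
    (L : LeftBC) (R : RightBC) :
    -- `Y^{LR,h}` is well defined
    (∀ᵐ ω ∂P, InDomain L R n (fun t => Y t ω)) ∧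
    -- it is the Markov chain on `Grid_h` with rate matrix `G_{n+2}^{LR}`
    IsMarkovChain P (gridPoint n) (gridRates φ L R n)
      (fun t ω => modify L R n (fun u => Y u ω) t) ∧
    -- it starts where `Y^h` starts, if this is an interior point or a killing endpoint
    (∀ᵐ ω ∂P, (Y 0 ω ≠ -1 ∨ L = LeftBC.D) → (Y 0 ω ≠ 1 ∨ R = RightBC.D) →
      modify L R n (fun u => Y u ω) 0 = Y 0 ω) := by
  obtain ⟨X, p, hX, hXY, hp, hfdd⟩ := exists_intProcess hmeas hcadlag hY
  have hc := isCenteredSkipFree_coeff hφ (mesh_pos n)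
  have hT := hasTransition_of_fdd (P := P) hX.meas hfdd
  obtain ⟨Z, hZ, hZr, hM, hae⟩ := exists_boundaryProcess hn hc hX hT hp L R
  have hpath : ∀ᵐ ω ∂P, (fun t => Y t ω) = fun t : NNReal => latticePoint n (X t ω) := by
    filter_upwards [hXY] with ω hω using funext hω
  refine ⟨?_, isMarkovChain_of_martPair hZ hZr (gridRates_nonneg hn hc L R)
    (gridRates_row_sum hn hc L R) hM ?_, ?_⟩
  · filter_upwards [hpath, hae] with ω h1 h2
    rw [h1]
    exact inDomain_latticePoint (hX.reg ω) h2.1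
  · filter_upwards [hpath, hae] with ω h1 h2 t
    rw [h1, modify_latticePoint (hX.reg ω) h2.1, ← h2.2]
  · filter_upwards [hpath, hae, hY0] with ω h1 h2 ⟨i, hi⟩ hL hR
    -- Starting in the grid bounds the initial index by `0` and `n + 1`, so that an excluded end
    -- point leaves an index strictly inside.
    have hi0 : X 0 ω = (i : ℕ) := by
      have h3 := congrFun h1 0
      simp only [NNReal.coe_zero] at h3
      rw [gridPoint_eq, h3] at hi
      exact (latticePoint_injective n hi).symm
    have h3 : Y 0 ω = latticePoint n (X 0 ω) := by rw [← hi, gridPoint_eq, hi0]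
    have hlt := i.2
    rw [h1, modify_latticePoint (hX.reg ω) h2.1]
    simp only [NNReal.coe_zero]
    rw [intModify_zero (hX.reg ω) (by omega) (by omega) h2.1 ?_ ?_]
    · exact h3.symm
    · refine hL.imp_left fun h h' => h ?_
      rw [h3, h', latticePoint_zero]
    · refine hR.imp_left fun h h' => h ?_
      rw [h3, h', latticePoint_last]
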